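/- **Setting.** Let $\Omega=[0,1]^2$ with periodic boundary conditions, and let $\mathcal H$ be the Hilbert space of real vector fields $u\in L^2_{\rm per}(\Omega;\mathbb R^2)$ with $\int_\Omega u\,dx=0$ and $\nabla\cdot u=0$, with the $L^2$ norm. Let $A$ be the Stokes operator on $\mathcal H$, with orthonormal eigenfunctions $\phi_k$ and eigenvalues $\lambda_k=4\pi^2|k|^2$, $k\in\mathbb Z^2\setminus\{0\}$, where $\phi_k(x)=\sqrt2\,\frac{k^\perp}{|k|}\cos(2\pi k\cdot x)$ for $k$ in one half of the lattice and $\phi_k(x)=\sqrt2\,\frac{k^\perp}{|k|}\sin(2\pi k\cdot x)$ in the opposite half. Put $A^su=\sum_k\lambda_k^s\langle u,\phi_k\rangle\phi_k$ and $\|u\|_s^2=\sum_k\lambda_k^s\langle u,\phi_k\rangle^2$, $\mathcal H^s=\{u:\|u\|_s<\infty\}$. Let $P^N$ be the orthogonal projection of $\mathcal H$ onto $\mathrm{span}\{\phi_k:|k|\le N\}$ ($|\cdot|$ Euclidean). Let $\nu>0$, $T>0$, and $\psi\in C([0,T];\mathcal H^\gamma)$ for some $\gamma>0$. For $u\in\mathcal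 H$ let $v\in C([0,T];\mathcal H)$ be the (weak) solution of the Stokes equations $$\frac{dv}{dt}+\nu Av=\psi,\qquad v(0)=u .$$ For $J$ given initial positions $z_{j,0}\in\mathbb R^2$, let $z_j\in C([0,T];\mathbb R^2)$ solve $z_j(t)=z_{j,0}+\int_0^t v(z_j(s),s)\,ds$ (where $v(\cdot,s)$, $s>0$, is the continuous periodic representative), and for $K$ given times $t_k\in(0,T]$ let $\mathcal G(u)=(z_j(t_k))_{j\le J,k\le K}\in\mathbb R^{2JK}$. Let $\Gamma$ be a symmetric positive definite $2JK\times 2JK$ matrix, $y\in\mathbb R^{2JK}$, and $|\cdot|_\Gamma=|\Gamma^{-1/2}\cdot|$. Let $\beta>0$, $\alpha>1$, let $\mu_0=\mathcal N(0,\beta A^{-\alpha})$ be the prior on $\mathcal H$, and let $\mu$ and $\mu^N$ be the posterior probability measures $$\frac{d\mu}{d\mu_0}(u)\propto\exp\Bigl(-\tfrac12|y-\mathcal G(u)|_\Gamma^2\Bigr),\qquad \frac{d\mu^N}{d\mu_0}(u)\propto\exp\Bigl(-\tfrac12|y-\mathcal G(P^Nu)|_\Gamma^2\Bigr).$$ The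 Hellinger distance is $d_{\rm Hell}(\mu,\mu')=\Bigl(\tfrac12\int\bigl(\sqrt{d\mu/d\mu_0}-\sqrt{d\mu'/d\mu_0}\bigr)^2d\mu_0\Bigr)^{1/2}$. **Theorem.** For $\mu_0$-almost every $u$, the tracer equations have unique solutions for the initial data $u$ and $P^Nu$, $N\ge0$, and $\mu$, $\mu^N$ are well-defined probability measures with finite second moments. For any $q<\alpha-1$ there is a constant $c>0$, independent of $N$, such that for all integers $N\ge1$ $$d_{\rm Hell}(\mu,\mu^N)\le c\,N^{-q},$$ and the means $m,m^N\in\mathcal H$ and (centred) covariance operators $\mathcal C,\mathcal C^N$ of $\mu,\mu^N$ satisfy $$\|m-m^N\|_{\mathcal H}\le cN^{-q},\qquad \|\mathcal C-\mathcal C^N\|_{\mathcal L(\mathcal H)}\le cN^{-q}.$$ -/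

import Mathlib

open MeasureTheory ProbabilityTheory Set Filter Topology
open scoped RealInnerProductSpace ContDiff Matrix

noncomputable section

namespace StokesDA

/-- The Euclidean plane. -/
abbrev Plane : Type := EuclideanSpace ℝ (Fin 2)

/-- The spatial domain `Ω`: the unit square. -/
def unitSquare : Set Plane := {x | ∀ i, x i ∈ Icc (0 : ℝ) 1}

/-- Lebesgue measure on the unit square. -/
abbrev squareMeasure : Measure Plane := volume.restrict unitSquare

/-- Functions on the plane with period `1` in each coordinate direction. -/
def IsPeriodic {F : Type*} (g : Plane → F) : Prop :=
  ∀ (i : Fin 2) (x : Plane), g (x + EuclideanSpace.single i 1) = g x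

/-- The classical divergence of a vector field on the plane. -/
def divergence (w : Plane → Plane) (x : Plane) : ℝ :=
  ∑ i, fderiv ℝ w x (EuclideanSpace.single i 1) i

/-- Smooth, periodic, divergence-free vector fields: the test fields for the Stokes equations. -/
structure IsTestField (w : Plane → Plane) : Prop where
  smooth : ContDiff ℝ ∞ w
  periodic : IsPeriodic w
  div_free : ∀ x, divergence w x = 0

/-! ### Auxiliary facts about integration over the unit square -/

theorem isCompact_unitSquare : IsCompact unitSquare := by
  have h : unitSquare = WithLp.ofLp ⁻¹' (Icc (0 : Fin 2 → ℝ) 1) := by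
    ext x
    simp [unitSquare, Pi.le_def, forall_and]
  rw [h]
  exact (EuclideanSpace.equiv (Fin 2) ℝ).toHomeomorph.isCompact_preimage.2 isCompact_Icc

instance isFiniteMeasure_squareMeasure : IsFiniteMeasure squareMeasure :=
  ⟨by simpa using isCompact_unitSquare.measure_lt_top⟩

theorem memLp_of_continuous {F : Type*} [NormedAddCommGroup F] [SecondCountableTopology F]
    {g : Plane → F} (hg : Continuous g) :
    MemLp g 2 squareMeasure := by
  obtain ⟨C, hC⟩ := isCompact_unitSquare.exists_bound_of_continuousOn hg.continuousOn
  borelize F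
  refine MemLp.of_bound hg.aestronglyMeasurable C ?_
  exact (ae_restrict_iff' isCompact_unitSquare.measurableSet).2 (ae_of_all _ hC)

/-- The divergence of a periodic `C¹` field has zero integral over the unit square. -/
theorem integral_divergence_eq_zero {w : Plane → Plane} (hw : ContDiff ℝ 1 w)
    (hp : IsPeriodic w) : ∫ x in unitSquare, divergence w x = 0 := by
  let L : (Fin 2 → ℝ) ≃L[ℝ] Plane := (EuclideanSpace.equiv (Fin 2) ℝ).symm
  have hL : ∀ x, L x = WithLp.toLp 2 x := fun x => rfl
  let M : Plane →L[ℝ] (Fin 2 → ℝ) := (EuclideanSpace.equiv (Fin 2) ℝ : Plane →L[ℝ] _)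
  have hcont : Continuous (divergence w) := by
    unfold divergence
    have := hw.continuous_fderiv one_ne_zero
    fun_prop
  have hpre : WithLp.toLp 2 ⁻¹' unitSquare = Icc (0 : Fin 2 → ℝ) 1 := by
    ext x
    simp [unitSquare, Pi.le_def, forall_and]
  have hmp := PiLp.volume_preserving_toLp (Fin 2)
  have hemb : MeasurableEmbedding (WithLp.toLp 2 : (Fin 2 → ℝ) → Plane) :=
    (MeasurableEquiv.toLp 2 (Fin 2 → ℝ)).measurableEmbedding
  rw [← hmp.setIntegral_preimage_emb hemb, hpre]
  have key := integral_divergence_of_hasFDerivAt_off_countable (n := 1) (0 : Fin 2 → ℝ) 1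
    (by intro i; simp) (fun x => M (w (L x)))
    (fun x => M ∘L (fderiv ℝ w (L x)) ∘L (L : (Fin 2 → ℝ) →L[ℝ] Plane)) ∅ countable_empty
    (by
      have := hw.continuous
      fun_prop)
    (by
      intro x _
      have h1 : HasFDerivAt w (fderiv ℝ w (L x)) (L x) :=
        (hw.differentiable one_ne_zero _).hasFDerivAt
      exact M.hasFDerivAt.comp x (h1.comp x L.hasFDerivAt))
    (by
      refine ContinuousOn.integrableOn_compact isCompact_Icc (Continuous.continuousOn ?_)
      have := hcont.comp L.continuous
      exact this)
  have e1 : ∀ x : Fin 2 → ℝ, divergence w (WithLp.toLp 2 x) =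
      ∑ i, (M ∘L (fderiv ℝ w (L x)) ∘L (L : (Fin 2 → ℝ) →L[ℝ] Plane)) (Pi.single i 1) i :=
    fun x => rfl
  simp_rw [e1]
  rw [key]
  refine Finset.sum_eq_zero fun i _ => ?_
  rw [sub_eq_zero]
  refine integral_congr_ae (ae_of_all _ fun x => ?_)
  have : L (i.insertNth ((1 : Fin 2 → ℝ) i) x) =
      L (i.insertNth ((0 : Fin 2 → ℝ) i) x) + EuclideanSpace.single i 1 := by
    ext j
    rw [hL, hL]
    refine Fin.succAboveCases i ?_ (fun m => ?_) j <;> simp [Fin.succAbove_ne]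
  simp only
  rw [this, hp i]

/-! ### The space `𝓗` -/

/-- Square integrable vector fields on the unit square. -/
abbrev L2Field : Type := Lp Plane 2 squareMeasure

/-- The `L²` pairing `∫_Ω u · w dx` of a square integrable field with a function. -/
def pairing (u : L2Field) (w : Plane → Plane) : ℝ :=
  ∫ x in unitSquare, ⟪u x, w x⟫

theorem pairing_eq_inner (u : L2Field) {w : Plane → Plane} (hw : Continuous w) :
    pairing u w = ⟪u, (memLp_of_continuous hw).toLp w⟫ := by
  rw [L2.inner_def]
  refine integral_congr_ae ?_
  filter_upwards [(memLp_of_continuous hw).coeFn_toLp] with x hx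
  rw [hx]

theorem continuous_gradient {g : Plane → ℝ} (hg : ContDiff ℝ ∞ g) : Continuous (gradient g) := by
  unfold gradient
  exact (LinearIsometryEquiv.continuous _).comp (hg.continuous_fderiv (by simp))

theorem integral_eq_zero_iff_pairing (u : L2Field) :
    ∫ x in unitSquare, u x = 0 ↔ ∀ c : Plane, pairing u (fun _ => c) = 0 := by
  have hu : Integrable u squareMeasure := (Lp.memLp u).integrable (by norm_num)
  have h : ∀ c : Plane, pairing u (fun _ => c) = ⟪c, ∫ x in unitSquare, u x⟫ := by
    intro c
    rw [← integral_inner hu]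
    simp only [pairing, real_inner_comm]
  simp_rw [h]
  exact ⟨fun h0 c => by rw [h0, inner_zero_right], fun h0 => inner_self_eq_zero.1 (h0 _)⟩

/-- The (real) space `𝓗` of square integrable vector fields on the unit square with zero mean
which are divergence free as periodic fields, in the sense of distributions. -/
def stokesSpace : Submodule ℝ L2Field where
  carrier := {u | (∫ x in unitSquare, u x = 0) ∧
    ∀ g : Plane → ℝ, ContDiff ℝ ∞ g → IsPeriodic g → pairing u (gradient g) = 0}
  zero_mem' := by
    refine ⟨(integral_eq_zero_iff_pairing _).2 fun c => ?_, fun g hg _ => ?_⟩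
    · rw [pairing_eq_inner _ continuous_const, inner_zero_left]
    · rw [pairing_eq_inner _ (continuous_gradient hg), inner_zero_left]
  add_mem' := by
    rintro u v ⟨hu, hu'⟩ ⟨hv, hv'⟩
    rw [integral_eq_zero_iff_pairing] at hu hv
    refine ⟨(integral_eq_zero_iff_pairing _).2 fun c => ?_, fun g hg hp => ?_⟩
    · have h1 := hu c
      have h2 := hv c
      rw [pairing_eq_inner _ continuous_const] at h1 h2 ⊢
      rw [inner_add_left, h1, h2, add_zero]
    · have h1 := hu' g hg hp
      have h2 := hv' g hg hp
      rw [pairing_eq_inner _ (continuous_gradient hg)] at h1 h2 ⊢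
      rw [inner_add_left, h1, h2, add_zero]
  smul_mem' := by
    rintro a u ⟨hu, hu'⟩
    rw [integral_eq_zero_iff_pairing] at hu
    refine ⟨(integral_eq_zero_iff_pairing _).2 fun c => ?_, fun g hg hp => ?_⟩
    · have h1 := hu c
      rw [pairing_eq_inner _ continuous_const] at h1 ⊢
      rw [real_inner_smul_left, h1, mul_zero]
    · have h1 := hu' g hg hp
      rw [pairing_eq_inner _ (continuous_gradient hg)] at h1 ⊢
      rw [real_inner_smul_left, h1, mul_zero]

/-- The Hilbert space `𝓗`, with the `L²` inner product. -/
abbrev VelocitySpace : Type := stokesSpace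

theorem isClosed_stokesSpace : IsClosed (stokesSpace : Set L2Field) := by
  have h : (stokesSpace : Set L2Field) =
      (⋂ c : Plane, {u | pairing u (fun _ => c) = 0}) ∩
        ⋂ (g : Plane → ℝ) (_ : ContDiff ℝ ∞ g) (_ : IsPeriodic g),
          {u | pairing u (gradient g) = 0} := by
    ext u
    simp only [mem_inter_iff, mem_iInter, Set.mem_ofPred_eq, ← integral_eq_zero_iff_pairing]
    exact Iff.rfl
  rw [h]
  refine (isClosed_iInter fun c => ?_).inter
    (isClosed_iInter fun g => isClosed_iInter fun hg => isClosed_iInter fun _ => ?_)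
  · simp_rw [pairing_eq_inner _ (continuous_const : Continuous fun _ : Plane => c)]
    exact isClosed_eq (by fun_prop) continuous_const
  · simp_rw [pairing_eq_inner _ (continuous_gradient hg)]
    exact isClosed_eq (by fun_prop) continuous_const

instance completeSpace_velocitySpace : CompleteSpace VelocitySpace :=
  isClosed_stokesSpace.completeSpace_coe

instance measurableSpace_velocitySpace : MeasurableSpace VelocitySpace := borel VelocitySpace

instance borelSpace_velocitySpace : BorelSpace VelocitySpace := ⟨rfl⟩

/-! ### The eigenbasis of the Stokes operator -/

/-- The index set `ℤ² \ {0}` of wave vectors. -/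
abbrev WaveVector : Type := {k : Fin 2 → ℤ // k ≠ 0}

/-- The Euclidean length `|k|` of a wave vector. -/
def waveLength (k : WaveVector) : ℝ := √((k.1 0 : ℝ) ^ 2 + (k.1 1 : ℝ) ^ 2)

/-- The eigenvalue `λ_k = 4π²|k|²` of the Stokes operator `A`. -/
def eigenvalue (k : WaveVector) : ℝ := 4 * Real.pi ^ 2 * waveLength k ^ 2

/-- The scalar profile of the `k`-th mode: `cos` on a half-lattice, `sin` on the opposite half. -/
def profile (k : WaveVector) : ℝ → ℝ :=
  if 0 < k.1 0 ∨ (k.1 0 = 0 ∧ 0 < k.1 1) then Real.cos else Real.sin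

/-- The real eigenfunctions of the Stokes operator on the torus,
`φ_k(x) = √2 cos(2π k·x) k^⊥/|k|` or `√2 sin(2π k·x) k^⊥/|k|`, where `k^⊥ = (-k₁, k₀)`. -/
def modeField (k : WaveVector) (x : Plane) : Plane :=
  (√2 / waveLength k * profile k (2 * Real.pi * (k.1 0 * x 0 + k.1 1 * x 1))) •
    !₂[-(k.1 1 : ℝ), (k.1 0 : ℝ)]

theorem waveLength_pos (k : WaveVector) : 0 < waveLength k := by
  refine Real.sqrt_pos.2 ?_
  have hk : k.1 0 ≠ 0 ∨ k.1 1 ≠ 0 := by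
    by_contra! h
    exact k.2 (by ext i; fin_cases i <;> simp [h.1, h.2])
  rcases hk with h | h
  · have : (k.1 0 : ℝ) ≠ 0 := by exact_mod_cast h
    positivity
  · have : (k.1 1 : ℝ) ≠ 0 := by exact_mod_cast h
    positivity

theorem profile_contDiff (k : WaveVector) : ContDiff ℝ ∞ (profile k) := by
  unfold profile
  split_ifs
  · exact Real.contDiff_cos
  · exact Real.contDiff_sin

theorem profile_add_int_mul (k : WaveVector) (θ : ℝ) (n : ℤ) :
    profile k (θ + n * (2 * Real.pi)) = profile k θ := by
  unfold profile
  split_ifs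
  · exact Real.cos_add_int_mul_two_pi θ n
  · exact Real.sin_add_int_mul_two_pi θ n

/-- The phase `2π k·x` as a continuous linear functional. -/
def phase (k : WaveVector) : Plane →L[ℝ] ℝ :=
  (2 * Real.pi) • ((k.1 0 : ℝ) • EuclideanSpace.proj (0 : Fin 2) +
    (k.1 1 : ℝ) • EuclideanSpace.proj (1 : Fin 2))

theorem phase_apply (k : WaveVector) (x : Plane) :
    phase k x = 2 * Real.pi * (k.1 0 * x 0 + k.1 1 * x 1) := by
  simp [phase]
  ring

theorem phase_single (k : WaveVector) (i : Fin 2) :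
    phase k (EuclideanSpace.single i 1) = k.1 i * (2 * Real.pi) := by
  rw [phase_apply]
  fin_cases i <;> simp <;> ring

/-- A field of the form `F(2π k·x) c`. -/
def planeWave (k : WaveVector) (F : ℝ → ℝ) (c : Plane) (x : Plane) : Plane := F (phase k x) • c

theorem planeWave_contDiff (k : WaveVector) {F : ℝ → ℝ} {n : WithTop ℕ∞} (hF : ContDiff ℝ n F)
    (c : Plane) : ContDiff ℝ n (planeWave k F c) :=
  (hF.comp (phase k).contDiff).smul contDiff_const

theorem planeWave_periodic (k : WaveVector) {F : ℝ → ℝ}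
    (hF : ∀ (θ : ℝ) (n : ℤ), F (θ + n * (2 * Real.pi)) = F θ)
    (c : Plane) : IsPeriodic (planeWave k F c) := by
  intro i x
  simp only [planeWave, map_add, phase_single, hF]

theorem planeWave_hasFDerivAt (k : WaveVector) {F F' : ℝ → ℝ} (hF : ∀ θ, HasDerivAt F (F' θ) θ)
    (c x : Plane) :
    HasFDerivAt (planeWave k F c) ((F' (phase k x) • phase k).smulRight c) x :=
  ((hF _).comp_hasFDerivAt x (phase k).hasFDerivAt).smul_const c

theorem planeWave_divergence (k : WaveVector) {F F' : ℝ → ℝ} (hF : ∀ θ, HasDerivAt F (F' θ) θ)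
    (c x : Plane) :
    divergence (planeWave k F c) x =
      2 * Real.pi * (k.1 0 * c 0 + k.1 1 * c 1) * F' (phase k x) := by
  unfold divergence
  rw [(planeWave_hasFDerivAt k hF c x).fderiv]
  simp [Fin.sum_univ_two, phase_single]
  ring

theorem modeField_eq_planeWave (k : WaveVector) :
    modeField k = planeWave k (profile k)
      ((√2 / waveLength k) • !₂[-(k.1 1 : ℝ), (k.1 0 : ℝ)]) := by
  ext1 x
  rw [modeField, planeWave, smul_smul, phase_apply, mul_comm]

theorem profile_hasDerivAt (k : WaveVector) (θ : ℝ) :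
    HasDerivAt (profile k) (deriv (profile k) θ) θ :=
  ((profile_contDiff k).differentiable (by simp) θ).hasDerivAt

/-- The modes are smooth, periodic and divergence free. -/
theorem modeField_isTestField (k : WaveVector) : IsTestField (modeField k) := by
  rw [modeField_eq_planeWave]
  refine ⟨planeWave_contDiff k (profile_contDiff k) _,
    planeWave_periodic k (profile_add_int_mul k) _, fun x => ?_⟩
  rw [planeWave_divergence k (profile_hasDerivAt k)]
  simp
  ring_nf
  simp

theorem profile_deriv_deriv (k : WaveVector) (θ : ℝ) :
    HasDerivAt (deriv (profile k)) (-profile k θ) θ := by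
  unfold profile
  split_ifs
  · rw [Real.deriv_cos']
    exact (Real.hasDerivAt_sin θ).neg
  · rw [Real.deriv_sin]
    exact Real.hasDerivAt_cos θ

/-- The modes are eigenfunctions of `-Δ` with eigenvalue `λ_k`; as they are divergence free, they
are eigenfunctions of the Stokes operator. -/
theorem modeField_laplacian (k : WaveVector) (x : Plane) :
    Laplacian.laplacian (modeField k) x = -eigenvalue k • modeField k x := by
  rw [modeField_eq_planeWave]
  set c : Plane := (√2 / waveLength k) • !₂[-(k.1 1 : ℝ), (k.1 0 : ℝ)]
  have h1 : fderiv ℝ (planeWave k (profile k) c) =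
      fun x => deriv (profile k) (phase k x) • (phase k).smulRight c := by
    ext1 x
    rw [(planeWave_hasFDerivAt k (profile_hasDerivAt k) c x).fderiv]
    ext v
    simp [mul_smul]
  have h2 : HasFDerivAt (fderiv ℝ (planeWave k (profile k) c))
      ((-profile k (phase k x) • phase k).smulRight ((phase k).smulRight c)) x := by
    rw [h1]
    exact ((profile_deriv_deriv k (phase k x)).comp_hasFDerivAt x
      (phase k).hasFDerivAt).smul_const ((phase k).smulRight c)
  rw [InnerProductSpace.laplacian_eq_iteratedFDeriv_orthonormalBasis _
    (EuclideanSpace.basisFun (Fin 2) ℝ)]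
  simp only [iteratedFDeriv_two_apply, h2.fderiv]
  have hs : waveLength k ^ 2 = (k.1 0 : ℝ) ^ 2 + (k.1 1 : ℝ) ^ 2 := Real.sq_sqrt (by positivity)
  simp [Fin.sum_univ_two, phase_single, planeWave, eigenvalue, hs, smul_smul, ← add_smul]
  congr 1
  ring

theorem integral_modeField (k : WaveVector) : ∫ x in unitSquare, modeField k x = 0 := by
  have hs : waveLength k ^ 2 = (k.1 0 : ℝ) ^ 2 + (k.1 1 : ℝ) ^ 2 := Real.sq_sqrt (by positivity)
  let P : ℝ → ℝ := fun θ => -deriv (profile k) θ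
  have hP : ∀ θ, HasDerivAt P (profile k θ) θ := fun θ => by
    have h := (profile_deriv_deriv k θ).neg
    rw [neg_neg] at h
    exact h
  have hPs : ContDiff ℝ 1 P := by
    refine ContDiff.neg ?_
    exact ((contDiff_infty_iff_deriv.1 (profile_contDiff k)).2).of_le (by simp)
  have hPp : ∀ (θ : ℝ) (n : ℤ), P (θ + n * (2 * Real.pi)) = P θ := by
    intro θ n
    simp only [P]
    rw [← deriv_comp_add_const]
    simp_rw [profile_add_int_mul]
  have h := integral_divergence_eq_zero (planeWave_contDiff k hPs !₂[(k.1 0 : ℝ), (k.1 1 : ℝ)])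
    (planeWave_periodic k hPp _)
  simp_rw [planeWave_divergence k hP] at h
  rw [integral_const_mul] at h
  have hne : 2 * Real.pi * ((k.1 0 : ℝ) * (!₂[(k.1 0 : ℝ), (k.1 1 : ℝ)] : Plane) 0 +
      k.1 1 * (!₂[(k.1 0 : ℝ), (k.1 1 : ℝ)] : Plane) 1) ≠ 0 := by
    have := waveLength_pos k
    have h' : (k.1 0 : ℝ) * (!₂[(k.1 0 : ℝ), (k.1 1 : ℝ)] : Plane) 0 +
      k.1 1 * (!₂[(k.1 0 : ℝ), (k.1 1 : ℝ)] : Plane) 1 = waveLength k ^ 2 := by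
      rw [hs]; simp; ring
    rw [h']
    positivity
  have h0 := (mul_eq_zero.1 h).resolve_left hne
  rw [modeField_eq_planeWave]
  simp only [planeWave]
  rw [integral_smul_const, h0, zero_smul]

theorem continuous_modeField (k : WaveVector) : Continuous (modeField k) :=
  (modeField_isTestField k).smooth.continuous

theorem modeField_mem (k : WaveVector) :
    (memLp_of_continuous (continuous_modeField k)).toLp (modeField k) ∈ stokesSpace := by
  have hae := (memLp_of_continuous (continuous_modeField k)).coeFn_toLp
  refine ⟨?_, fun g hg hp => ?_⟩
  · rw [integral_congr_ae hae, integral_modeField]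
  · have hW := modeField_isTestField k
    have e : pairing ((memLp_of_continuous (continuous_modeField k)).toLp (modeField k))
        (gradient g) = ∫ x in unitSquare, divergence (fun x => g x • modeField k x) x := by
      refine integral_congr_ae ?_
      filter_upwards [hae] with x hx
      have hg1 : HasFDerivAt g (fderiv ℝ g x) x := (hg.differentiable (by simp) x).hasFDerivAt
      have hW1 : HasFDerivAt (modeField k) (fderiv ℝ (modeField k) x) x :=
        (hW.smooth.differentiable (by simp) x).hasFDerivAt
      have hd := hW.div_free x
      have hv : fderiv ℝ g x (modeField k x) =
          modeField k x 0 * fderiv ℝ g x (EuclideanSpace.single 0 1) +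
          modeField k x 1 * fderiv ℝ g x (EuclideanSpace.single 1 1) := by
        have hx2 : modeField k x = modeField k x 0 • EuclideanSpace.single 0 (1 : ℝ) +
            modeField k x 1 • EuclideanSpace.single 1 (1 : ℝ) := by
          ext i; fin_cases i <;> simp
        conv_lhs => rw [hx2]
        rw [map_add, map_smul, map_smul, smul_eq_mul, smul_eq_mul]
      unfold divergence at hd ⊢
      rw [hx, real_inner_comm, gradient, InnerProductSpace.toDual_symm_apply,
        (hg1.fun_smul hW1).fderiv, hv]
      simp only [Fin.sum_univ_two] at hd ⊢
      simp
      linear_combination (-g x) * hd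
    rw [e]
    refine integral_divergence_eq_zero ((hg.smul hW.smooth).of_le (by simp)) fun i x => ?_
    simp only [hp i x, hW.periodic i x]

/-- The eigenfunction `φ_k` as an element of `𝓗`. -/
def mode (k : WaveVector) : VelocitySpace :=
  ⟨(memLp_of_continuous (continuous_modeField k)).toLp (modeField k), modeField_mem k⟩

/-- The coefficient `u_k = ⟨u, φ_k⟩`. -/
def coeff (u : VelocitySpace) (k : WaveVector) : ℝ := ⟪u, mode k⟫

/-- The fractional power `A^s u = ∑_k λ_k^s ⟨u, φ_k⟩ φ_k` of the Stokes operator (for `u` in its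
domain, that is, whenever the series converges in `𝓗`; in particular for all `u` if `s ≤ 0`). -/
def stokesPow (s : ℝ) (u : VelocitySpace) : VelocitySpace :=
  ∑' k, (eigenvalue k ^ s * coeff u k) • mode k

/-- Membership in `𝓗^s = {u : ∑_k λ_k^s |⟨u, φ_k⟩|² < ∞}`, for `s ≥ 0`. -/
def MemHs (s : ℝ) (u : VelocitySpace) : Prop :=
  Summable fun k => eigenvalue k ^ s * coeff u k ^ 2

/-- The norm of `𝓗^s`. -/
def hsNorm (s : ℝ) (u : VelocitySpace) : ℝ := √(∑' k, eigenvalue k ^ s * coeff u k ^ 2)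

/-- `ψ ∈ C([0,T]; 𝓗^s)`. -/
def ContinuousInHs (s T : ℝ) (ψ : ℝ → VelocitySpace) : Prop :=
  (∀ t ∈ Icc 0 T, MemHs s (ψ t)) ∧
    ∀ t ∈ Icc 0 T, Tendsto (fun τ => hsNorm s (ψ τ - ψ t)) (𝓝[Icc 0 T] t) (𝓝 0)

/-- The span of the eigenfunctions `φ_k` with `|k| ≤ N`. -/
def modeSpan (N : ℕ) : Submodule ℝ VelocitySpace :=
  Submodule.span ℝ (mode '' {k | waveLength k ≤ N})

theorem finite_waveVectors (N : ℕ) : {k : WaveVector | waveLength k ≤ N}.Finite := by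
  have hfin : (Icc (fun _ => -(N : ℤ)) (fun _ => (N : ℤ)) : Set (Fin 2 → ℤ)).Finite :=
    Set.finite_Icc _ _
  refine (hfin.preimage (f := fun k : WaveVector => k.1) Subtype.val_injective.injOn).subset ?_
  intro k hk
  have hk' : waveLength k ≤ N := hk
  have hs : waveLength k ^ 2 = (k.1 0 : ℝ) ^ 2 + (k.1 1 : ℝ) ^ 2 := Real.sq_sqrt (by positivity)
  have hpos := waveLength_pos k
  have h : ∀ i, |(k.1 i : ℝ)| ≤ N := by
    intro i
    refine abs_le_of_sq_le_sq (?_ : (k.1 i : ℝ) ^ 2 ≤ (N : ℝ) ^ 2) (by positivity)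
    fin_cases i <;> simp <;> nlinarith [sq_nonneg (k.1 0 : ℝ), sq_nonneg (k.1 1 : ℝ)]
  have h2 : ∀ i, |k.1 i| ≤ (N : ℤ) := fun i => by exact_mod_cast h i
  exact ⟨fun i => (abs_le.1 (h2 i)).1, fun i => (abs_le.1 (h2 i)).2⟩

instance finiteDimensional_modeSpan (N : ℕ) : FiniteDimensional ℝ (modeSpan N) :=
  FiniteDimensional.span_of_finite ℝ ((finite_waveVectors N).image mode)

/-- The spectral truncation `P^N`: orthogonal projection in `𝓗` onto the span of the `φ_k` with
`|k| ≤ N`. -/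
def spectralProj (N : ℕ) : VelocitySpace →L[ℝ] VelocitySpace := (modeSpan N).starProjection

/-! ### The Stokes flow and the Lagrangian tracers -/

/-- `v ∈ C([0,T]; 𝓗)` is the solution of the periodic Stokes equations
`∂v/∂t = ν Δv - ∇p + f`, `∇·v = 0`, `v(0) = u`, with projected forcing `ψ = Pf`, in the weak
sense: tested against smooth divergence-free periodic fields, which eliminates the pressure. -/
structure IsStokesSolution (ν T : ℝ) (ψ : ℝ → VelocitySpace) (u : VelocitySpace)
    (v : ℝ → VelocitySpace) : Prop where
  continuousOn : ContinuousOn v (Icc 0 T)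
  init : v 0 = u
  weak : ∀ w, IsTestField w → ∀ t ∈ Icc 0 T,
    pairing (v t) w = pairing u w +
      ∫ s in (0 : ℝ)..t, (ν * pairing (v s) (Laplacian.laplacian w) + pairing (ψ s) w)

/-- `V(s, ·)` is, for each `s ∈ (0,T]`, the continuous periodic representative of `v(s) ∈ 𝓗`. -/
def IsContinuousRep (T : ℝ) (v : ℝ → VelocitySpace) (V : ℝ → Plane → Plane) : Prop :=
  ∀ s ∈ Ioc 0 T, Continuous (V s) ∧ IsPeriodic (V s) ∧
    V s =ᵐ[squareMeasure] ((v s : L2Field) : Plane → Plane)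

/-- `z ∈ C([0,T]; ℝ²)` solves the tracer equation `z(t) = a + ∫₀ᵗ v(z(s), s) ds`, where `v` is the
Stokes velocity field with initial condition `u`. -/
def IsTracer (ν T : ℝ) (ψ : ℝ → VelocitySpace) (u : VelocitySpace) (a : Plane)
    (z : ℝ → Plane) : Prop :=
  ∃ (v : ℝ → VelocitySpace) (V : ℝ → Plane → Plane),
    IsStokesSolution ν T ψ u v ∧ IsContinuousRep T v V ∧ ContinuousOn z (Icc 0 T) ∧
    ∀ t ∈ Icc 0 T, IntervalIntegrable (fun s => V s (z s)) volume 0 t ∧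
      z t = a + ∫ s in (0 : ℝ)..t, V s (z s)

/-- The tracer equation has a solution on `[0,T]`, and only one. -/
def HasUniqueTracer (ν T : ℝ) (ψ : ℝ → VelocitySpace) (u : VelocitySpace) (a : Plane) : Prop :=
  ∃ z, IsTracer ν T ψ u a z ∧ ∀ z', IsTracer ν T ψ u a z' → EqOn z' z (Icc 0 T)

open Classical in
/-- The tracer trajectory started at `a` (with the constant trajectory as a default value where the
tracer equation has no solution). -/
def tracer (ν T : ℝ) (ψ : ℝ → VelocitySpace) (u : VelocitySpace) (a : Plane) : ℝ → Plane :=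
  if h : ∃ z, IsTracer ν T ψ u a z then h.choose else fun _ => a

/-- The forward map `𝒢(u) ∈ ℝ^{2JK}`: the positions `z_j(t_k)` of `J` tracers at `K` times. -/
def forwardMap (ν T : ℝ) (ψ : ℝ → VelocitySpace) {J K : ℕ} (a : Fin J → Plane)
    (t : Fin K → ℝ) (u : VelocitySpace) : Fin J × Fin K × Fin 2 → ℝ :=
  fun i => tracer ν T ψ u (a i.1) (t i.2.1) i.2.2

/-! ### Bayesian inversion -/

/-- The potential `½ |y - g|_Γ²`, where `|·|_Γ = |Γ^{-1/2} ·|`. -/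
def misfit {ι : Type*} [Fintype ι] [DecidableEq ι] (Γ : Matrix ι ι ℝ) (y g : ι → ℝ) : ℝ :=
  1 / 2 * ((y - g) ⬝ᵥ (Γ⁻¹ *ᵥ (y - g)))

/-- The posterior measure: the probability measure with density proportional to
`exp(-½ |y - G(u)|_Γ²)` with respect to the prior. -/
def posteriorMeasure {ι : Type*} [Fintype ι] [DecidableEq ι] (μ₀ : Measure VelocitySpace)
    (Γ : Matrix ι ι ℝ) (y : ι → ℝ) (G : VelocitySpace → ι → ℝ) : Measure VelocitySpace :=
  μ₀.tilted fun u => -misfit Γ y (G u)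

/-- The mean of a measure on `𝓗`. -/
def mean (μ : Measure VelocitySpace) : VelocitySpace := ∫ u, u ∂μ

/-- The (centred) covariance operator `h ↦ ∫ ⟨u - m, h⟩ (u - m) dμ(u)`, `m` the mean of `μ`. -/
def covOp (μ : Measure VelocitySpace) : VelocitySpace →L[ℝ] VelocitySpace :=
  covarianceOperator (μ.map fun u => u - mean μ)

/-- `μ₀ = N(0, β A^{-α})`. -/
structure IsPrior (β α : ℝ) (μ₀ : Measure VelocitySpace) : Prop where
  gaussian : IsGaussian μ₀
  mean_eq : mean μ₀ = 0
  cov_eq : ∀ h, covOp μ₀ h = β • stokesPow (-α) h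

/-- The Hellinger distance between `μ` and `μ'`, both absolutely continuous with respect to the
reference measure `ρ`. -/
def hellinger {X : Type*} [MeasurableSpace X] (ρ μ μ' : Measure X) : ℝ :=
  √(1 / 2 * ∫ x, (√(μ.rnDeriv ρ x).toReal - √(μ'.rnDeriv ρ x).toReal) ^ 2 ∂ρ)

end StokesDA

end

open StokesDA

/-!
The posterior measures are Lipschitz continuous functions of the likelihood, the likelihood is a
Lipschitz continuous function of the forward map, and the forward map is locally Lipschitz
continuous in the weak norm `∑_k |u_k| / |k|²` of the initial velocity; spectral truncation
converges in that norm at the rate allowed by the prior.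

*Flow and tracers.* In the basis of modes the Stokes equations decouple into scalar equations
solved by Duhamel's formula (`IsStokesSolution.coeff_eq`, `exists_isStokesSolution`), so the
velocity field is the explicit series `velField`. Its spatial Lipschitz constant at time `s` is at
most `lipBound`, a multiple of `∑_k |k| |v_k(s)|`. This is singular at `s = 0`, but integrating the
`k`-th mode in time gains `1 / (ν λ_k)`, so the constant is integrable in time once
`∑_k |u_k| / |k| < ∞` (`IsRegular`), with integral at most `(tracerNorm u + forcingNorm) / ν`
(`lipBound_integrable`). Picard iteration and Gronwall's inequality for coefficients that are
integrable in time then give existence and uniqueness of tracers (`hasUniqueTracer`). For two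
initial velocities the fields differ by at most `√2 ∑_k |v_k(s) - v'_k(s)|`, whose time integral is
at most `ν⁻¹ ∑_k |u_k - u'_k| / |k|²`, hence `norm_forwardMap_sub_le`.

*Truncation and prior.* Put `S_r(u) = ∑_k |k|^{r-2} |u_k|` (`weightedNorm`). Only modes with
`|k| > N` are removed, so the weak norm of `u - P^N u` is at most `N^{-r} S_r(u)`, and for `r ≥ 1`
also `tracerNorm u ≤ S_r(u)`. Under the prior `u_k` is Gaussian with standard deviation of order
`|k|^{-α}`, and `∑_k |k|^{r-2-α} < ∞` for `r < α`; Jensen's inequality gives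
`E exp(C S_r) < ∞` for all `C` (`IsPrior.integrable_exp_weightedNorm`). Thus the square roots of
the two likelihoods differ by at most `N^{-r} W` with `W` square integrable
(`abs_sqrt_likelihood_sub_le`). This holds for every `r` in `[1, α)`, which covers the exponents
`q < α - 1`.

*Stability.* As `W` and `‖u‖²` are square integrable, a difference of square roots of likelihoods
bounded by `ε W` implies differences of order `ε` for Hellinger distances, means and covariance
operators (`posterior_stability`); the normalization constants are bounded below since they are
positive and converge to a positive limit.
Measurability of the forward map, needed for all of this, comes from its continuity on closed sets
that exhaust the regular velocities (`aemeasurable_forwardMap_comp`).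
-/

open MeasureTheory ProbabilityTheory Set Filter Topology
open scoped RealInnerProductSpace ContDiff Matrix

noncomputable section

namespace StokesDA

/-! ### Carathéodory differential equations -/

/-- `∫₀ᵗ L Λⁿ = Λ(t)^{n+1} / (n + 1)` for the primitive `Λ` of an integrable function `L`. -/
theorem integral_mul_primitive_pow {L : ℝ → ℝ} {T : ℝ} (hL : IntervalIntegrable L volume 0 T)
    (n : ℕ) {t : ℝ} (ht : t ∈ Icc 0 T) :
    ∫ s in (0 : ℝ)..t, L s * (∫ r in (0 : ℝ)..s, L r) ^ n =
      (∫ r in (0 : ℝ)..t, L r) ^ (n + 1) / (n + 1) := by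
  have hLt : IntervalIntegrable L volume 0 t :=
    hL.mono_set (by rw [uIcc_of_le ht.1, uIcc_of_le (ht.1.trans ht.2)]; exact Icc_subset_Icc_right ht.2)
  set Λ : ℝ → ℝ := fun x => ∫ r in (0 : ℝ)..x, L r with hΛ
  have hac : AbsolutelyContinuousOnInterval Λ 0 t :=
    hLt.absolutelyContinuousOnInterval_intervalIntegral (by simp)
  have hpow : ∀ m : ℕ, AbsolutelyContinuousOnInterval (fun x => Λ x ^ (m + 1)) 0 t := by
    intro m
    induction m with
    | zero => simpa using hac
    | succ m ih =>
      simp_rw [pow_succ _ (m + 1)]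
      exact ih.fun_mul hac
  have h := (hpow n).integral_deriv_eq_sub
  have h0 : Λ 0 = 0 := by simp [hΛ]
  have hd : ∫ x in (0 : ℝ)..t, deriv (fun x => Λ x ^ (n + 1)) x =
      ∫ x in (0 : ℝ)..t, (n + 1 : ℝ) * (L x * Λ x ^ n) := by
    refine intervalIntegral.integral_congr_ae ?_
    filter_upwards [hLt.ae_hasDerivAt_integral] with x hx hxt
    have := (hx (uIoc_subset_uIcc hxt) 0 (by simp)).pow (n + 1)
    have e : (fun x => Λ x ^ (n + 1)) = (fun x => ∫ t in (0 : ℝ)..x, L t) ^ (n + 1) := rfl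
    rw [e, this.deriv]
    push_cast
    simp only [hΛ]
    ring
  rw [hd, intervalIntegral.integral_const_mul, h0] at h
  field_simp
  rw [mul_comm, h]
  simp [hΛ]

/-- Gronwall's inequality in integral form, with an integrable coefficient. -/
theorem le_mul_exp_of_le_add_integral {L f : ℝ → ℝ} {T A : ℝ}
    (hL : IntervalIntegrable L volume 0 T) (hL0 : ∀ s ∈ Ioc 0 T, 0 ≤ L s)
    (hf : ContinuousOn f (Icc 0 T)) (hA : 0 ≤ A)
    (h : ∀ t ∈ Icc 0 T, f t ≤ A + ∫ s in (0 : ℝ)..t, L s * f s) {t : ℝ} (ht : t ∈ Icc 0 T) :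
    f t ≤ A * Real.exp (∫ s in (0 : ℝ)..t, L s) := by
  have hsub : ∀ {t : ℝ}, t ∈ Icc 0 T → IntervalIntegrable L volume 0 t := fun ht =>
    hL.mono_set (by rw [uIcc_of_le ht.1, uIcc_of_le (ht.1.trans ht.2)]; exact Icc_subset_Icc_right ht.2)
  set Λ : ℝ → ℝ := fun x => ∫ r in (0 : ℝ)..x, L r with hΛ
  have hΛ0 : ∀ t ∈ Icc 0 T, 0 ≤ Λ t := fun t ht =>
    intervalIntegral.integral_nonneg_of_ae_restrict ht.1 (by
      rw [← Measure.restrict_congr_set Ioc_ae_eq_Icc]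
      exact (ae_restrict_iff' measurableSet_Ioc).2 (ae_of_all _ fun s hs =>
        hL0 s ⟨hs.1, hs.2.trans ht.2⟩))
  obtain ⟨B, hB⟩ := isCompact_Icc.exists_bound_of_continuousOn hf
  have hΛc : ContinuousOn Λ (Icc 0 T) := by
    have := (hL.absolutelyContinuousOnInterval_intervalIntegral (c := 0) (by simp)).continuousOn
    rwa [uIcc_of_le (ht.1.trans ht.2)] at this
  -- iterating the hypothesis `n` times leaves a partial sum of the exponential series and a
  -- remainder
  have key : ∀ n : ℕ, ∀ t ∈ Icc 0 T,
      f t ≤ A * ∑ j ∈ Finset.range n, Λ t ^ j / (j.factorial : ℝ) +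
        B * (Λ t ^ n / (n.factorial : ℝ)) := by
    intro n
    induction n with
    | zero =>
      intro t ht
      simpa using (le_abs_self _).trans (hB t ht)
    | succ n ih =>
      intro t ht
      refine (h t ht).trans ?_
      have hcont : ∀ j : ℕ, ContinuousOn (fun s => Λ s ^ j) (uIcc 0 t) := fun j => by
        rw [uIcc_of_le ht.1]
        exact (hΛc.mono (Icc_subset_Icc_right ht.2)).pow j
      have hi : ∀ j : ℕ, IntervalIntegrable (fun s => L s * Λ s ^ j) volume 0 t := fun j =>
        (hsub ht).mul_continuousOn (hcont j)
      have hfi : IntervalIntegrable (fun s => L s * f s) volume 0 t :=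
        (hsub ht).mul_continuousOn (by
          rw [uIcc_of_le ht.1]; exact hf.mono (Icc_subset_Icc_right ht.2))
      have e1 : ∀ s, L s * (A * ∑ j ∈ Finset.range n, Λ s ^ j / (j.factorial : ℝ) +
          B * (Λ s ^ n / (n.factorial : ℝ))) =
          (∑ j ∈ Finset.range n, (A / (j.factorial : ℝ)) * (L s * Λ s ^ j)) +
            (B / (n.factorial : ℝ)) * (L s * Λ s ^ n) := by
        intro s
        rw [Finset.mul_sum, mul_add, Finset.mul_sum]
        congr 1
        · exact Finset.sum_congr rfl fun j _ => by ring
        · ring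
      have hsumi : IntervalIntegrable (fun s => ∑ j ∈ Finset.range n,
          (A / (j.factorial : ℝ)) * (L s * Λ s ^ j)) volume 0 t := by
        have := IntervalIntegrable.sum (Finset.range n)
          (f := fun j s => (A / (j.factorial : ℝ)) * (L s * Λ s ^ j)) (μ := volume) (a := 0)
          (b := t) fun j _ => (hi j).const_mul _
        convert! this using 1
        ext s
        simp
      have hm : ∫ s in (0 : ℝ)..t, L s * f s ≤ ∫ s in (0 : ℝ)..t,
          ((∑ j ∈ Finset.range n, (A / (j.factorial : ℝ)) * (L s * Λ s ^ j)) +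
            (B / (n.factorial : ℝ)) * (L s * Λ s ^ n)) := by
        refine intervalIntegral.integral_mono_on_of_le_Ioo ht.1 hfi
          (hsumi.add ((hi n).const_mul _)) fun s hs => ?_
        rw [← e1]
        have hs' : s ∈ Icc 0 T := ⟨hs.1.le, hs.2.le.trans ht.2⟩
        exact mul_le_mul_of_nonneg_left (ih s hs') (hL0 s ⟨hs.1, hs'.2⟩)
      rw [intervalIntegral.integral_add hsumi ((hi n).const_mul _),
        intervalIntegral.integral_finsetSum (fun j _ => (hi j).const_mul _),
        intervalIntegral.integral_const_mul, integral_mul_primitive_pow hL n ht] at hm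
      simp_rw [intervalIntegral.integral_const_mul] at hm
      have e2 : ∑ j ∈ Finset.range n, A / (j.factorial : ℝ) * ∫ s in (0 : ℝ)..t, L s * Λ s ^ j =
          A * ∑ j ∈ Finset.range n, Λ t ^ (j + 1) / ((j + 1).factorial : ℝ) := by
        rw [Finset.mul_sum]
        refine Finset.sum_congr rfl fun j _ => ?_
        rw [integral_mul_primitive_pow hL j ht, Nat.factorial_succ]
        push_cast
        field_simp
        simp [hΛ]
      rw [e2] at hm
      rw [Finset.sum_range_succ', Nat.factorial_succ]
      have e3 : B / (n.factorial : ℝ) * ((∫ r in (0 : ℝ)..t, L r) ^ (n + 1) / (n + 1)) =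
          B * (Λ t ^ (n + 1) / (((n + 1) * n.factorial : ℕ) : ℝ)) := by
        push_cast
        field_simp
        simp [hΛ]
      rw [e3] at hm
      simp only [pow_zero, Nat.factorial_zero, Nat.cast_one, div_one]
      linarith
  have hlim : Tendsto (fun n : ℕ => A * Real.exp (Λ t) + B * (Λ t ^ n / (n.factorial : ℝ)))
      atTop (𝓝 (A * Real.exp (Λ t) + B * 0)) :=
    ((FloorSemiring.tendsto_pow_div_factorial_atTop (Λ t)).const_mul B).const_add _
  rw [mul_zero, add_zero] at hlim
  refine ge_of_tendsto' hlim fun n => (key n t ht).trans ?_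
  gcongr
  exact Real.sum_le_exp_of_nonneg (hΛ0 t ht) n

/-- Existence for the integral equation `z(t) = a + ∫₀ᵗ V(s, z(s)) ds` when `V(s, ·)` has a Lipschitz
constant that is integrable in time: some iterate of the Picard map is a contraction. -/
theorem exists_integral_curve {E : Type*} [NormedAddCommGroup E] [NormedSpace ℝ E]
    [CompleteSpace E] {V : ℝ → E → E} {L : ℝ → ℝ} {T : ℝ} (hT : 0 ≤ T)
    (hL : IntervalIntegrable L volume 0 T) (hL0 : ∀ s ∈ Ioc 0 T, 0 ≤ L s)
    (hV : ∀ᵐ s ∂volume.restrict (Ioc 0 T), ∀ x y, ‖V s x - V s y‖ ≤ L s * ‖x - y‖)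
    (hint : ∀ z : ℝ → E, Continuous z → IntervalIntegrable (fun s => V s (z s)) volume 0 T)
    (a : E) :
    ∃ z : ℝ → E, Continuous z ∧ ∀ t ∈ Icc 0 T, z t = a + ∫ s in (0 : ℝ)..t, V s (z s) := by
  let X := C(Icc (0 : ℝ) T, E)
  let ext : X → ℝ → E := fun z => IccExtend hT z
  have hext : ∀ z : X, Continuous (ext z) := fun z => z.continuous.Icc_extend'
  have hsub : ∀ {t : ℝ}, t ∈ Icc 0 T → uIcc 0 t ⊆ uIcc 0 T := fun ht => by
    rw [uIcc_of_le ht.1, uIcc_of_le hT]; exact Icc_subset_Icc_right ht.2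
  let Φ : X → X := fun z =>
    ⟨fun t => a + ∫ s in (0 : ℝ)..t, V s (ext z s), by
      have h := intervalIntegral.continuousOn_primitive_interval'
        (hint (ext z) (hext z)) (a := 0) (by simp)
      rw [uIcc_of_le hT] at h
      exact continuous_const.add h.domRestrict⟩
  have hΦ : ∀ z (t : Icc (0 : ℝ) T), Φ z t = a + ∫ s in (0 : ℝ)..t, V s (ext z s) := fun _ _ => rfl
  set Λ : ℝ → ℝ := fun x => ∫ r in (0 : ℝ)..x, L r with hΛ
  have hΛc : ContinuousOn Λ (Icc 0 T) := by
    have := (hL.absolutelyContinuousOnInterval_intervalIntegral (c := 0) (by simp)).continuousOn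
    rwa [uIcc_of_le hT] at this
  have key : ∀ (n : ℕ) (z w : X) (t : Icc (0 : ℝ) T),
      ‖(Φ^[n] z) t - (Φ^[n] w) t‖ ≤ Λ t ^ n / (n.factorial : ℝ) * ‖z - w‖ := by
    intro n z w
    induction n with
    | zero =>
      intro t
      have h := (z - w).norm_coe_le_norm t
      rw [ContinuousMap.sub_apply] at h
      simpa using h
    | succ n ih =>
      intro t
      rw [Function.iterate_succ_apply', Function.iterate_succ_apply', hΦ, hΦ, add_sub_add_left_eq_sub,
        ← intervalIntegral.integral_sub ((hint _ (hext _)).mono_set (hsub t.2))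
          ((hint _ (hext _)).mono_set (hsub t.2))]
      have hi : IntervalIntegrable (fun s => L s * Λ s ^ n) volume 0 t := by
        refine (hL.mono_set (hsub t.2)).mul_continuousOn ?_
        rw [uIcc_of_le t.2.1]
        exact (hΛc.mono (Icc_subset_Icc_right t.2.2)).pow n
      have hb : ∀ᵐ s, s ∈ Ioc (0 : ℝ) t →
          ‖V s (ext (Φ^[n] z) s) - V s (ext (Φ^[n] w) s)‖ ≤
            L s * Λ s ^ n * (‖z - w‖ / (n.factorial : ℝ)) := by
        filter_upwards [(ae_restrict_iff' measurableSet_Ioc).1 hV] with s hs hst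
        have hs' : s ∈ Icc 0 T := ⟨hst.1.le, hst.2.trans t.2.2⟩
        refine (hs ⟨hst.1, hs'.2⟩ _ _).trans ?_
        have h1 := ih ⟨s, hs'⟩
        have h2 : ∀ q : X, ext q s = q ⟨s, hs'⟩ := fun q => IccExtend_of_mem hT q hs'
        rw [h2, h2]
        calc _ ≤ L s * (Λ s ^ n / (n.factorial : ℝ) * ‖z - w‖) :=
              mul_le_mul_of_nonneg_left h1 (hL0 s ⟨hst.1, hs'.2⟩)
          _ = _ := by ring
      refine (intervalIntegral.norm_integral_le_of_norm_le t.2.1 hb (hi.mul_const _)).trans ?_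
      rw [intervalIntegral.integral_mul_const, integral_mul_primitive_pow hL n t.2,
        Nat.factorial_succ]
      push_cast
      apply le_of_eq
      field_simp
      simp only [hΛ]
      ring
  obtain ⟨B, hB⟩ := isCompact_Icc.exists_bound_of_continuousOn hΛc
  have hB0 : 0 ≤ B := (norm_nonneg _).trans (hB 0 ⟨le_rfl, hT⟩)
  obtain ⟨n, hn⟩ := ((FloorSemiring.tendsto_pow_div_factorial_atTop B).eventually
    (gt_mem_nhds one_half_pos)).exists
  have hcontr : ContractingWith (1 / 2 : NNReal) Φ^[n] := by
    refine ⟨by norm_num, LipschitzWith.of_dist_le_mul fun z w => ?_⟩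
    rw [dist_eq_norm, dist_eq_norm, ContinuousMap.norm_le _ (by positivity)]
    intro t
    refine (key n z w t).trans ?_
    have h1 : Λ t ^ n ≤ B ^ n := by
      refine (le_abs_self _).trans ?_
      rw [abs_pow]
      exact pow_le_pow_left₀ (abs_nonneg _) (hB t t.2) n
    have h2 : Λ t ^ n / (n.factorial : ℝ) ≤ 1 / 2 :=
      (div_le_div_of_nonneg_right h1 (by positivity)).trans hn.le
    have h3 := mul_le_mul_of_nonneg_right h2 (norm_nonneg (z - w))
    simpa using h3
  set z := ContractingWith.fixedPoint Φ^[n] hcontr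
  have hz : Φ z = z := hcontr.isFixedPt_fixedPoint_iterate
  refine ⟨ext z, hext z, fun t ht => ?_⟩
  rw [show ext z t = z ⟨t, ht⟩ from IccExtend_of_mem hT z ht]
  conv_lhs => rw [← hz]
  exact hΦ z ⟨t, ht⟩

/-! ### Orthonormality of the modes and sums over the lattice -/

theorem volume_unitSquare : volume unitSquare = 1 := by
  have hpre : WithLp.toLp 2 ⁻¹' unitSquare = Icc (0 : Fin 2 → ℝ) 1 := by
    ext x
    simp [unitSquare, Pi.le_def, forall_and]
  rw [← (PiLp.volume_preserving_toLp (Fin 2)).measure_preimage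
    isCompact_unitSquare.measurableSet.nullMeasurableSet, hpre, Real.volume_Icc_pi]
  simp

theorem sq_waveLength (k : WaveVector) : waveLength k ^ 2 = (k.1 0 : ℝ) ^ 2 + (k.1 1 : ℝ) ^ 2 :=
  Real.sq_sqrt (by positivity)

/-- Trigonometric functions of nonzero frequency have zero mean over the unit square. -/
theorem integral_comp_phase_eq_zero (k : WaveVector) {F F' : ℝ → ℝ} (hF : ContDiff ℝ 1 F)
    (hd : ∀ θ, HasDerivAt F (F' θ) θ)
    (hp : ∀ (θ : ℝ) (n : ℤ), F (θ + n * (2 * Real.pi)) = F θ) :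
    ∫ x in unitSquare, F' (phase k x) = 0 := by
  have h := integral_divergence_eq_zero (planeWave_contDiff k hF !₂[(k.1 0 : ℝ), (k.1 1 : ℝ)])
    (planeWave_periodic k hp _)
  simp_rw [planeWave_divergence k hd] at h
  rw [integral_const_mul] at h
  refine (mul_eq_zero.1 h).resolve_left ?_
  have h' : (k.1 0 : ℝ) * (!₂[(k.1 0 : ℝ), (k.1 1 : ℝ)] : Plane) 0 +
      k.1 1 * (!₂[(k.1 0 : ℝ), (k.1 1 : ℝ)] : Plane) 1 = waveLength k ^ 2 := by
    rw [sq_waveLength]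
    simp
    ring
  have := waveLength_pos k
  rw [h']
  positivity

theorem integral_cos_phase (k : WaveVector) : ∫ x in unitSquare, Real.cos (phase k x) = 0 :=
  integral_comp_phase_eq_zero k Real.contDiff_sin Real.hasDerivAt_sin Real.sin_add_int_mul_two_pi

theorem integral_sin_phase (k : WaveVector) : ∫ x in unitSquare, Real.sin (phase k x) = 0 :=
  integral_comp_phase_eq_zero k (F := fun θ => -Real.cos θ) Real.contDiff_cos.neg
    (fun θ => by
      have h := (Real.hasDerivAt_cos θ).neg
      rw [neg_neg] at h
      exact h)
    (fun θ n => by rw [Real.cos_add_int_mul_two_pi])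

/-- The half of the lattice that carries the cosine modes. -/
def IsUpper (k : WaveVector) : Prop := 0 < k.1 0 ∨ (k.1 0 = 0 ∧ 0 < k.1 1)

theorem profile_of_isUpper {k : WaveVector} (h : IsUpper k) : profile k = Real.cos := if_pos h

theorem profile_of_not_isUpper {k : WaveVector} (h : ¬IsUpper k) : profile k = Real.sin := if_neg h

theorem abs_profile_le_one (k : WaveVector) (θ : ℝ) : |profile k θ| ≤ 1 := by
  unfold profile
  split_ifs
  · exact Real.abs_cos_le_one θ
  · exact Real.abs_sin_le_one θ

theorem waveVector_ne_zero (k : WaveVector) : k.1 0 ≠ 0 ∨ k.1 1 ≠ 0 := by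
  by_contra! h
  exact k.2 (by ext i; fin_cases i <;> simp [h.1, h.2])

theorem integral_phase_add {F : ℝ → ℝ} (hF : ∀ m : WaveVector, ∫ x in unitSquare, F (phase m x) = 0)
    (j k : WaveVector) (h : j.1 + k.1 ≠ 0) :
    ∫ x in unitSquare, F (phase j x + phase k x) = 0 := by
  rw [← hF ⟨j.1 + k.1, h⟩]
  congr 1
  ext x
  congr 1
  simp only [phase_apply, Pi.add_apply]
  push_cast
  ring

theorem integral_phase_sub {F : ℝ → ℝ} (hF : ∀ m : WaveVector, ∫ x in unitSquare, F (phase m x) = 0)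
    (j k : WaveVector) :
    ∫ x in unitSquare, F (phase j x - phase k x) = if j = k then F 0 else 0 := by
  split_ifs with h
  · subst h
    simp [volume_unitSquare, Measure.real]
  · have h' : j.1 - k.1 ≠ 0 := fun h0 => h (Subtype.ext (sub_eq_zero.1 h0))
    rw [← hF ⟨j.1 - k.1, h'⟩]
    congr 1
    ext x
    congr 1
    simp only [phase_apply, Pi.sub_apply]
    push_cast
    ring

theorem integrableOn_unitSquare {F : Type*} [NormedAddCommGroup F] {g : Plane → F}
    (hg : Continuous g) : Integrable g squareMeasure :=
  hg.continuousOn.integrableOn_compact isCompact_unitSquare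

theorem integral_profile_mul_profile (j k : WaveVector) :
    ∫ x in unitSquare, profile j (phase j x) * profile k (phase k x) =
      if j = k then 1 / 2 else 0 := by
  have hc1 : Integrable (fun x => Real.cos (phase j x - phase k x)) squareMeasure :=
    integrableOn_unitSquare (by fun_prop)
  have hc2 : Integrable (fun x => Real.cos (phase j x + phase k x)) squareMeasure :=
    integrableOn_unitSquare (by fun_prop)
  have hs1 : Integrable (fun x => Real.sin (phase j x - phase k x)) squareMeasure :=
    integrableOn_unitSquare (by fun_prop)
  have hs2 : Integrable (fun x => Real.sin (phase j x + phase k x)) squareMeasure :=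
    integrableOn_unitSquare (by fun_prop)
  have hcd := integral_phase_sub integral_cos_phase j k
  have hsd := integral_phase_sub integral_sin_phase j k
  rw [Real.sin_zero, ite_self] at hsd
  rw [Real.cos_zero] at hcd
  have hj0 := waveVector_ne_zero j
  have hk0 := waveVector_ne_zero k
  have hadd : ∀ h : (IsUpper j ↔ IsUpper k), j.1 + k.1 ≠ 0 := by
    intro h h0
    have e0 : j.1 0 + k.1 0 = 0 := congrFun h0 0
    have e1 : j.1 1 + k.1 1 = 0 := congrFun h0 1
    unfold IsUpper at h
    omega
  have hsa : ∫ x in unitSquare, Real.sin (phase j x + phase k x) = 0 := by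
    by_cases h0 : j.1 + k.1 = 0
    · have : ∀ x, Real.sin (phase j x + phase k x) = 0 := fun x => by
        have e0 : (j.1 0 : ℝ) + k.1 0 = 0 := by exact_mod_cast congrFun h0 0
        have e1 : (j.1 1 : ℝ) + k.1 1 = 0 := by exact_mod_cast congrFun h0 1
        rw [phase_apply, phase_apply, show 2 * Real.pi * (j.1 0 * x 0 + j.1 1 * x 1) +
          2 * Real.pi * (k.1 0 * x 0 + k.1 1 * x 1) = 0 by
            linear_combination 2 * Real.pi * (x 0 * e0 + x 1 * e1), Real.sin_zero]
      simp [this]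
    · exact integral_phase_add integral_sin_phase j k h0
  by_cases hj : IsUpper j <;> by_cases hk : IsUpper k
  · have hca := integral_phase_add integral_cos_phase j k (hadd (by simp [hj, hk]))
    rw [profile_of_isUpper hj, profile_of_isUpper hk]
    have e : ∀ x, Real.cos (phase j x) * Real.cos (phase k x) =
        1 / 2 * (Real.cos (phase j x - phase k x) + Real.cos (phase j x + phase k x)) := fun x => by
      rw [Real.cos_sub, Real.cos_add]; ring
    simp_rw [e]
    rw [integral_const_mul, integral_add hc1 hc2, hcd, hca]
    split_ifs <;> norm_num
  · have hjk : j ≠ k := fun h => hk (h ▸ hj)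
    rw [profile_of_isUpper hj, profile_of_not_isUpper hk, if_neg hjk]
    have e : ∀ x, Real.cos (phase j x) * Real.sin (phase k x) =
        1 / 2 * (Real.sin (phase j x + phase k x) - Real.sin (phase j x - phase k x)) := fun x => by
      rw [Real.sin_sub, Real.sin_add]; ring
    simp_rw [e]
    rw [integral_const_mul, integral_sub hs2 hs1, hsa, hsd]
    norm_num
  · have hjk : j ≠ k := fun h => hj (h ▸ hk)
    rw [profile_of_not_isUpper hj, profile_of_isUpper hk, if_neg hjk]
    have e : ∀ x, Real.sin (phase j x) * Real.cos (phase k x) =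
        1 / 2 * (Real.sin (phase j x + phase k x) + Real.sin (phase j x - phase k x)) := fun x => by
      rw [Real.sin_sub, Real.sin_add]; ring
    simp_rw [e]
    rw [integral_const_mul, integral_add hs2 hs1, hsa, hsd]
    norm_num
  · have hca := integral_phase_add integral_cos_phase j k (hadd (by simp [hj, hk]))
    rw [profile_of_not_isUpper hj, profile_of_not_isUpper hk]
    have e : ∀ x, Real.sin (phase j x) * Real.sin (phase k x) =
        1 / 2 * (Real.cos (phase j x - phase k x) - Real.cos (phase j x + phase k x)) := fun x => by
      rw [Real.cos_sub, Real.cos_add]; ring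
    simp_rw [e]
    rw [integral_const_mul, integral_sub hc1 hc2, hcd, hca]
    split_ifs <;> norm_num

theorem coe_mode (k : WaveVector) :
    ((mode k : L2Field) : Plane → Plane) =ᵐ[squareMeasure] modeField k :=
  (memLp_of_continuous (continuous_modeField k)).coeFn_toLp

theorem inner_eq_pairing (u : VelocitySpace) {w : VelocitySpace} {g : Plane → Plane}
    (h : ((w : L2Field) : Plane → Plane) =ᵐ[squareMeasure] g) :
    ⟪u, w⟫ = pairing u g := by
  rw [Submodule.coe_inner, L2.inner_def]
  refine integral_congr_ae ?_
  filter_upwards [h] with x hx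
  rw [hx]

theorem coeff_eq_pairing (u : VelocitySpace) (k : WaveVector) :
    coeff u k = pairing u (modeField k) :=
  inner_eq_pairing u (coe_mode k)

theorem orthonormal_mode : Orthonormal ℝ mode := by
  rw [orthonormal_iff_ite]
  intro j k
  rw [inner_eq_pairing _ (coe_mode k)]
  have e : pairing (mode j) (modeField k) =
      ∫ x in unitSquare, (2 * (j.1 0 * k.1 0 + j.1 1 * k.1 1) / (waveLength j * waveLength k)) *
        (profile j (phase j x) * profile k (phase k x)) := by
    refine integral_congr_ae ?_
    filter_upwards [coe_mode j] with x hx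
    rw [hx, modeField, modeField, phase_apply, phase_apply, real_inner_smul_left,
      real_inner_smul_right]
    have h2 : √2 * √2 = (2 : ℝ) := Real.mul_self_sqrt (by norm_num)
    have := waveLength_pos j
    have := waveLength_pos k
    simp [PiLp.inner_apply, Fin.sum_univ_two]
    field_simp
    rw [show √2 ^ 2 = (2 : ℝ) by norm_num]
    ring
  rw [e, integral_const_mul, integral_profile_mul_profile]
  split_ifs with h
  · subst h
    have := waveLength_pos j
    have h2 := sq_waveLength j
    field_simp
    linarith
  · simp

theorem coeff_mode (j k : WaveVector) : coeff (mode j) k = if j = k then 1 else 0 :=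
  orthonormal_iff_ite.1 orthonormal_mode j k

theorem coeff_sub (u v : VelocitySpace) (k : WaveVector) :
    coeff (u - v) k = coeff u k - coeff v k := inner_sub_left _ _ _

theorem continuous_coeff (k : WaveVector) : Continuous fun u => coeff u k := by
  unfold coeff
  fun_prop

theorem coeff_spectralProj (N : ℕ) (u : VelocitySpace) (k : WaveVector) :
    coeff (spectralProj N u) k = if waveLength k ≤ N then coeff u k else 0 := by
  unfold coeff spectralProj
  rw [Submodule.inner_starProjection_left_eq_right]
  split_ifs with h
  · have hk : mode k ∈ modeSpan N := Submodule.subset_span (mem_image_of_mem _ h)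
    rw [Submodule.starProjection_eq_self_iff.2 hk]
  · rw [(Submodule.starProjection_apply_eq_zero_iff _).2 ?_, inner_zero_right]
    rw [Submodule.mem_orthogonal]
    intro v hv
    induction hv using Submodule.span_induction with
    | mem x hx =>
      obtain ⟨j, hj, rfl⟩ := hx
      rw [orthonormal_iff_ite.1 orthonormal_mode j k, if_neg]
      rintro rfl
      exact h hj
    | zero => simp
    | add x y _ _ hx hy => rw [inner_add_left, hx, hy, add_zero]
    | smul c x _ hx => rw [real_inner_smul_left, hx, mul_zero]

theorem norm_le_waveLength (k : WaveVector) : ‖k.1‖ ≤ waveLength k := by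
  rw [pi_norm_le_iff_of_nonneg (waveLength_pos k).le]
  intro i
  rw [Int.norm_eq_abs]
  refine abs_le_of_sq_le_sq ?_ (waveLength_pos k).le
  rw [sq_waveLength]
  fin_cases i <;> simp <;> positivity

theorem one_le_waveLength (k : WaveVector) : 1 ≤ waveLength k := by
  refine le_trans ?_ (norm_le_waveLength k)
  rcases waveVector_ne_zero k with h | h
  · exact le_trans (by rw [Int.norm_eq_abs]; exact_mod_cast Int.one_le_abs h)
      (norm_le_pi_norm k.1 0)
  · exact le_trans (by rw [Int.norm_eq_abs]; exact_mod_cast Int.one_le_abs h)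
      (norm_le_pi_norm k.1 1)

/-- `∑_k |k|^s` converges over the planar lattice for `s < -2`. -/
theorem summable_waveLength_rpow {s : ℝ} (hs : s < -2) :
    Summable fun k : WaveVector => waveLength k ^ s := by
  have h := (EisensteinSeries.summable_one_div_norm_rpow (k := -s) (by linarith)).comp_injective
    (Subtype.val_injective (p := fun k : Fin 2 → ℤ => k ≠ 0))
  refine h.of_nonneg_of_le (fun k => Real.rpow_nonneg (waveLength_pos k).le _) fun k => ?_
  simp only [Function.comp_apply, neg_neg]
  exact Real.rpow_le_rpow_of_nonpos (norm_pos_iff.2 k.2) (norm_le_waveLength k) (by linarith)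

/-! ### Completeness of the modes -/

open UnitAddTorus in
/-- A square integrable function on the cube `(0, 1]²` whose Fourier coefficients vanish is zero. -/
theorem ae_eq_zero_of_integral_trig {f : (Fin 2 → ℝ) → ℝ}
    (hf : MemLp f 2 (volume.restrict {x : Fin 2 → ℝ | ∀ i, x i ∈ Ioc (0 : ℝ) (0 + 1)}))
    (h : ∀ n : Fin 2 → ℤ,
      ∫ x in {x : Fin 2 → ℝ | ∀ i, x i ∈ Ioc (0 : ℝ) (0 + 1)}, mFourier n (fun i => x i) * (f x : ℂ) = 0) :
    f =ᵐ[volume.restrict {x : Fin 2 → ℝ | ∀ i, x i ∈ Ioc (0 : ℝ) (0 + 1)}] 0 := by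
  set S : Set (Fin 2 → ℝ) := {x | ∀ i, x i ∈ Ioc (0 : ℝ) (0 + 1)} with hS
  have hSm : MeasurableSet S := MeasurableSet.univ_pi' fun i => measurableSet_Ioc
  let rep : UnitAddTorus (Fin 2) → (Fin 2 → ℝ) := fun x => (measurableEquivPiIoc 0 x).1
  have hrep : MeasurePreserving rep _ (volume.restrict S) :=
    MeasurePreserving.comp (measurePreserving_subtype_coe hSm) (measurePreserving_equivPiIoc (0 : Fin 2 → ℝ))
  have hrep' : ∀ x ∈ S, rep (fun i => (x i : UnitAddCircle)) = x := by
    intro x hx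
    have := (measurableEquivPiIoc (0 : Fin 2 → ℝ)).apply_symm_apply ⟨x, hx⟩
    exact congrArg Subtype.val this
  have hF : MemLp (fun t => (f (rep t) : ℂ)) 2 _ := hf.ofReal.comp_measurePreserving hrep
  have hc : ∀ n, mFourierCoeff (hF.toLp _) n = 0 := by
    intro n
    have e : mFourierCoeff (hF.toLp _) n = mFourierCoeff (fun t => (f (rep t) : ℂ)) n := by
      refine integral_congr_ae ?_
      filter_upwards [hF.coeFn_toLp] with t ht
      rw [ht]
    rw [e, mFourierCoeff_eq_integral _ _ (0 : Fin 2 → ℝ), ← h (-n)]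
    refine setIntegral_congr_fun hSm fun x hx => ?_
    simp only [hrep' x hx, smul_eq_mul]
  have h0 : hF.toLp _ = 0 := by
    apply mFourierBasis.repr.injective
    ext n
    rw [mFourierBasis_repr, hc, map_zero]
    rfl
  have h1 := hF.coeFn_toLp
  rw [h0] at h1
  have h2 := (h1.symm.trans (Lp.coeFn_zero _ _ _))
  have h4 : MeasurePreserving (fun x : S => (measurableEquivPiIoc (0 : Fin 2 → ℝ)).symm x) _ _ :=
    (measurePreserving_equivPiIoc (0 : Fin 2 → ℝ)).symm
  have h5 := h4.quasiMeasurePreserving.ae h2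
  refine (ae_restrict_iff_subtype hSm).2 ?_
  filter_upwards [h5] with x hx
  have h6 : rep ((measurableEquivPiIoc (0 : Fin 2 → ℝ)).symm x) = x :=
    congrArg Subtype.val ((measurableEquivPiIoc (0 : Fin 2 → ℝ)).apply_symm_apply x)
  simp only [h6] at hx
  simpa using hx

theorem measurePreserving_toLp_unitSquare :
    MeasurePreserving (WithLp.toLp 2 : (Fin 2 → ℝ) → Plane)
      (volume.restrict {x : Fin 2 → ℝ | ∀ i, x i ∈ Ioc (0 : ℝ) (0 + 1)}) squareMeasure := by
  have hpre : WithLp.toLp 2 ⁻¹' unitSquare = Icc (0 : Fin 2 → ℝ) 1 := by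
    ext x
    simp [unitSquare, Pi.le_def, forall_and]
  have h1 := (PiLp.volume_preserving_toLp (Fin 2)).restrict_preimage
    isCompact_unitSquare.measurableSet
  have h2 : ({x : Fin 2 → ℝ | ∀ i, x i ∈ Ioc (0 : ℝ) (0 + 1)} : Set _) =ᵐ[volume]
      Icc (0 : Fin 2 → ℝ) 1 := by
    have := Measure.univ_pi_Ioc_ae_eq_Icc (f := (0 : Fin 2 → ℝ)) (g := 1)
      (μ := fun _ : Fin 2 => (volume : Measure ℝ))
    have e : {x : Fin 2 → ℝ | ∀ i, x i ∈ Ioc (0 : ℝ) (0 + 1)} =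
        univ.pi fun i => Ioc ((0 : Fin 2 → ℝ) i) ((1 : Fin 2 → ℝ) i) := by
      ext x
      simp
    rw [e]
    exact this
  rw [hpre] at h1
  rw [Measure.restrict_congr_set h2]
  exact h1

/-- A square integrable function on the unit square that is orthogonal to all trigonometric
functions is zero. -/
theorem ae_eq_zero_of_integral_cos_sin {g : Plane → ℝ} (hg : MemLp g 2 squareMeasure)
    (h1 : ∫ x in unitSquare, g x = 0)
    (hc : ∀ k : WaveVector, ∫ x in unitSquare, Real.cos (phase k x) * g x = 0)
    (hs : ∀ k : WaveVector, ∫ x in unitSquare, Real.sin (phase k x) * g x = 0) :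
    g =ᵐ[squareMeasure] 0 := by
  have hmp := measurePreserving_toLp_unitSquare
  have hemb : MeasurableEmbedding (WithLp.toLp 2 : (Fin 2 → ℝ) → Plane) :=
    (MeasurableEquiv.toLp 2 (Fin 2 → ℝ)).measurableEmbedding
  have hgi : Integrable g squareMeasure := hg.integrable (by norm_num)
  have key := ae_eq_zero_of_integral_trig (hg.comp_measurePreserving hmp) fun n => by
    have e : ∀ x : Fin 2 → ℝ, UnitAddTorus.mFourier n (fun i => (x i : UnitAddCircle)) *
        (((g ∘ WithLp.toLp 2) x : ℝ) : ℂ) = (fun z : Plane =>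
          Complex.exp ((2 * Real.pi * (n 0 * z 0 + n 1 * z 1) : ℝ) * Complex.I) * (g z : ℂ))
            (WithLp.toLp 2 x) := by
      intro x
      simp only [UnitAddTorus.mFourier, ContinuousMap.coe_mk, Fin.prod_univ_two, fourier_coe_apply,
        Function.comp_apply, ← Complex.exp_add]
      congr 2
      push_cast
      ring
    rw [integral_congr_ae (ae_of_all _ e), hmp.integral_comp hemb (fun z : Plane =>
      Complex.exp ((2 * Real.pi * (n 0 * z 0 + n 1 * z 1) : ℝ) * Complex.I) * (g z : ℂ))]
    by_cases hn : n = 0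
    · subst hn
      simp only [Pi.zero_apply, Int.cast_zero, zero_mul, add_zero, mul_zero, Complex.ofReal_zero,
        Complex.exp_zero, one_mul]
      rw [integral_complex_ofReal, h1, Complex.ofReal_zero]
    · have e2 : ∀ z : Plane, Complex.exp ((2 * Real.pi * (n 0 * z 0 + n 1 * z 1) : ℝ) * Complex.I) *
          (g z : ℂ) = ((Real.cos (phase ⟨n, hn⟩ z) * g z : ℝ) : ℂ) +
            ((Real.sin (phase ⟨n, hn⟩ z) * g z : ℝ) : ℂ) * Complex.I := by
        intro z
        rw [phase_apply, Complex.exp_mul_I, ← Complex.ofReal_cos, ← Complex.ofReal_sin]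
        push_cast
        ring
      have hb : ∀ F : ℝ → ℝ, Continuous F → (∀ θ, |F θ| ≤ 1) →
          Integrable (fun z => F (phase ⟨n, hn⟩ z) * g z) squareMeasure := by
        intro F hF hF1
        refine hgi.bdd_mul (c := 1) (by fun_prop) (ae_of_all _ fun z => ?_)
        exact hF1 _
      simp_rw [e2]
      rw [integral_add (hb _ Real.continuous_cos Real.abs_cos_le_one).ofReal
        ((hb _ Real.continuous_sin Real.abs_sin_le_one).ofReal.mul_const _), integral_mul_const,
        integral_complex_ofReal, integral_complex_ofReal, hc, hs]
      simp
  have h3 : MeasurePreserving (MeasurableEquiv.toLp 2 (Fin 2 → ℝ))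
    (volume.restrict {x : Fin 2 → ℝ | ∀ i, x i ∈ Ioc (0 : ℝ) (0 + 1)}) squareMeasure := hmp
  have h4 := h3.symm.quasiMeasurePreserving.ae key
  filter_upwards [h4] with x hx
  exact hx

theorem pairing_planeWave (u : L2Field) (k : WaveVector) {F : ℝ → ℝ} (hF : Continuous F)
    (hF1 : ∀ θ, |F θ| ≤ 1) (c : Plane) :
    pairing u (planeWave k F c) = c 0 * (∫ x in unitSquare, F (phase k x) * u x 0) +
      c 1 * (∫ x in unitSquare, F (phase k x) * u x 1) := by
  have hu : ∀ i : Fin 2, Integrable (fun x => u x i) squareMeasure := fun i =>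
    (EuclideanSpace.proj i : Plane →L[ℝ] ℝ).integrable_comp ((Lp.memLp u).integrable (by norm_num))
  have hb : ∀ i : Fin 2, Integrable (fun z => F (phase k z) * u z i) squareMeasure := fun i =>
    (hu i).bdd_mul (c := 1) (by fun_prop) (ae_of_all _ fun z => hF1 _)
  rw [← integral_const_mul, ← integral_const_mul,
    ← integral_add ((hb 0).const_mul _) ((hb 1).const_mul _)]
  refine integral_congr_ae (ae_of_all _ fun x => ?_)
  simp [planeWave, PiLp.inner_apply, Fin.sum_univ_two]
  ring

theorem gradient_comp_phase (k : WaveVector) {F F' : ℝ → ℝ} (hd : ∀ θ, HasDerivAt F (F' θ) θ) :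
    gradient (fun x => F (phase k x)) =
      planeWave k F' ((2 * Real.pi) • !₂[(k.1 0 : ℝ), (k.1 1 : ℝ)]) := by
  ext1 x
  have h : HasFDerivAt (fun x => F (phase k x)) (F' (phase k x) • (phase k : Plane →L[ℝ] ℝ)) x :=
    (hd _).comp_hasFDerivAt x (phase k).hasFDerivAt
  refine ext_inner_right ℝ fun y => ?_
  rw [gradient, InnerProductSpace.toDual_symm_apply, h.fderiv]
  simp [planeWave, PiLp.inner_apply, Fin.sum_univ_two, phase_apply]
  ring

/-- The negative of a wave vector. -/
def negWave (k : WaveVector) : WaveVector := ⟨-k.1, neg_ne_zero.2 k.2⟩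

theorem phase_negWave (k : WaveVector) (x : Plane) : phase (negWave k) x = -phase k x := by
  simp only [phase_apply, negWave, Pi.neg_apply]
  push_cast
  ring

theorem isUpper_negWave (k : WaveVector) : IsUpper (negWave k) ↔ ¬IsUpper k := by
  have := waveVector_ne_zero k
  unfold IsUpper negWave
  simp only [Pi.neg_apply]
  omega

/-- The modes are complete in `𝓗`: vanishing mean and divergence of `u` annihilate the part of each
Fourier coefficient that is parallel to the wave vector, and the modes the orthogonal part. -/
theorem eq_zero_of_coeff_eq_zero (u : VelocitySpace) (h : ∀ k, coeff u k = 0) : u = 0 := by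
  set w : L2Field := u.1 with hw
  obtain ⟨hmean, hdiv⟩ := u.2
  have hwi : Integrable w squareMeasure := (Lp.memLp w).integrable (by norm_num)
  have hmean' : ∀ i : Fin 2, ∫ x in unitSquare, w x i = 0 := fun i => by
    have := (EuclideanSpace.proj i : Plane →L[ℝ] ℝ).integral_comp_comm hwi
    rw [hmean, map_zero] at this
    exact this
  -- each mode tests the component along `k^⊥` against the profile of `k`
  have hperp : ∀ k : WaveVector,
      -(k.1 1 : ℝ) * (∫ x in unitSquare, profile k (phase k x) * w x 0) +
        k.1 0 * ∫ x in unitSquare, profile k (phase k x) * w x 1 = 0 := by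
    intro k
    have hk := h k
    rw [coeff_eq_pairing, modeField_eq_planeWave, pairing_planeWave] at hk
    · have h1 : (√2 / waveLength k) ≠ 0 := by have := waveLength_pos k; positivity
      have h2 : (√2 / waveLength k) * (-(k.1 1 : ℝ) *
          (∫ x in unitSquare, profile k (phase k x) * w x 0) +
          k.1 0 * ∫ x in unitSquare, profile k (phase k x) * w x 1) = 0 := by
        rw [← hk]
        simp [hw]
        ring
      exact (mul_eq_zero.1 h2).resolve_left h1
    · exact (profile_contDiff k).continuous
    · exact abs_profile_le_one k
  have hperp' : ∀ k : WaveVector,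
      (-(k.1 1 : ℝ) * (∫ x in unitSquare, Real.cos (phase k x) * w x 0) +
        k.1 0 * (∫ x in unitSquare, Real.cos (phase k x) * w x 1) = 0) ∧
      (-(k.1 1 : ℝ) * (∫ x in unitSquare, Real.sin (phase k x) * w x 0) +
        k.1 0 * (∫ x in unitSquare, Real.sin (phase k x) * w x 1) = 0) := by
    intro k
    have h1 := hperp k
    have h2 := hperp (negWave k)
    simp only [phase_negWave] at h2
    by_cases hk : IsUpper k
    · rw [profile_of_isUpper hk] at h1
      rw [profile_of_not_isUpper (by rw [isUpper_negWave]; exact not_not.2 hk)] at h2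
      simp only [Real.sin_neg, neg_mul, integral_neg, negWave, Pi.neg_apply, Int.cast_neg] at h2
      exact ⟨h1, by linarith⟩
    · rw [profile_of_not_isUpper hk] at h1
      rw [profile_of_isUpper (by rw [isUpper_negWave]; exact hk)] at h2
      simp only [Real.cos_neg, negWave, Pi.neg_apply, Int.cast_neg] at h2
      exact ⟨by linarith, h1⟩
  -- gradients of scalar plane waves test the component along `k`
  have hpar : ∀ (k : WaveVector) {F F' : ℝ → ℝ}, ContDiff ℝ ∞ F → Continuous F' →
      (∀ θ, |F' θ| ≤ 1) → (∀ θ, HasDerivAt F (F' θ) θ) →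
      (∀ (θ : ℝ) (n : ℤ), F (θ + n * (2 * Real.pi)) = F θ) →
      (k.1 0 : ℝ) * (∫ x in unitSquare, F' (phase k x) * w x 0) +
        k.1 1 * (∫ x in unitSquare, F' (phase k x) * w x 1) = 0 := by
    intro k F F' hF hF' hF1 hd hp
    have h1 := hdiv (fun x => F (phase k x)) (hF.comp (phase k).contDiff) (fun i x => by
      simp only [map_add, phase_single, hp])
    rw [gradient_comp_phase k hd, pairing_planeWave _ _ hF' hF1] at h1
    have h2 : (2 * Real.pi) ≠ 0 := by positivity
    refine (mul_eq_zero.1 (?_ : 2 * Real.pi * _ = 0)).resolve_left h2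
    rw [← h1]
    simp [hw]
    ring
  have hsolve : ∀ (k : WaveVector) (p q : ℝ), -(k.1 1 : ℝ) * p + k.1 0 * q = 0 →
      (k.1 0 : ℝ) * p + k.1 1 * q = 0 → p = 0 ∧ q = 0 := by
    intro k p q h1 h2
    have h3 := sq_waveLength k
    have h4 : waveLength k ^ 2 ≠ 0 := by have := waveLength_pos k; positivity
    constructor
    · refine (mul_eq_zero.1 (?_ : waveLength k ^ 2 * p = 0)).resolve_left h4
      rw [h3]
      linear_combination (k.1 0 : ℝ) * h2 - (k.1 1 : ℝ) * h1
    · refine (mul_eq_zero.1 (?_ : waveLength k ^ 2 * q = 0)).resolve_left h4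
      rw [h3]
      linear_combination (k.1 1 : ℝ) * h2 + (k.1 0 : ℝ) * h1
  have hcos := fun k => hsolve k _ _ (hperp' k).1 (hpar k Real.contDiff_sin Real.continuous_cos
    Real.abs_cos_le_one Real.hasDerivAt_sin Real.sin_add_int_mul_two_pi)
  have hsin := fun k => hsolve k _ _ (hperp' k).2 (hpar k (F := fun θ => -Real.cos θ)
    Real.contDiff_cos.neg Real.continuous_sin Real.abs_sin_le_one
    (fun θ => by
      have h := (Real.hasDerivAt_cos θ).neg
      rw [neg_neg] at h
      exact h) (fun θ n => by rw [Real.cos_add_int_mul_two_pi]))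
  have hmem : ∀ i : Fin 2, MemLp (fun x => w x i) 2 squareMeasure := fun i =>
    (EuclideanSpace.proj i : Plane →L[ℝ] ℝ).comp_memLp' (Lp.memLp w)
  have h0 := ae_eq_zero_of_integral_cos_sin (hmem 0) (hmean' 0) (fun k => (hcos k).1)
    (fun k => (hsin k).1)
  have h1 := ae_eq_zero_of_integral_cos_sin (hmem 1) (hmean' 1) (fun k => (hcos k).2)
    (fun k => (hsin k).2)
  refine Subtype.ext (Lp.ext ?_)
  filter_upwards [h0, h1, Lp.coeFn_zero Plane 2 squareMeasure] with x hx0 hx1 hx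
  rw [ZeroMemClass.coe_zero, hx]
  ext i
  fin_cases i
  · exact hx0
  · exact hx1

/-- The modes as a Hilbert basis of `𝓗`. -/
def modeBasis : HilbertBasis WaveVector ℝ VelocitySpace :=
  HilbertBasis.mkOfOrthogonalEqBot orthonormal_mode (by
    rw [Submodule.eq_bot_iff]
    intro u hu
    refine eq_zero_of_coeff_eq_zero u fun k => ?_
    rw [coeff, real_inner_comm]
    exact (Submodule.mem_orthogonal _ _).1 hu _ (Submodule.subset_span (mem_range_self k)))

theorem modeBasis_apply (k : WaveVector) : modeBasis k = mode k := by
  simp [modeBasis]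

theorem hasSum_coeff_smul_mode (u : VelocitySpace) : HasSum (fun k => coeff u k • mode k) u := by
  have h := modeBasis.hasSum_repr u
  simp_rw [HilbertBasis.repr_apply_apply, modeBasis_apply, real_inner_comm] at h
  exact h

theorem hasSum_sq_coeff (u : VelocitySpace) : HasSum (fun k => coeff u k ^ 2) (‖u‖ ^ 2) := by
  have h := modeBasis.hasSum_inner_mul_inner u u
  simp_rw [modeBasis_apply, real_inner_self_eq_norm_sq] at h
  refine h.congr_fun fun k => ?_
  rw [coeff, real_inner_comm u, sq]

/-- Square summable coefficients define an element of `𝓗`. -/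
theorem exists_coeff_eq {c : WaveVector → ℝ} (hc : Summable fun k => c k ^ 2) :
    ∃ u : VelocitySpace, ∀ k, coeff u k = c k := by
  have hmem : Memℓp c 2 := memℓp_gen (by simpa using hc)
  refine ⟨modeBasis.repr.symm ⟨c, hmem⟩, fun k => ?_⟩
  rw [coeff, real_inner_comm, ← modeBasis_apply, ← HilbertBasis.repr_apply_apply]
  simp

theorem ext_coeff {u v : VelocitySpace} (h : ∀ k, coeff u k = coeff v k) : u = v := by
  rw [← sub_eq_zero]
  exact eq_zero_of_coeff_eq_zero _ fun k => by rw [coeff_sub, h, sub_self]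

instance secondCountableTopology_velocitySpace : SecondCountableTopology VelocitySpace := by
  have : SecondCountableTopology L2Field := by
    have : Fact ((2 : ENNReal) ≠ ⊤) := ⟨by norm_num⟩
    have := Lp.SecondCountableTopology (E := Plane) (μ := squareMeasure) (p := 2)
    exact this
  exact Topology.IsEmbedding.subtypeVal.secondCountableTopology

/-! ### Variation of constants for a scalar mode -/

/-- The solution `e^{-κt} (c + ∫₀ᵗ e^{κs} f(s) ds)` of `x' = -κ x + f`, `x(0) = c`. -/
def duhamel (κ c : ℝ) (f : ℝ → ℝ) (t : ℝ) : ℝ :=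
  Real.exp (-κ * t) * (c + ∫ s in (0 : ℝ)..t, Real.exp (κ * s) * f s)

theorem duhamel_zero (κ c : ℝ) (f : ℝ → ℝ) : duhamel κ c f 0 = c := by simp [duhamel]

theorem hasDerivAt_duhamel (κ c : ℝ) {f : ℝ → ℝ} (hf : Continuous f) (t : ℝ) :
    HasDerivAt (duhamel κ c f) (-κ * duhamel κ c f t + f t) t := by
  have hc : Continuous fun s => Real.exp (κ * s) * f s := by fun_prop
  have h1 := (intervalIntegral.integral_hasDerivAt_right (hc.intervalIntegrable 0 t)
    (hc.stronglyMeasurableAtFilter _ _) hc.continuousAt).const_add c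
  have h2 : HasDerivAt (fun t => Real.exp (-κ * t)) (Real.exp (-κ * t) * (-κ * 1)) t :=
    ((hasDerivAt_id t).const_mul (-κ)).exp
  refine (h2.mul h1).congr_deriv ?_
  have h3 : Real.exp (-κ * t) * Real.exp (κ * t) = 1 := by
    rw [← Real.exp_add]; simp
  unfold duhamel
  linear_combination f t * h3

theorem continuous_duhamel (κ c : ℝ) {f : ℝ → ℝ} (hf : Continuous f) :
    Continuous (duhamel κ c f) :=
  continuous_iff_continuousAt.2 fun t => (hasDerivAt_duhamel κ c hf t).continuousAt

theorem duhamel_sub_eq_integral (κ c : ℝ) {f : ℝ → ℝ} (hf : Continuous f) (t : ℝ) :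
    duhamel κ c f t - c = ∫ s in (0 : ℝ)..t, (-κ * duhamel κ c f s + f s) := by
  have hc : Continuous fun s => -κ * duhamel κ c f s + f s :=
    (continuous_const.mul (continuous_duhamel κ c hf)).add hf
  rw [intervalIntegral.integral_eq_sub_of_hasDerivAt (fun s _ => hasDerivAt_duhamel κ c hf s)
    (hc.intervalIntegrable _ _), duhamel_zero]

theorem abs_duhamel_le (κ c : ℝ) (f : ℝ → ℝ) {t : ℝ} (ht : 0 ≤ t) :
    |duhamel κ c f t| ≤ duhamel κ |c| (fun s => |f s|) t := by
  unfold duhamel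
  rw [abs_mul, Real.abs_exp]
  refine mul_le_mul_of_nonneg_left ((abs_add_le _ _).trans ?_) (Real.exp_pos _).le
  gcongr
  refine (intervalIntegral.abs_integral_le_integral_abs ht).trans_eq ?_
  simp_rw [abs_mul, Real.abs_exp]

theorem mul_integral_duhamel_le {κ c : ℝ} (hc : 0 ≤ c) {f : ℝ → ℝ} (hf : Continuous f)
    (hf0 : ∀ s, 0 ≤ f s) {T : ℝ} (hT : 0 ≤ T) :
    κ * ∫ s in (0 : ℝ)..T, duhamel κ c f s ≤ c + ∫ s in (0 : ℝ)..T, f s := by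
  have h := duhamel_sub_eq_integral κ c hf T
  have hD := continuous_duhamel κ c hf
  have hi : IntervalIntegrable (fun s => -κ * duhamel κ c f s) volume 0 T :=
    (continuous_const.mul hD).intervalIntegrable _ _
  rw [intervalIntegral.integral_add hi
    (hf.intervalIntegrable _ _), intervalIntegral.integral_const_mul] at h
  have h0 : 0 ≤ duhamel κ c f T := by
    have : 0 ≤ ∫ s in (0 : ℝ)..T, Real.exp (κ * s) * f s :=
      intervalIntegral.integral_nonneg hT fun s _ => mul_nonneg (Real.exp_pos _).le (hf0 s)
    unfold duhamel
    positivity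
  linarith

/-- The time integral of a damped mode gains a factor `1 / κ`. -/
theorem integral_abs_duhamel_le {κ : ℝ} (hκ : 0 < κ) (c : ℝ) {f : ℝ → ℝ} (hf : Continuous f)
    {T : ℝ} (hT : 0 ≤ T) :
    ∫ s in (0 : ℝ)..T, |duhamel κ c f s| ≤ (|c| + ∫ s in (0 : ℝ)..T, |f s|) / κ := by
  rw [le_div_iff₀' hκ]
  refine le_trans ?_ (mul_integral_duhamel_le (κ := κ) (abs_nonneg c) hf.abs (fun s => abs_nonneg _) hT)
  refine mul_le_mul_of_nonneg_left ?_ hκ.le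
  exact intervalIntegral.integral_mono_on hT ((continuous_duhamel κ c hf).abs.intervalIntegrable _ _)
    ((continuous_duhamel κ _ hf.abs).intervalIntegrable _ _)
    fun s hs => abs_duhamel_le κ c f hs.1

theorem abs_duhamel_le_of_bound {κ : ℝ} (hκ : 0 < κ) (c : ℝ) {f : ℝ → ℝ} (hf : Continuous f)
    {B : ℝ} (hB : ∀ s, |f s| ≤ B) {t : ℝ} (ht : 0 ≤ t) :
    |duhamel κ c f t| ≤ Real.exp (-κ * t) * |c| + B / κ := by
  refine (abs_duhamel_le κ c f ht).trans ?_
  have hB0 : 0 ≤ B := (abs_nonneg _).trans (hB 0)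
  have h1 : ∫ s in (0 : ℝ)..t, Real.exp (κ * s) * |f s| ≤
      ∫ s in (0 : ℝ)..t, Real.exp (κ * s) * B := by
    refine intervalIntegral.integral_mono_on ht (Continuous.intervalIntegrable (by fun_prop) _ _)
      (Continuous.intervalIntegrable (by fun_prop) _ _) fun s _ => ?_
    exact mul_le_mul_of_nonneg_left (hB s) (Real.exp_pos _).le
  have h2 : ∫ s in (0 : ℝ)..t, Real.exp (κ * s) * B = (Real.exp (κ * t) - 1) * (B / κ) := by
    rw [intervalIntegral.integral_eq_sub_of_hasDerivAt
      (f := fun s => Real.exp (κ * s) * (B / κ)) (fun s _ => ?_)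
      (Continuous.intervalIntegrable (by fun_prop) _ _)]
    · simp
      ring
    · refine (((hasDerivAt_id s).const_mul κ).exp.mul_const (B / κ)).congr_deriv ?_
      simp
      field_simp
  unfold duhamel
  rw [h2] at h1
  have h3 : Real.exp (-κ * t) * Real.exp (κ * t) = 1 := by
    rw [← Real.exp_add]; simp
  have h4 := mul_le_mul_of_nonneg_left h1 (Real.exp_pos (-κ * t)).le
  have h5 : 0 ≤ Real.exp (-κ * t) * (B / κ) := by positivity
  have h6 : Real.exp (-κ * t) * ((Real.exp (κ * t) - 1) * (B / κ)) =
      B / κ - Real.exp (-κ * t) * (B / κ) := by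
    linear_combination (B / κ) * h3
  rw [mul_add]
  linarith

theorem duhamel_sub_duhamel (κ c c' : ℝ) (f : ℝ → ℝ) (t : ℝ) :
    duhamel κ c f t - duhamel κ c' f t = duhamel κ (c - c') 0 t := by
  simp [duhamel]
  ring

/-- Duhamel's formula gives the only continuous solution of the integrated scalar equation. -/
theorem eq_duhamel_of_integral_eq {κ : ℝ} (hκ : 0 < κ) (c : ℝ) {f x : ℝ → ℝ} (hf : Continuous f)
    {T : ℝ} (hx : ContinuousOn x (Icc 0 T))
    (h : ∀ t ∈ Icc 0 T, x t = c + ∫ s in (0 : ℝ)..t, (-κ * x s + f s)) {t : ℝ}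
    (ht : t ∈ Icc 0 T) : x t = duhamel κ c f t := by
  have hD := continuous_duhamel κ c hf
  have hd : ContinuousOn (fun s => |x s - duhamel κ c f s|) (Icc 0 T) :=
    (hx.sub hD.continuousOn).abs
  have key := le_mul_exp_of_le_add_integral (L := fun _ => κ) (A := 0) (T := T)
    intervalIntegrable_const (fun _ _ => hκ.le) hd le_rfl (fun t ht => ?_) ht
  · rw [zero_mul] at key
    exact sub_eq_zero.1 (abs_nonpos_iff.1 key)
  · have hxt : ContinuousOn x (uIcc 0 t) := by
      rw [uIcc_of_le ht.1]; exact hx.mono (Icc_subset_Icc_right ht.2)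
    have e : x t - duhamel κ c f t = ∫ s in (0 : ℝ)..t, -κ * (x s - duhamel κ c f s) := by
      have h1 := duhamel_sub_eq_integral κ c hf t
      have h2 := h t ht
      have h3 : x t - duhamel κ c f t = (∫ s in (0 : ℝ)..t, (-κ * x s + f s)) -
          ∫ s in (0 : ℝ)..t, (-κ * duhamel κ c f s + f s) := by linarith
      have hi1 : IntervalIntegrable (fun s => -κ * x s + f s) volume 0 t :=
        ((continuousOn_const.mul hxt).add hf.continuousOn).intervalIntegrable
      have hi2 : IntervalIntegrable (fun s => -κ * duhamel κ c f s + f s) volume 0 t :=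
        ((continuous_const.mul hD).add hf).intervalIntegrable _ _
      rw [h3, ← intervalIntegral.integral_sub hi1 hi2]
      congr 1
      ext s
      ring
    rw [zero_add, e]
    refine (intervalIntegral.abs_integral_le_integral_abs ht.1).trans_eq ?_
    congr 1
    ext s
    rw [abs_mul, abs_neg, abs_of_pos hκ]

/-! ### The forcing -/

theorem eigenvalue_pos (k : WaveVector) : 0 < eigenvalue k := by
  have := waveLength_pos k
  unfold eigenvalue
  positivity

theorem sq_waveLength_le_eigenvalue (k : WaveVector) : waveLength k ^ 2 ≤ eigenvalue k := by
  have h1 : 1 ≤ 4 * Real.pi ^ 2 := by nlinarith [Real.pi_gt_three]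
  exact le_mul_of_one_le_left (sq_nonneg _) h1

theorem one_le_eigenvalue (k : WaveVector) : 1 ≤ eigenvalue k :=
  (one_le_pow₀ (one_le_waveLength k)).trans (sq_waveLength_le_eigenvalue k)

theorem MemHs.sub {s : ℝ} {u v : VelocitySpace} (hu : MemHs s u) (hv : MemHs s v) :
    MemHs s (u - v) := by
  refine ((hu.mul_left 2).add (hv.mul_left 2)).of_nonneg_of_le
    (fun k => mul_nonneg (Real.rpow_nonneg (eigenvalue_pos k).le _) (sq_nonneg _)) fun k => ?_
  rw [coeff_sub]
  have h := Real.rpow_nonneg (eigenvalue_pos k).le s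
  nlinarith [mul_nonneg h (sq_nonneg (coeff u k + coeff v k))]

theorem sq_hsNorm (s : ℝ) (u : VelocitySpace) :
    hsNorm s u ^ 2 = ∑' k, eigenvalue k ^ s * coeff u k ^ 2 :=
  Real.sq_sqrt (tsum_nonneg fun k =>
    mul_nonneg (Real.rpow_nonneg (eigenvalue_pos k).le _) (sq_nonneg _))

theorem norm_le_hsNorm {s : ℝ} (hs : 0 ≤ s) {u : VelocitySpace} (hu : MemHs s u) :
    ‖u‖ ≤ hsNorm s u := by
  refine (abs_le_of_sq_le_sq' (b := hsNorm s u) ?_ (Real.sqrt_nonneg _)).2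
  rw [sq_hsNorm, ← (hasSum_sq_coeff u).tsum_eq]
  refine (hasSum_sq_coeff u).summable.tsum_le_tsum (fun k => ?_) hu
  exact le_mul_of_one_le_left (sq_nonneg _) (Real.one_le_rpow (one_le_eigenvalue k) hs)

theorem ContinuousInHs.continuousOn {γ T : ℝ} (hγ : 0 ≤ γ) {ψ : ℝ → VelocitySpace}
    (hψ : ContinuousInHs γ T ψ) : ContinuousOn ψ (Icc 0 T) := by
  intro t ht
  refine tendsto_iff_norm_sub_tendsto_zero.2 ?_
  refine squeeze_zero' (Eventually.of_forall fun _ => norm_nonneg _) ?_ (hψ.2 t ht)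
  filter_upwards [self_mem_nhdsWithin] with τ hτ
  exact norm_le_hsNorm hγ ((hψ.1 τ hτ).sub (hψ.1 t ht))

theorem ContinuousInHs.exists_bound {γ T : ℝ} {ψ : ℝ → VelocitySpace}
    (hψ : ContinuousInHs γ T ψ) :
    ∃ M, 0 ≤ M ∧ ∀ t ∈ Icc 0 T, ∑' k, eigenvalue k ^ γ * coeff (ψ t) k ^ 2 ≤ M := by
  have h : ∃ M, ∀ t ∈ Icc 0 T, t ∈ Icc 0 T →
      ∑' k, eigenvalue k ^ γ * coeff (ψ t) k ^ 2 ≤ M := by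
    refine isCompact_Icc.induction_on (p := fun S => ∃ M, ∀ t ∈ S, t ∈ Icc 0 T →
      ∑' k, eigenvalue k ^ γ * coeff (ψ t) k ^ 2 ≤ M) ⟨0, by simp⟩ ?_ ?_ ?_
    · rintro s t hst ⟨M, hM⟩
      exact ⟨M, fun τ hτ => hM τ (hst hτ)⟩
    · rintro s t ⟨M, hM⟩ ⟨M', hM'⟩
      exact ⟨max M M', fun τ hτ hτT => hτ.elim (fun h => (hM τ h hτT).trans (le_max_left _ _))
        fun h => (hM' τ h hτT).trans (le_max_right _ _)⟩
    · intro t ht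
      refine ⟨_, inter_mem ((hψ.2 t ht).eventually (gt_mem_nhds one_pos)) self_mem_nhdsWithin,
        2 * 1 + 2 * ∑' k, eigenvalue k ^ γ * coeff (ψ t) k ^ 2, ?_⟩
      rintro τ ⟨h1, hτ⟩ -
      have h2 : ∑' k, eigenvalue k ^ γ * coeff (ψ τ - ψ t) k ^ 2 ≤ 1 := by
        rw [← sq_hsNorm]
        exact pow_le_one₀ (Real.sqrt_nonneg _) (le_of_lt h1)
      have hs := (hψ.1 τ hτ).sub (hψ.1 t ht)
      refine le_trans ?_ (add_le_add_left (mul_le_mul_of_nonneg_left h2 zero_le_two) _)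
      rw [← tsum_mul_left, ← tsum_mul_left, ← (hs.mul_left 2).tsum_add ((hψ.1 t ht).mul_left 2)]
      refine (hψ.1 τ hτ).tsum_le_tsum (fun k => ?_) ((hs.mul_left 2).add ((hψ.1 t ht).mul_left 2))
      rw [coeff_sub]
      have h := Real.rpow_nonneg (eigenvalue_pos k).le γ
      nlinarith [mul_nonneg h (sq_nonneg (coeff (ψ τ) k - 2 * coeff (ψ t) k))]
  obtain ⟨M, hM⟩ := h
  exact ⟨max M 0, le_max_right _ _, fun t ht => (hM t ht ht).trans (le_max_left _ _)⟩

/-- The `k`-th coefficient of the forcing, extended from `[0, T]` to all times by its end values. -/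
def forcing (T : ℝ) (ψ : ℝ → VelocitySpace) (k : WaveVector) (s : ℝ) : ℝ :=
  coeff (ψ (max 0 (min s T))) k

theorem clamp_mem {T : ℝ} (hT : 0 ≤ T) (s : ℝ) : max 0 (min s T) ∈ Icc 0 T :=
  ⟨le_max_left _ _, max_le hT (min_le_right _ _)⟩

theorem forcing_of_mem {T : ℝ} (ψ : ℝ → VelocitySpace) (k : WaveVector) {s : ℝ}
    (hs : s ∈ Icc 0 T) : forcing T ψ k s = coeff (ψ s) k := by
  rw [forcing, min_eq_left hs.2, max_eq_right hs.1]

theorem continuous_forcing {T : ℝ} (hT : 0 ≤ T) {ψ : ℝ → VelocitySpace}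
    (hψ : ContinuousOn ψ (Icc 0 T)) (k : WaveVector) : Continuous (forcing T ψ k) :=
  (continuous_coeff k).comp (hψ.comp_continuous (by fun_prop) (clamp_mem hT))

/-- The coefficient `v_k(t)` of the solution of the Stokes equations. -/
def velCoeff (ν T : ℝ) (ψ : ℝ → VelocitySpace) (u : VelocitySpace) (k : WaveVector) : ℝ → ℝ :=
  duhamel (ν * eigenvalue k) (coeff u k) (forcing T ψ k)

theorem continuous_velCoeff (ν : ℝ) {T : ℝ} (hT : 0 ≤ T) {ψ : ℝ → VelocitySpace}
    (hψ : ContinuousOn ψ (Icc 0 T)) (u : VelocitySpace) (k : WaveVector) :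
    Continuous (velCoeff ν T ψ u k) :=
  continuous_duhamel _ _ (continuous_forcing hT hψ k)

/-- The forced part of the Stokes flow has absolutely summable coefficients, uniformly in time. -/
theorem exists_velCoeff_bound {ν γ T : ℝ} (hν : 0 < ν) (hγ : 0 < γ) (hT : 0 ≤ T)
    {ψ : ℝ → VelocitySpace} (hψ : ContinuousInHs γ T ψ) :
    ∃ b : WaveVector → ℝ, (∀ k, 0 ≤ b k) ∧ Summable b ∧ ∀ u k t, 0 ≤ t →
      |velCoeff ν T ψ u k t| ≤ Real.exp (-(ν * eigenvalue k) * t) * |coeff u k| + b k := by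
  obtain ⟨M, hM0, hM⟩ := hψ.exists_bound
  refine ⟨fun k => √M * waveLength k ^ (-γ) / (ν * eigenvalue k), fun k => ?_, ?_, ?_⟩
  · have := eigenvalue_pos k
    have := Real.rpow_nonneg (waveLength_pos k).le (-γ)
    positivity
  · refine ((summable_waveLength_rpow (s := -2 - γ) (by linarith)).mul_left (√M / ν)).of_nonneg_of_le
      (fun k => ?_) fun k => ?_
    · have := eigenvalue_pos k
      have := Real.rpow_nonneg (waveLength_pos k).le (-γ)
      positivity
    · have h1 := eigenvalue_pos k
      have h2 := Real.rpow_nonneg (waveLength_pos k).le (-γ)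
      have h3 := waveLength_pos k
      rw [show (-2 - γ : ℝ) = -γ - (2 : ℕ) by push_cast; ring, Real.rpow_sub_natCast h3.ne',
        mul_div_assoc', div_mul_eq_mul_div, div_div]
      gcongr
      exact sq_waveLength_le_eigenvalue k
  · intro u k t ht
    refine abs_duhamel_le_of_bound (mul_pos hν (eigenvalue_pos k)) _
      (continuous_forcing hT (hψ.continuousOn hγ.le) k) (fun s => ?_) ht
    have hs := clamp_mem hT s
    set τ := max 0 (min s T) with hτ
    have h1 : eigenvalue k ^ γ * coeff (ψ τ) k ^ 2 ≤ M :=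
      ((hψ.1 τ hs).le_tsum k fun j _ =>
        mul_nonneg (Real.rpow_nonneg (eigenvalue_pos j).le _) (sq_nonneg _)).trans (hM τ hs)
    have h2 : (waveLength k ^ γ) ^ 2 ≤ eigenvalue k ^ γ := by
      rw [← Real.rpow_natCast, ← Real.rpow_mul (waveLength_pos k).le, mul_comm γ,
        Real.rpow_mul (waveLength_pos k).le, Real.rpow_natCast]
      exact Real.rpow_le_rpow (sq_nonneg _) (sq_waveLength_le_eigenvalue k) hγ.le
    have h3 := Real.rpow_pos_of_pos (waveLength_pos k) γ
    rw [Real.rpow_neg (waveLength_pos k).le, ← div_eq_mul_inv, le_div_iff₀ h3]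
    refine Real.le_sqrt_of_sq_le ?_
    rw [show forcing T ψ k s = coeff (ψ τ) k from rfl, mul_pow, sq_abs]
    nlinarith [mul_le_mul_of_nonneg_right h2 (sq_nonneg (coeff (ψ τ) k))]

/-- The forcing is absolutely summable with the weight `1 / |k|`; this is where `γ > 0` enters. -/
theorem summable_integral_forcing {γ T : ℝ} (hγ : 0 < γ) (hT : 0 ≤ T)
    {ψ : ℝ → VelocitySpace} (hψ : ContinuousInHs γ T ψ) :
    Summable fun k => (∫ s in (0 : ℝ)..T, |forcing T ψ k s|) / waveLength k := by
  obtain ⟨M, hM0, hM⟩ := hψ.exists_bound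
  have hsum := summable_waveLength_rpow (s := -2 - 2 * γ) (by linarith)
  have hcont := fun k => continuous_forcing hT (hψ.continuousOn hγ.le) k
  refine summable_of_sum_le (c := T * ((∑' k : WaveVector, waveLength k ^ (-2 - 2 * γ)) + M))
    (fun k => ?_) fun F => ?_
  · exact div_nonneg (intervalIntegral.integral_nonneg hT fun s _ => abs_nonneg _)
      (waveLength_pos k).le
  · simp_rw [← intervalIntegral.integral_div]
    rw [← intervalIntegral.integral_finsetSum fun k _ =>
      ((hcont k).abs.div_const _).intervalIntegrable _ _]
    refine (intervalIntegral.integral_mono_on hT (Continuous.intervalIntegrable ?_ _ _)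
      (intervalIntegrable_const (c := (∑' k : WaveVector, waveLength k ^ (-2 - 2 * γ)) + M))
      fun s hs => ?_).trans_eq ?_
    · exact continuous_finsetSum _ fun k _ => (hcont k).abs.div_const _
    · have hle : ∀ k, |forcing T ψ k s| / waveLength k ≤
          waveLength k ^ (-2 - 2 * γ) + eigenvalue k ^ γ * coeff (ψ s) k ^ 2 := by
        intro k
        rw [forcing_of_mem ψ k hs]
        have hk := waveLength_pos k
        have h3 := Real.rpow_pos_of_pos hk γ
        have h2 : (waveLength k ^ γ) ^ 2 ≤ eigenvalue k ^ γ := by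
          rw [← Real.rpow_natCast, ← Real.rpow_mul hk.le, mul_comm γ,
            Real.rpow_mul hk.le, Real.rpow_natCast]
          exact Real.rpow_le_rpow (sq_nonneg _) (sq_waveLength_le_eigenvalue k) hγ.le
        have h4 : waveLength k ^ (-2 - 2 * γ) = (1 / (waveLength k * waveLength k ^ γ)) ^ 2 := by
          rw [show (-2 - 2 * γ : ℝ) = -((1 + γ) * (2 : ℕ)) by push_cast; ring, Real.rpow_neg hk.le,
            Real.rpow_mul hk.le, Real.rpow_natCast, Real.rpow_add hk, Real.rpow_one, one_div, inv_pow]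
        have h5 : |coeff (ψ s) k| / waveLength k =
            (1 / (waveLength k * waveLength k ^ γ)) * (waveLength k ^ γ * |coeff (ψ s) k|) := by
          field_simp
        have h6 : (waveLength k ^ γ * |coeff (ψ s) k|) ^ 2 ≤
            eigenvalue k ^ γ * coeff (ψ s) k ^ 2 := by
          rw [mul_pow, sq_abs]
          exact mul_le_mul_of_nonneg_right h2 (sq_nonneg _)
        rw [h5, h4]
        nlinarith [sq_nonneg (1 / (waveLength k * waveLength k ^ γ) -
          waveLength k ^ γ * |coeff (ψ s) k|), sq_nonneg (1 / (waveLength k * waveLength k ^ γ) +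
          waveLength k ^ γ * |coeff (ψ s) k|)]
      refine (Finset.sum_le_sum fun k _ => hle k).trans ?_
      rw [Finset.sum_add_distrib]
      exact add_le_add (hsum.sum_le_tsum _ fun k _ => Real.rpow_nonneg (waveLength_pos k).le _)
        (((hψ.1 s hs).sum_le_tsum _ fun k _ => mul_nonneg
          (Real.rpow_nonneg (eigenvalue_pos k).le _) (sq_nonneg _)).trans (hM s hs))
    · simp
      ring

/-! ### Solutions of the Stokes equations -/

/-- The directional derivative of a periodic field is periodic. -/
theorem IsPeriodic.fderiv_apply {F : Type*} [NormedAddCommGroup F] [NormedSpace ℝ F]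
    {w : Plane → F} (hp : IsPeriodic w) (v : Plane) : IsPeriodic fun x => fderiv ℝ w x v := by
  intro i x
  have : (fun y => w (y + EuclideanSpace.single i 1)) = w := funext (hp i)
  simp only
  rw [← fderiv_comp_add_right, this]

theorem laplacian_eq_sum (w : Plane → Plane) (hw : ContDiff ℝ ∞ w) (x : Plane) :
    Laplacian.laplacian w x = ∑ i : Fin 2,
      fderiv ℝ (fun y => fderiv ℝ w y (EuclideanSpace.single i 1)) x (EuclideanSpace.single i 1) := by
  rw [InnerProductSpace.laplacian_eq_iteratedFDeriv_orthonormalBasis _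
    (EuclideanSpace.basisFun (Fin 2) ℝ)]
  refine Finset.sum_congr rfl fun i _ => ?_
  have hd : DifferentiableAt ℝ (fderiv ℝ w) x :=
    (hw.fderiv_right (m := 1) (by norm_cast)).differentiable one_ne_zero x
  rw [iteratedFDeriv_two_apply, fderiv_clm_apply hd (differentiableAt_const _)]
  simp

theorem contDiff_fderiv_single {w : Plane → Plane} (hw : ContDiff ℝ ∞ w) (v : Plane) :
    ContDiff ℝ ∞ fun x => fderiv ℝ w x v :=
  (hw.fderiv_right (m := ∞) (by norm_cast)).clm_apply contDiff_const

theorem continuous_laplacian {w : Plane → Plane} (hw : ContDiff ℝ ∞ w) :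
    Continuous (Laplacian.laplacian w) := by
  rw [funext (laplacian_eq_sum w hw)]
  exact continuous_finsetSum _ fun i _ =>
    (contDiff_fderiv_single (contDiff_fderiv_single hw _) _).continuous

/-- Green's second identity on the torus. -/
theorem integral_inner_laplacian_comm {p w : Plane → Plane} (hp : ContDiff ℝ ∞ p)
    (hpp : IsPeriodic p) (hw : ContDiff ℝ ∞ w) (hwp : IsPeriodic w) :
    ∫ x in unitSquare, ⟪p x, Laplacian.laplacian w x⟫ =
      ∫ x in unitSquare, ⟪Laplacian.laplacian p x, w x⟫ := by
  let D : (Plane → Plane) → Fin 2 → Plane → Plane := fun g i x =>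
    fderiv ℝ g x (EuclideanSpace.single i 1)
  have hD : ∀ {g : Plane → Plane}, ContDiff ℝ ∞ g → ∀ i, ContDiff ℝ ∞ (D g i) :=
    fun hg i => contDiff_fderiv_single hg _
  have hDp : ∀ {g : Plane → Plane}, IsPeriodic g → ∀ i, IsPeriodic (D g i) :=
    fun hg i => hg.fderiv_apply _
  let G : Plane → Plane := fun x => WithLp.toLp 2 fun i => ⟪p x, D w i x⟫ - ⟪D p i x, w x⟫
  have hGi : ∀ i, ContDiff ℝ 1 fun x => ⟪p x, D w i x⟫ - ⟪D p i x, w x⟫ := fun i =>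
    ((hp.inner ℝ (hD hw i)).sub ((hD hp i).inner ℝ hw)).of_le (by norm_cast)
  have hG : ContDiff ℝ 1 G := contDiff_euclidean.2 hGi
  have hGp : IsPeriodic G := by
    intro j x
    ext i
    simp only [G, hpp j x, hwp j x, hDp hpp i j x, hDp hwp i j x]
  have hdiff : ∀ {g : Plane → Plane}, ContDiff ℝ ∞ g → ∀ x, DifferentiableAt ℝ g x :=
    fun hg x => hg.differentiable (by simp) x
  have hdiv : ∀ x, divergence G x =
      ⟪p x, Laplacian.laplacian w x⟫ - ⟪Laplacian.laplacian p x, w x⟫ := by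
    intro x
    rw [laplacian_eq_sum w hw, laplacian_eq_sum p hp, inner_sum, sum_inner,
      ← Finset.sum_sub_distrib]
    refine Finset.sum_congr rfl fun i _ => ?_
    have h1 : fderiv ℝ G x (EuclideanSpace.single i 1) i =
        fderiv ℝ (fun x => ⟪p x, D w i x⟫ - ⟪D p i x, w x⟫) x (EuclideanSpace.single i 1) := by
      have hGx : HasFDerivAt G (fderiv ℝ G x) x :=
        (hG.differentiable one_ne_zero x).hasFDerivAt
      have := ((EuclideanSpace.proj i : Plane →L[ℝ] ℝ).hasFDerivAt.comp x hGx).fderiv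
      exact (DFunLike.congr_fun this _).symm
    rw [h1, fderiv_fun_sub ((hdiff hp x).inner ℝ (hdiff (hD hw i) x))
      ((hdiff (hD hp i) x).inner ℝ (hdiff hw x)), sub_apply,
      fderiv_inner_apply ℝ (hdiff hp x) (hdiff (hD hw i) x),
      fderiv_inner_apply ℝ (hdiff (hD hp i) x) (hdiff hw x)]
    simp only [D]
    ring
  have h := integral_divergence_eq_zero hG hGp
  simp_rw [hdiv] at h
  rw [integral_sub (integrableOn_unitSquare (hp.continuous.inner (continuous_laplacian hw)))
    (integrableOn_unitSquare ((continuous_laplacian hp).inner hw.continuous))] at h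
  exact sub_eq_zero.1 h

theorem pairing_mode_laplacian (k : WaveVector) {w : Plane → Plane} (hw : IsTestField w) :
    pairing (mode k) (Laplacian.laplacian w) = -eigenvalue k * pairing (mode k) w := by
  have h := integral_inner_laplacian_comm (modeField_isTestField k).smooth
    (modeField_isTestField k).periodic hw.smooth hw.periodic
  have e : ∀ g : Plane → Plane, pairing (mode k) g = ∫ x in unitSquare, ⟪modeField k x, g x⟫ := by
    intro g
    refine integral_congr_ae ?_
    filter_upwards [coe_mode k] with x hx
    rw [hx]
  rw [e, e, h, ← integral_const_mul]
  simp_rw [modeField_laplacian, real_inner_smul_left]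

theorem pairing_laplacian_modeField (u : L2Field) (k : WaveVector) :
    pairing u (Laplacian.laplacian (modeField k)) = -eigenvalue k * pairing u (modeField k) := by
  unfold pairing
  rw [← integral_const_mul]
  simp_rw [modeField_laplacian, real_inner_smul_right]

/-- Pairing with a continuous field as a continuous linear functional on `𝓗`. -/
def pairingCLM {g : Plane → Plane} (hg : Continuous g) : VelocitySpace →L[ℝ] ℝ :=
  (innerSL ℝ ((memLp_of_continuous hg).toLp g)) ∘L stokesSpace.subtypeL

theorem pairingCLM_apply {g : Plane → Plane} (hg : Continuous g) (u : VelocitySpace) :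
    pairingCLM hg u = pairing u g := by
  rw [pairing_eq_inner _ hg, real_inner_comm]
  rfl

/-- The coefficients of a weak solution of the Stokes equations are given by Duhamel's formula; as
the modes are complete, weak solutions are unique. -/
theorem IsStokesSolution.coeff_eq {ν T : ℝ} (hν : 0 < ν) (hT : 0 ≤ T) {ψ : ℝ → VelocitySpace}
    (hψ : ContinuousOn ψ (Icc 0 T)) {u : VelocitySpace} {v : ℝ → VelocitySpace}
    (hv : IsStokesSolution ν T ψ u v) (k : WaveVector) {t : ℝ} (ht : t ∈ Icc 0 T) :
    coeff (v t) k = velCoeff ν T ψ u k t := by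
  refine eq_duhamel_of_integral_eq (x := fun t => coeff (v t) k) (mul_pos hν (eigenvalue_pos k)) _
    (continuous_forcing hT hψ k) ((continuous_coeff k).comp_continuousOn hv.continuousOn)
    (fun t ht => ?_) ht
  rw [coeff_eq_pairing, hv.weak _ (modeField_isTestField k) t ht, coeff_eq_pairing]
  congr 1
  refine intervalIntegral.integral_congr fun s hs => ?_
  rw [uIcc_of_le ht.1] at hs
  rw [pairing_laplacian_modeField, forcing_of_mem ψ k ⟨hs.1, hs.2.trans ht.2⟩, coeff_eq_pairing,
    coeff_eq_pairing]
  ring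

/-- Continuity in `𝓗` from continuity of the coefficients and a square summable bound. -/
theorem continuousOn_of_coeff {v : ℝ → VelocitySpace} {s : Set ℝ} {B : WaveVector → ℝ}
    (hB : Summable fun k => B k ^ 2) (hvB : ∀ t ∈ s, ∀ k, |coeff (v t) k| ≤ B k)
    (hc : ∀ k, ContinuousOn (fun t => coeff (v t) k) s) : ContinuousOn v s := by
  intro t ht
  refine tendsto_iff_norm_sub_tendsto_zero.2 ?_
  have h1 : Tendsto (fun τ => ∑' k, coeff (v τ - v t) k ^ 2) (𝓝[s] t)
      (𝓝 (∑' _ : WaveVector, (0 : ℝ))) := by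
    refine tendsto_tsum_of_dominated_convergence (hB.mul_left 4) (fun k => ?_) ?_
    · have := (((hc k).continuousWithinAt ht).tendsto.sub_const (coeff (v t) k)).pow 2
      simpa [coeff_sub] using this
    · filter_upwards [self_mem_nhdsWithin] with τ hτ k
      rw [coeff_sub, Real.norm_eq_abs, abs_pow]
      have h2 : |coeff (v τ) k - coeff (v t) k| ≤ 2 * B k :=
        (abs_sub _ _).trans (by linarith [hvB τ hτ k, hvB t ht k])
      calc _ ≤ (2 * B k) ^ 2 := pow_le_pow_left₀ (abs_nonneg _) h2 2
        _ = 4 * B k ^ 2 := by ring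
  have h3 : Tendsto (fun τ => √(‖v τ - v t‖ ^ 2)) (𝓝[s] t) (𝓝 (√0)) := by
    refine (Real.continuous_sqrt.tendsto _).comp ?_
    simpa [(hasSum_sq_coeff _).tsum_eq] using h1
  simpa [Real.sqrt_sq (norm_nonneg _)] using h3

theorem norm_sum_coeff_smul_mode_le (u : VelocitySpace) (F : Finset WaveVector) :
    ‖∑ k ∈ F, coeff u k • mode k‖ ≤ ‖u‖ := by
  refine (abs_le_of_sq_le_sq' (b := ‖u‖) ?_ (norm_nonneg _)).2
  have h : ‖∑ k ∈ F, coeff u k • mode k‖ ^ 2 = ∑ k ∈ F, coeff u k ^ 2 := by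
    rw [← real_inner_self_eq_norm_sq, orthonormal_mode.inner_sum]
    simp [sq]
  rw [h]
  exact sum_le_hasSum F (fun k _ => sq_nonneg _) (hasSum_sq_coeff u)

theorem exists_isStokesSolution {ν γ T : ℝ} (hν : 0 < ν) (hγ : 0 < γ) (hT : 0 ≤ T)
    {ψ : ℝ → VelocitySpace} (hψ : ContinuousInHs γ T ψ) (u : VelocitySpace) :
    ∃ v, IsStokesSolution ν T ψ u v := by
  obtain ⟨b, hb0, hb, hvb⟩ := exists_velCoeff_bound hν hγ hT hψ
  have hψc := hψ.continuousOn hγ.le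
  have hbound : ∀ k t, 0 ≤ t → |velCoeff ν T ψ u k t| ≤ |coeff u k| + b k := by
    intro k t ht
    refine (hvb u k t ht).trans (add_le_add_left (mul_le_of_le_one_left (abs_nonneg _) ?_) _)
    rw [Real.exp_le_one_iff, neg_mul]
    have := eigenvalue_pos k
    exact neg_nonpos.2 (by positivity)
  have hBs : Summable fun k => (|coeff u k| + b k) ^ 2 := by
    have hb2 : Summable fun k => b k ^ 2 := by
      refine (hb.mul_left (∑' k, b k)).of_nonneg_of_le (fun k => sq_nonneg _) fun k => ?_
      rw [sq]
      exact mul_le_mul_of_nonneg_right (hb.le_tsum k fun j _ => hb0 j) (hb0 k)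
    refine (((hasSum_sq_coeff u).summable.mul_left 2).add (hb2.mul_left 2)).of_nonneg_of_le
      (fun k => sq_nonneg _) fun k => ?_
    rw [← sq_abs (coeff u k)]
    nlinarith [sq_nonneg (|coeff u k| - b k)]
  have hex : ∀ t, 0 ≤ t → ∃ x : VelocitySpace, ∀ k, coeff x k = velCoeff ν T ψ u k t :=
    fun t ht => exists_coeff_eq (hBs.of_nonneg_of_le (fun k => sq_nonneg _) fun k => by
      rw [← sq_abs]
      exact pow_le_pow_left₀ (abs_nonneg _) (hbound k t ht) 2)
  choose! v hv using hex
  have hvc : ContinuousOn v (Icc 0 T) := by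
    refine continuousOn_of_coeff hBs (fun t ht k => ?_) fun k => ?_
    · rw [hv t ht.1]
      exact hbound k t ht.1
    · exact (continuous_velCoeff ν hT hψc u k).continuousOn.congr fun t ht => hv t ht.1 k
  refine ⟨v, hvc, ?_, fun w hw t ht => ?_⟩
  · exact ext_coeff fun k => by rw [hv 0 le_rfl, velCoeff, duhamel_zero]
  have hwc := hw.smooth.continuous
  have hlc := continuous_laplacian hw.smooth
  -- the modewise identities are summed over finite sets of modes, and then the limit is taken
  let S : Finset WaveVector → VelocitySpace → VelocitySpace := fun F x => ∑ k ∈ F, coeff x k • mode k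
  have hS : ∀ x, Tendsto (fun F => S F x) atTop (𝓝 x) := hasSum_coeff_smul_mode
  have hSp : ∀ {g : Plane → Plane} (hg : Continuous g) x,
      Tendsto (fun F => pairingCLM hg (S F x)) atTop (𝓝 (pairing x g)) := fun hg x => by
    rw [← pairingCLM_apply hg]
    exact ((pairingCLM hg).continuous.tendsto x).comp (hS x)
  have hsub : uIcc 0 t ⊆ Icc 0 T := by
    rw [uIcc_of_le ht.1]; exact Icc_subset_Icc_right ht.2
  have hSc : ∀ F, Continuous (S F) := fun F =>
    continuous_finsetSum _ fun k _ => (continuous_coeff k).smul continuous_const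
  have hfin : ∀ F, pairingCLM hwc (S F (v t)) = pairingCLM hwc (S F u) +
      ∫ s in (0 : ℝ)..t, (ν * pairingCLM hlc (S F (v s)) + pairingCLM hwc (S F (ψ s))) := by
    intro F
    have e1 : ∀ {g : Plane → Plane} (hg : Continuous g) (x : VelocitySpace),
        pairingCLM hg (S F x) = ∑ k ∈ F, coeff x k * pairing (mode k) g := by
      intro g hg x
      simp only [S, map_sum, map_smul, pairingCLM_apply, smul_eq_mul]
    have e2 : ∀ s ∈ uIcc 0 t, ν * pairingCLM hlc (S F (v s)) + pairingCLM hwc (S F (ψ s)) =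
        ∑ k ∈ F, pairing (mode k) w *
          (-(ν * eigenvalue k) * velCoeff ν T ψ u k s + forcing T ψ k s) := by
      intro s hs
      have hs' := hsub hs
      rw [e1, e1, Finset.mul_sum, ← Finset.sum_add_distrib]
      refine Finset.sum_congr rfl fun k _ => ?_
      rw [pairing_mode_laplacian k hw, hv s hs'.1, forcing_of_mem ψ k hs']
      ring
    rw [intervalIntegral.integral_congr e2, intervalIntegral.integral_finsetSum, e1, e1,
      ← Finset.sum_add_distrib]
    · refine Finset.sum_congr rfl fun k _ => ?_
      rw [intervalIntegral.integral_const_mul, hv t ht.1]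
      unfold velCoeff
      rw [← duhamel_sub_eq_integral _ _ (continuous_forcing hT hψc k)]
      ring
    · intro k _
      exact (continuous_const.mul ((continuous_const.mul (continuous_velCoeff ν hT hψc u k)).add
        (continuous_forcing hT hψc k))).intervalIntegrable _ _
  have hnorm : ∀ {g : Plane → Plane} (hg : Continuous g) F x,
      |pairingCLM hg (S F x)| ≤ ‖pairingCLM hg‖ * ‖x‖ := fun hg F x =>
    ((pairingCLM hg).le_opNorm _).trans
      (mul_le_mul_of_nonneg_left (norm_sum_coeff_smul_mode_le x F)
      (ContinuousLinearMap.opNorm_nonneg _))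
  have hvt := hvc.mono hsub
  have hψt := hψc.mono hsub
  have hlim : Tendsto (fun F => ∫ s in (0 : ℝ)..t,
      (ν * pairingCLM hlc (S F (v s)) + pairingCLM hwc (S F (ψ s)))) atTop
      (𝓝 (∫ s in (0 : ℝ)..t, (ν * pairing (v s) (Laplacian.laplacian w) + pairing (ψ s) w))) := by
    refine intervalIntegral.tendsto_integral_filter_of_dominated_convergence
      (fun s => ν * (‖pairingCLM hlc‖ * ‖v s‖) + ‖pairingCLM hwc‖ * ‖ψ s‖) ?_ ?_ ?_ ?_
    · refine Eventually.of_forall fun F => ?_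
      refine (ContinuousOn.aestronglyMeasurable ?_ measurableSet_uIoc)
      refine ContinuousOn.mono ?_ uIoc_subset_uIcc
      exact (continuousOn_const.mul (((pairingCLM hlc).continuous.comp (hSc F)).comp_continuousOn
        hvt)).add (((pairingCLM hwc).continuous.comp (hSc F)).comp_continuousOn hψt)
    · refine Eventually.of_forall fun F => ae_of_all _ fun s _ => ?_
      refine (norm_add_le _ _).trans (add_le_add ?_ (hnorm hwc F _))
      rw [norm_mul, Real.norm_eq_abs, abs_of_pos hν]
      exact mul_le_mul_of_nonneg_left (hnorm hlc F _) hν.le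
    · refine ContinuousOn.intervalIntegrable ?_
      exact (continuousOn_const.mul (continuousOn_const.mul hvt.norm)).add
        (continuousOn_const.mul hψt.norm)
    · exact ae_of_all _ fun s _ => ((hSp hlc _).const_mul ν).add (hSp hwc _)
  refine tendsto_nhds_unique (hSp hwc (v t)) ?_
  simp_rw [hfin]
  exact (hSp hwc u).add hlim

/-! ### The velocity field as a function of time and space -/

/-- A series of nonnegative integrable functions whose integrals are summable converges almost
everywhere to an integrable function. -/
theorem integrable_tsum_of_nonneg {X ι : Type*} [MeasurableSpace X] [Countable ι] {μ : Measure X}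
    {f : ι → X → ℝ} (hf : ∀ i, Integrable (f i) μ) (h0 : ∀ i x, 0 ≤ f i x)
    (hs : Summable fun i => ∫ x, f i x ∂μ) :
    (∀ᵐ x ∂μ, Summable fun i => f i x) ∧ Integrable (fun x => ∑' i, f i x) μ ∧
      ∫ x, ∑' i, f i x ∂μ = ∑' i, ∫ x, f i x ∂μ := by
  have hm : ∀ i, AEMeasurable (fun x => ENNReal.ofReal (f i x)) μ := fun i =>
    (hf i).aemeasurable.ennreal_ofReal
  have hfin : ∫⁻ x, ∑' i, ENNReal.ofReal (f i x) ∂μ ≠ ⊤ := by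
    rw [lintegral_tsum hm]
    simp_rw [← ofReal_integral_eq_lintegral_ofReal (hf _) (ae_of_all _ (h0 _))]
    rw [← ENNReal.ofReal_tsum_of_nonneg (fun i => integral_nonneg (h0 i)) hs]
    exact ENNReal.ofReal_ne_top
  have hmt : AEMeasurable (fun x => ∑' i, ENNReal.ofReal (f i x)) μ := AEMeasurable.tsum hm
  have e : ∀ x, (∑' i, ENNReal.ofReal (f i x)).toReal = ∑' i, f i x := fun x => by
    rw [ENNReal.tsum_toReal_eq fun i => ENNReal.ofReal_ne_top]
    simp [ENNReal.toReal_ofReal (h0 _ x)]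
  refine ⟨?_, ?_, ?_⟩
  · filter_upwards [ae_lt_top' hmt hfin] with x hx
    have := ENNReal.summable_toReal hx.ne
    simpa [ENNReal.toReal_ofReal (h0 _ x)] using this
  · simp_rw [← e]
    exact integrable_toReal_of_lintegral_ne_top hmt hfin
  · refine (hasSum_integral_of_summable_integral_norm hf ?_).tsum_eq.symm
    simpa [abs_of_nonneg (h0 _ _)] using hs

theorem abs_profile_sub_le (k : WaveVector) (θ η : ℝ) :
    |profile k θ - profile k η| ≤ |θ - η| := by
  unfold profile
  split_ifs
  · exact Real.abs_cos_sub_cos_le θ η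
  · exact Real.abs_sin_sub_sin_le θ η

theorem norm_mode_direction (k : WaveVector) :
    ‖(√2 / waveLength k) • (!₂[-(k.1 1 : ℝ), (k.1 0 : ℝ)] : Plane)‖ = √2 := by
  have hk := waveLength_pos k
  have h : ‖(!₂[-(k.1 1 : ℝ), (k.1 0 : ℝ)] : Plane)‖ = waveLength k := by
    rw [EuclideanSpace.norm_eq, waveLength]
    simp [Fin.sum_univ_two, add_comm]
  rw [norm_smul, h, Real.norm_eq_abs, abs_of_nonneg (div_nonneg (Real.sqrt_nonneg _) hk.le)]
  field_simp

theorem norm_modeField_le (k : WaveVector) (x : Plane) : ‖modeField k x‖ ≤ √2 := by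
  rw [modeField_eq_planeWave, planeWave, norm_smul, norm_mode_direction]
  exact mul_le_of_le_one_left (Real.sqrt_nonneg _) (abs_profile_le_one k _)

theorem abs_phase_le (k : WaveVector) (x : Plane) :
    |phase k x| ≤ 2 * Real.pi * waveLength k * ‖x‖ := by
  have h1 : |(k.1 0 : ℝ) * x 0 + k.1 1 * x 1| ≤ waveLength k * ‖x‖ := by
    refine abs_le_of_sq_le_sq ?_ (mul_nonneg (waveLength_pos k).le (norm_nonneg _))
    rw [mul_pow, sq_waveLength, EuclideanSpace.norm_sq_eq]
    simp only [Fin.sum_univ_two, Real.norm_eq_abs, sq_abs]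
    nlinarith [sq_nonneg ((k.1 0 : ℝ) * x 1 - k.1 1 * x 0)]
  rw [phase_apply, abs_mul, abs_of_pos (by positivity : (0 : ℝ) < 2 * Real.pi),
    mul_assoc (2 * Real.pi) (waveLength k)]
  exact mul_le_mul_of_nonneg_left h1 (by positivity)

theorem norm_modeField_sub_le (k : WaveVector) (x y : Plane) :
    ‖modeField k x - modeField k y‖ ≤ √2 * (2 * Real.pi * waveLength k) * ‖x - y‖ := by
  rw [modeField_eq_planeWave, planeWave, planeWave, ← sub_smul, norm_smul, norm_mode_direction,
    mul_comm, mul_assoc]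
  refine mul_le_mul_of_nonneg_left ?_ (Real.sqrt_nonneg _)
  refine (abs_profile_sub_le k _ _).trans ?_
  rw [← map_sub]
  exact abs_phase_le k _

/-- The velocity field `v(x, s) = ∑_k v_k(s) φ_k(x)`. -/
def velField (ν T : ℝ) (ψ : ℝ → VelocitySpace) (u : VelocitySpace) (s : ℝ) (x : Plane) : Plane :=
  ∑' k, velCoeff ν T ψ u k s • modeField k x

/-- The bound `∑_k √2 · 2π|k| |v_k(s)|` for the velocity field and for its Lipschitz constant at
time `s`. -/
def lipBound (ν T : ℝ) (ψ : ℝ → VelocitySpace) (u : VelocitySpace) (s : ℝ) : ℝ :=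
  ∑' k, √2 * (2 * Real.pi * waveLength k) * |velCoeff ν T ψ u k s|

/-- The norm `∑_k |u_k| / |k|` that controls the time integral of the Lipschitz constant of the
velocity field; it has the default value `0` if the series diverges. -/
def tracerNorm (u : VelocitySpace) : ℝ := ∑' k, |coeff u k| / waveLength k

/-- The initial velocities with finite `tracerNorm`. -/
def IsRegular (u : VelocitySpace) : Prop := Summable fun k => |coeff u k| / waveLength k

/-- The contribution of the forcing to the time integral of the Lipschitz constant. -/
def forcingNorm (T : ℝ) (ψ : ℝ → VelocitySpace) : ℝ :=
  ∑' k, (∫ s in (0 : ℝ)..T, |forcing T ψ k s|) / waveLength k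

theorem lipBound_nonneg (ν T : ℝ) (ψ : ℝ → VelocitySpace) (u : VelocitySpace) (s : ℝ) :
    0 ≤ lipBound ν T ψ u s :=
  tsum_nonneg fun k => by
    have := waveLength_pos k
    positivity

section Flow

variable {ν γ T : ℝ} {ψ : ℝ → VelocitySpace}

/-- At positive times the smoothing effect of the Stokes flow makes the coefficients absolutely
summable. -/
theorem summable_velCoeff (hν : 0 < ν) (hγ : 0 < γ) (hT : 0 ≤ T) (hψ : ContinuousInHs γ T ψ)
    {u : VelocitySpace} (hu : IsRegular u) {s : ℝ} (hs : 0 < s) :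
    Summable fun k => |velCoeff ν T ψ u k s| := by
  obtain ⟨b, hb0, hb, hvb⟩ := exists_velCoeff_bound hν hγ hT hψ
  refine ((hu.mul_left (1 / (ν * s))).add hb).of_nonneg_of_le (fun k => abs_nonneg _) fun k => ?_
  refine (hvb u k s hs.le).trans (add_le_add_left ?_ _)
  have h1 := eigenvalue_pos k
  have h2 := waveLength_pos k
  have h3 : waveLength k ≤ eigenvalue k := by
    refine le_trans ?_ (sq_waveLength_le_eigenvalue k)
    nlinarith [one_le_waveLength k]
  have h4 : Real.exp (-(ν * eigenvalue k) * s) ≤ 1 / (ν * s * waveLength k) := by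
    rw [neg_mul, Real.exp_neg, one_div]
    refine inv_anti₀ (by positivity) ?_
    refine le_trans ?_ (Real.add_one_le_exp _)
    nlinarith [mul_le_mul_of_nonneg_left h3 (mul_pos hν hs).le]
  refine (mul_le_mul_of_nonneg_right h4 (abs_nonneg _)).trans_eq ?_
  field_simp

theorem continuous_velField (hν : 0 < ν) (hγ : 0 < γ) (hT : 0 ≤ T) (hψ : ContinuousInHs γ T ψ)
    {u : VelocitySpace} (hu : IsRegular u) {s : ℝ} (hs : 0 < s) :
    Continuous (velField ν T ψ u s) := by
  refine continuous_tsum (fun k => by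
      have := continuous_modeField k
      fun_prop)
    ((summable_velCoeff hν hγ hT hψ hu hs).mul_right √2) fun k x => ?_
  rw [norm_smul]
  exact mul_le_mul_of_nonneg_left (norm_modeField_le k x) (abs_nonneg _)

theorem velField_periodic (u : VelocitySpace) (s : ℝ) : IsPeriodic (velField ν T ψ u s) := by
  intro i x
  unfold velField
  simp_rw [(modeField_isTestField _).periodic i x]

/-- An element of `𝓗` with absolutely summable coefficients is represented by the sum of its
pointwise Fourier series. -/
theorem tsum_smul_modeField_ae_eq (w : VelocitySpace) (hw : Summable fun k => |coeff w k|) :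
    (fun x => ∑' k, coeff w k • modeField k x) =ᵐ[squareMeasure] ((w : L2Field) : Plane → Plane) := by
  have hbd : ∀ k x, ‖coeff w k • modeField k x‖ ≤ |coeff w k| * √2 := fun k x => by
    rw [norm_smul]
    exact mul_le_mul_of_nonneg_left (norm_modeField_le k x) (abs_nonneg _)
  have hcont : Continuous fun x => ∑' k, coeff w k • modeField k x :=
    continuous_tsum (fun k => by
      have := continuous_modeField k
      fun_prop) (hw.mul_right √2) hbd
  set g : L2Field := (memLp_of_continuous hcont).toLp _
  have hg : g =ᵐ[squareMeasure] fun x => ∑' k, coeff w k • modeField k x :=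
    (memLp_of_continuous hcont).coeFn_toLp
  have hunif := tendstoUniformly_tsum (hw.mul_right √2) hbd
  let S : Finset WaveVector → L2Field := fun F => ∑ k ∈ F, coeff w k • (mode k : L2Field)
  have hS : Tendsto S atTop (𝓝 (w : L2Field)) := by
    have h := stokesSpace.subtypeL.hasSum (hasSum_coeff_smul_mode w)
    exact h
  have hSg : Tendsto S atTop (𝓝 g) := by
    rw [tendsto_iff_norm_sub_tendsto_zero, Metric.tendsto_nhds]
    intro ε hε
    filter_upwards [Metric.tendstoUniformly_iff.1 hunif (ε / 2) (half_pos hε)] with F hF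
    rw [dist_zero_right, norm_norm]
    have hSF : S F =ᵐ[squareMeasure] fun x => ∑ k ∈ F, coeff w k • modeField k x := by
      have h1 : ∀ᵐ x ∂squareMeasure, ∀ k : WaveVector, (mode k : L2Field) x = modeField k x :=
        ae_all_iff.2 fun k => coe_mode k
      have h2 : ∀ᵐ x ∂squareMeasure, ∀ k : WaveVector,
          (coeff w k • (mode k : L2Field) : L2Field) x = coeff w k • (mode k : L2Field) x :=
        ae_all_iff.2 fun k => Lp.coeFn_smul _ _
      filter_upwards [h1, h2, Lp.coeFn_finsetSum F fun k => coeff w k • (mode k : L2Field)]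
        with x hx1 hx2 hx3
      rw [hx3]
      simp only [Finset.sum_apply, hx2, hx1]
    have hb := Lp.norm_le_of_ae_bound (f := S F - g) (C := ε / 2) (by positivity) (by
      filter_upwards [Lp.coeFn_sub (S F) g, hSF, hg] with x hx hxS hxg
      rw [hx, Pi.sub_apply, hxS, hxg, ← dist_eq_norm, dist_comm]
      exact (hF x).le)
    refine hb.trans_lt ?_
    simp [measureUnivNNReal, volume_unitSquare]
    linarith
  have : (w : L2Field) = g := tendsto_nhds_unique hS hSg
  rw [this]
  exact hg.symm

theorem isContinuousRep_velField (hν : 0 < ν) (hγ : 0 < γ) (hT : 0 ≤ T) (hψ : ContinuousInHs γ T ψ)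
    {u : VelocitySpace} (hu : IsRegular u) {v : ℝ → VelocitySpace}
    (hv : IsStokesSolution ν T ψ u v) : IsContinuousRep T v (velField ν T ψ u) := by
  intro s hs
  refine ⟨continuous_velField hν hγ hT hψ hu hs.1, velField_periodic u s, ?_⟩
  have hc : ∀ k, coeff (v s) k = velCoeff ν T ψ u k s := fun k =>
    hv.coeff_eq hν hT (hψ.continuousOn hγ.le) k ⟨hs.1.le, hs.2⟩
  have h := tsum_smul_modeField_ae_eq (v s)
    (by simpa only [hc] using summable_velCoeff hν hγ hT hψ hu hs.1)
  simp_rw [hc] at h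
  exact h

theorem unitSquare_subset_closure_interior : unitSquare ⊆ closure (interior unitSquare) := by
  have hconv : Convex ℝ unitSquare := by
    intro x hx y hy p q hp hq hpq i
    exact convex_Icc (0 : ℝ) 1 (hx i) (hy i) hp hq hpq
  have hne : (interior unitSquare).Nonempty := by
    refine ⟨!₂[1 / 2, 1 / 2], mem_interior.2 ⟨{x | ∀ i, x i ∈ Ioo (0 : ℝ) 1},
      fun x hx i => Ioo_subset_Icc_self (hx i), ?_, ?_⟩⟩
    · simp only [ofPred_forall]
      exact isOpen_iInter_of_finite fun i => isOpen_Ioo.preimage (by fun_prop)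
    · intro i
      fin_cases i <;> norm_num
  rw [hconv.closure_interior_eq_closure_of_nonempty_interior hne]
  exact subset_closure

/-- The continuous periodic representative is unique. -/
theorem eq_of_ae_eq_unitSquare {g h : Plane → Plane} (hg : Continuous g) (hh : Continuous h)
    (hgp : IsPeriodic g) (hhp : IsPeriodic h) (he : g =ᵐ[squareMeasure] h) : g = h := by
  have hon : EqOn g h unitSquare := Measure.eqOn_of_ae_eq he hg.continuousOn hh.continuousOn
    unitSquare_subset_closure_interior
  ext1 x
  let n : Fin 2 → ℤ := fun i => ⌊x i⌋
  have hper : ∀ {p : Plane → Plane}, IsPeriodic p → p x =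
      p (x - n 0 • EuclideanSpace.single 0 1 - n 1 • EuclideanSpace.single 1 1) := by
    intro p hp
    have h0 : Function.Periodic p (EuclideanSpace.single 0 1) := hp 0
    have h1 : Function.Periodic p (EuclideanSpace.single 1 1) := hp 1
    rw [(h1.zsmul (n 1)).sub_eq, (h0.zsmul (n 0)).sub_eq]
  rw [hper hgp, hper hhp]
  refine hon fun i => ?_
  fin_cases i
  · simpa [n] using (Int.fract_lt_one (x 0)).le
  · simpa [n] using (Int.fract_lt_one (x 1)).le

theorem IsContinuousRep.eq_velField (hν : 0 < ν) (hγ : 0 < γ) (hT : 0 ≤ T)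
    (hψ : ContinuousInHs γ T ψ) {u : VelocitySpace} (hu : IsRegular u) {v : ℝ → VelocitySpace}
    (hv : IsStokesSolution ν T ψ u v) {V : ℝ → Plane → Plane} (hV : IsContinuousRep T v V) {s : ℝ}
    (hs : s ∈ Ioc 0 T) : V s = velField ν T ψ u s := by
  obtain ⟨h1, h2, h3⟩ := hV s hs
  obtain ⟨h4, h5, h6⟩ := isContinuousRep_velField hν hγ hT hψ hu hv s hs
  exact eq_of_ae_eq_unitSquare h1 h4 h2 h5 (h3.trans h6.symm)

end Flow

/-! ### Tracers -/

section Tracer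

variable {ν γ T : ℝ} {ψ : ℝ → VelocitySpace}

theorem abs_velCoeff_le_lipBound_term (u : VelocitySpace) (k : WaveVector) (s : ℝ) :
    √2 * |velCoeff ν T ψ u k s| ≤
      √2 * (2 * Real.pi * waveLength k) * |velCoeff ν T ψ u k s| := by
  refine mul_le_mul_of_nonneg_right ?_ (abs_nonneg _)
  refine le_mul_of_one_le_right (Real.sqrt_nonneg _) ?_
  nlinarith [Real.pi_gt_three, one_le_waveLength k]

/-- The Lipschitz constants of the velocity field are integrable in time: for each mode, the time
integral of `|v_k|` gains the factor `1 / λ_k`. -/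
theorem lipBound_integrable (hν : 0 < ν) (hγ : 0 < γ) (hT : 0 ≤ T) (hψ : ContinuousInHs γ T ψ)
    {u : VelocitySpace} (hu : IsRegular u) :
    (∀ᵐ s ∂volume.restrict (Ioc 0 T),
      Summable fun k => √2 * (2 * Real.pi * waveLength k) * |velCoeff ν T ψ u k s|) ∧
    IntervalIntegrable (lipBound ν T ψ u) volume 0 T ∧
    ∫ s in (0 : ℝ)..T, lipBound ν T ψ u s ≤ (tracerNorm u + forcingNorm T ψ) / ν := by
  have hψc := hψ.continuousOn hγ.le
  have hc := fun k => (continuous_velCoeff ν hT hψc u k).abs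
  set f : WaveVector → ℝ → ℝ := fun k s =>
    √2 * (2 * Real.pi * waveLength k) * |velCoeff ν T ψ u k s| with hf
  have hfc : ∀ k, Continuous (f k) := fun k => continuous_const.mul (hc k)
  have hfi : ∀ k, Integrable (f k) (volume.restrict (Ioc 0 T)) := fun k =>
    ((hfc k).intervalIntegrable 0 T).1
  have hf0 : ∀ k s, 0 ≤ f k s := fun k s => by
    have := waveLength_pos k
    positivity
  have hF := summable_integral_forcing hγ hT hψ
  have hbs : Summable fun k => (|coeff u k| / waveLength k +
      (∫ s in (0 : ℝ)..T, |forcing T ψ k s|) / waveLength k) / ν := (hu.add hF).div_const ν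
  have hb : ∀ k, ∫ s in Ioc 0 T, f k s ≤ (|coeff u k| / waveLength k +
      (∫ s in (0 : ℝ)..T, |forcing T ψ k s|) / waveLength k) / ν := by
    intro k
    have hk := waveLength_pos k
    have h1 := integral_abs_duhamel_le (mul_pos hν (eigenvalue_pos k)) (coeff u k)
      (continuous_forcing hT hψc k) hT
    have h2 : 0 ≤ ∫ s in (0 : ℝ)..T, |forcing T ψ k s| :=
      intervalIntegral.integral_nonneg hT fun s _ => abs_nonneg _
    rw [← intervalIntegral.integral_of_le hT, hf, intervalIntegral.integral_const_mul]
    calc _ ≤ √2 * (2 * Real.pi * waveLength k) * ((|coeff u k| +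
          ∫ s in (0 : ℝ)..T, |forcing T ψ k s|) / (ν * eigenvalue k)) := by
          refine mul_le_mul_of_nonneg_left h1 (by positivity)
      _ = (√2 / (2 * Real.pi)) * ((|coeff u k| / waveLength k +
          (∫ s in (0 : ℝ)..T, |forcing T ψ k s|) / waveLength k) / ν) := by
          unfold eigenvalue
          field_simp
          ring
      _ ≤ _ := by
          refine mul_le_of_le_one_left (by positivity) ?_
          rw [div_le_one (by positivity)]
          have h3 : √2 ≤ 2 := Real.sqrt_le_iff.2 (by norm_num)
          nlinarith [Real.pi_gt_three]
  have hs : Summable fun k => ∫ s in Ioc 0 T, f k s :=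
    hbs.of_nonneg_of_le (fun k => integral_nonneg (hf0 k)) hb
  obtain ⟨h1, h2, h3⟩ := integrable_tsum_of_nonneg hfi hf0 hs
  refine ⟨h1, (intervalIntegrable_iff_integrableOn_Ioc_of_le hT).2 h2, ?_⟩
  rw [intervalIntegral.integral_of_le hT]
  refine (h3.trans_le (hs.tsum_le_tsum hb hbs)).trans_eq ?_
  rw [tsum_div_const, hu.tsum_add hF]
  rfl

theorem norm_velField_le {u : VelocitySpace} {s : ℝ}
    (hs : Summable fun k => √2 * (2 * Real.pi * waveLength k) * |velCoeff ν T ψ u k s|) (x : Plane) :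
    ‖velField ν T ψ u s x‖ ≤ lipBound ν T ψ u s := by
  refine tsum_of_norm_bounded hs.hasSum fun k => ?_
  refine le_trans ?_ (abs_velCoeff_le_lipBound_term u k s)
  rw [norm_smul, Real.norm_eq_abs, mul_comm]
  exact mul_le_mul_of_nonneg_right (norm_modeField_le k x) (abs_nonneg _)

theorem summable_smul_modeField {u : VelocitySpace} {s : ℝ}
    (hs : Summable fun k => √2 * (2 * Real.pi * waveLength k) * |velCoeff ν T ψ u k s|) (x : Plane) :
    Summable fun k => velCoeff ν T ψ u k s • modeField k x := by
  refine Summable.of_norm_bounded hs fun k => ?_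
  refine le_trans ?_ (abs_velCoeff_le_lipBound_term u k s)
  rw [norm_smul, Real.norm_eq_abs, mul_comm]
  exact mul_le_mul_of_nonneg_right (norm_modeField_le k x) (abs_nonneg _)

theorem norm_velField_sub_le {u : VelocitySpace} {s : ℝ}
    (hs : Summable fun k => √2 * (2 * Real.pi * waveLength k) * |velCoeff ν T ψ u k s|)
    (x y : Plane) :
    ‖velField ν T ψ u s x - velField ν T ψ u s y‖ ≤ lipBound ν T ψ u s * ‖x - y‖ := by
  unfold velField lipBound
  rw [← (summable_smul_modeField hs x).tsum_sub (summable_smul_modeField hs y), ← tsum_mul_right]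
  refine tsum_of_norm_bounded (hs.mul_right _).hasSum fun k => ?_
  rw [← smul_sub, norm_smul, Real.norm_eq_abs]
  refine (mul_le_mul_of_nonneg_left (norm_modeField_sub_le k x y) (abs_nonneg _)).trans_eq ?_
  ring

/-- The difference of the velocity fields of two initial data. -/
theorem norm_velField_sub_velField_le {u u' : VelocitySpace} {s : ℝ}
    (hs : Summable fun k => √2 * (2 * Real.pi * waveLength k) * |velCoeff ν T ψ u k s|)
    (hs' : Summable fun k => √2 * (2 * Real.pi * waveLength k) * |velCoeff ν T ψ u' k s|)
    (x : Plane) :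
    ‖velField ν T ψ u s x - velField ν T ψ u' s x‖ ≤
      ∑' k, √2 * |velCoeff ν T ψ u k s - velCoeff ν T ψ u' k s| := by
  have hsum : Summable fun k => √2 * |velCoeff ν T ψ u k s - velCoeff ν T ψ u' k s| := by
    refine (hs.add hs').of_nonneg_of_le (fun k => by positivity) fun k => ?_
    refine le_trans ?_ (add_le_add (abs_velCoeff_le_lipBound_term u k s)
      (abs_velCoeff_le_lipBound_term u' k s))
    rw [← mul_add]
    exact mul_le_mul_of_nonneg_left (abs_sub _ _) (Real.sqrt_nonneg _)
  unfold velField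
  rw [← (summable_smul_modeField hs x).tsum_sub (summable_smul_modeField hs' x)]
  refine tsum_of_norm_bounded hsum.hasSum fun k => ?_
  rw [← sub_smul, norm_smul, Real.norm_eq_abs, mul_comm]
  exact mul_le_mul_of_nonneg_right (norm_modeField_le k x) (abs_nonneg _)

theorem intervalIntegrable_velField_comp (hν : 0 < ν) (hγ : 0 < γ) (hT : 0 ≤ T)
    (hψ : ContinuousInHs γ T ψ) {u : VelocitySpace} (hu : IsRegular u) {z : ℝ → Plane}
    (hz : ContinuousOn z (Icc 0 T)) :
    IntervalIntegrable (fun s => velField ν T ψ u s (z s)) volume 0 T := by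
  obtain ⟨h1, h2, -⟩ := lipBound_integrable hν hγ hT hψ hu
  have hψc := hψ.continuousOn hγ.le
  rw [intervalIntegrable_iff_integrableOn_Ioc_of_le hT] at h2 ⊢
  refine Integrable.mono' h2 ?_ ?_
  · refine aestronglyMeasurable_of_tendsto_ae atTop
      (f := fun F s => ∑ k ∈ F, velCoeff ν T ψ u k s • modeField k (z s)) (fun F => ?_) ?_
    · refine ContinuousOn.aestronglyMeasurable ?_ measurableSet_Ioc
      exact continuousOn_finsetSum _ fun k _ => (continuous_velCoeff ν hT hψc u k).continuousOn.smul
        ((continuous_modeField k).comp_continuousOn (hz.mono Ioc_subset_Icc_self))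
    · filter_upwards [h1] with s hs
      exact (summable_smul_modeField hs (z s)).hasSum
  · filter_upwards [h1] with s hs
    exact norm_velField_le hs _

/-- In terms of the explicit velocity field, a tracer is a solution of the integral equation. -/
theorem isTracer_iff (hν : 0 < ν) (hγ : 0 < γ) (hT : 0 ≤ T) (hψ : ContinuousInHs γ T ψ)
    {u : VelocitySpace} (hu : IsRegular u) {a : Plane} {z : ℝ → Plane} :
    IsTracer ν T ψ u a z ↔ ContinuousOn z (Icc 0 T) ∧
      ∀ t ∈ Icc 0 T, z t = a + ∫ s in (0 : ℝ)..t, velField ν T ψ u s (z s) := by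
  constructor
  · rintro ⟨v, V, hv, hV, hz, h⟩
    refine ⟨hz, fun t ht => ?_⟩
    rw [(h t ht).2]
    congr 1
    refine intervalIntegral.integral_congr_ae (ae_of_all _ fun s hs => ?_)
    rw [uIoc_of_le ht.1] at hs
    rw [hV.eq_velField hν hγ hT hψ hu hv ⟨hs.1, hs.2.trans ht.2⟩]
  · rintro ⟨hz, h⟩
    obtain ⟨v, hv⟩ := exists_isStokesSolution hν hγ hT hψ u
    refine ⟨v, velField ν T ψ u, hv, isContinuousRep_velField hν hγ hT hψ hu hv, hz, fun t ht =>
      ⟨(intervalIntegrable_velField_comp hν hγ hT hψ hu hz).mono_set ?_, h t ht⟩⟩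
    rw [uIcc_of_le ht.1, uIcc_of_le hT]
    exact Icc_subset_Icc_right ht.2

/-- Stability of tracers with respect to the initial velocity, by Gronwall's inequality. -/
theorem IsTracer.norm_sub_le (hν : 0 < ν) (hγ : 0 < γ) (hT : 0 ≤ T) (hψ : ContinuousInHs γ T ψ)
    {u u' : VelocitySpace} (hu : IsRegular u) (hu' : IsRegular u') {a : Plane} {z z' : ℝ → Plane}
    (hz : IsTracer ν T ψ u a z) (hz' : IsTracer ν T ψ u' a z') {t : ℝ} (ht : t ∈ Icc 0 T) :
    ‖z t - z' t‖ ≤ (∑' k, |coeff u k - coeff u' k| / waveLength k ^ 2) / ν *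
      Real.exp ((tracerNorm u + forcingNorm T ψ) / ν) := by
  have hψc := hψ.continuousOn hγ.le
  obtain ⟨hzc, hze⟩ := (isTracer_iff hν hγ hT hψ hu).1 hz
  obtain ⟨hzc', hze'⟩ := (isTracer_iff hν hγ hT hψ hu').1 hz'
  obtain ⟨hL1, hL2, hL3⟩ := lipBound_integrable hν hγ hT hψ hu
  obtain ⟨hL1', -, -⟩ := lipBound_integrable hν hγ hT hψ hu'
  set f : WaveVector → ℝ → ℝ := fun k s =>
    √2 * |velCoeff ν T ψ u k s - velCoeff ν T ψ u' k s| with hf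
  have hfc : ∀ k, Continuous (f k) := fun k => continuous_const.mul
    ((continuous_velCoeff ν hT hψc u k).sub (continuous_velCoeff ν hT hψc u' k)).abs
  have hfi : ∀ k, Integrable (f k) (volume.restrict (Ioc 0 T)) := fun k =>
    ((hfc k).intervalIntegrable 0 T).1
  have hf0 : ∀ k s, 0 ≤ f k s := fun k s => by positivity
  have hreg : Summable fun k => |coeff u k - coeff u' k| / waveLength k ^ 2 := by
    refine (Summable.add hu hu').of_nonneg_of_le (fun k => by positivity) fun k => ?_
    have hk := waveLength_pos k
    rw [← add_div]
    refine div_le_div₀ (by positivity) (abs_sub _ _) hk ?_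
    nlinarith [one_le_waveLength k]
  have hb : ∀ k, ∫ s in Ioc 0 T, f k s ≤ |coeff u k - coeff u' k| / waveLength k ^ 2 / ν := by
    intro k
    have hk := waveLength_pos k
    have h1 := integral_abs_duhamel_le (mul_pos hν (eigenvalue_pos k)) (coeff u k - coeff u' k)
      (f := 0) continuous_zero hT
    rw [← intervalIntegral.integral_of_le hT, hf, intervalIntegral.integral_const_mul]
    simp_rw [velCoeff, duhamel_sub_duhamel]
    simp only [Pi.zero_apply, abs_zero, intervalIntegral.integral_zero, add_zero] at h1
    calc _ ≤ √2 * (|coeff u k - coeff u' k| / (ν * eigenvalue k)) :=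
          mul_le_mul_of_nonneg_left h1 (Real.sqrt_nonneg _)
      _ = (√2 / (4 * Real.pi ^ 2)) * (|coeff u k - coeff u' k| / waveLength k ^ 2 / ν) := by
          unfold eigenvalue
          field_simp
      _ ≤ _ := by
          refine mul_le_of_le_one_left (by positivity) ?_
          rw [div_le_one (by positivity)]
          have h3 : √2 ≤ 2 := Real.sqrt_le_iff.2 (by norm_num)
          nlinarith [Real.pi_gt_three]
  have hs : Summable fun k => ∫ s in Ioc 0 T, f k s :=
    (hreg.div_const ν).of_nonneg_of_le (fun k => integral_nonneg (hf0 k)) hb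
  obtain ⟨-, hd2, hd3⟩ := integrable_tsum_of_nonneg hfi hf0 hs
  set A := (∑' k, |coeff u k - coeff u' k| / waveLength k ^ 2) / ν with hA
  have hdA : ∫ s in Ioc 0 T, ∑' k, f k s ≤ A := by
    rw [hd3, hA, ← tsum_div_const]
    exact hs.tsum_le_tsum hb (hreg.div_const ν)
  have hA0 : 0 ≤ A := div_nonneg (tsum_nonneg fun k => by positivity) hν.le
  have hI : ∀ {t : ℝ}, t ∈ Icc 0 T → uIcc 0 t ⊆ uIcc 0 T := fun ht => by
    rw [uIcc_of_le ht.1, uIcc_of_le hT]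
    exact Icc_subset_Icc_right ht.2
  have hdi : IntervalIntegrable (fun s => ∑' k, f k s) volume 0 T :=
    (intervalIntegrable_iff_integrableOn_Ioc_of_le hT).2 hd2
  have hg := le_mul_exp_of_le_add_integral hL2 (fun s _ => lipBound_nonneg ν T ψ u s)
    (f := fun s => ‖z s - z' s‖) (hzc.sub hzc').norm hA0 (fun t ht => ?_) ht
  · refine hg.trans (mul_le_mul_of_nonneg_left (Real.exp_le_exp.2 (le_trans ?_ hL3)) hA0)
    exact intervalIntegral.integral_mono_interval le_rfl ht.1 ht.2
      (ae_of_all _ fun s => lipBound_nonneg ν T ψ u s) hL2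
  · have hi := (intervalIntegrable_velField_comp hν hγ hT hψ hu hzc).mono_set (hI ht)
    have hi' := (intervalIntegrable_velField_comp hν hγ hT hψ hu' hzc').mono_set (hI ht)
    have hLi : IntervalIntegrable (fun s => lipBound ν T ψ u s * ‖z s - z' s‖) volume 0 t :=
      (hL2.mono_set (hI ht)).mul_continuousOn (by
        rw [uIcc_of_le ht.1]
        exact ((hzc.sub hzc').norm).mono (Icc_subset_Icc_right ht.2))
    have hdt := hdi.mono_set (hI ht)
    have hle : ∫ s in (0 : ℝ)..t, ∑' k, f k s ≤ A := by
      refine le_trans ?_ hdA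
      rw [← intervalIntegral.integral_of_le hT]
      exact intervalIntegral.integral_mono_interval le_rfl ht.1 ht.2
        (ae_of_all _ fun s => tsum_nonneg fun k => hf0 k s) hdi
    rw [hze t ht, hze' t ht, add_sub_add_left_eq_sub, ← intervalIntegral.integral_sub hi hi']
    refine (intervalIntegral.norm_integral_le_of_norm_le ht.1 ?_ (hdt.add hLi)).trans ?_
    · have hsub := ae_restrict_of_ae_restrict_of_subset (Ioc_subset_Ioc_right ht.2) hL1
      have hsub' := ae_restrict_of_ae_restrict_of_subset (Ioc_subset_Ioc_right ht.2) hL1'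
      filter_upwards [(ae_restrict_iff' measurableSet_Ioc).1 hsub,
        (ae_restrict_iff' measurableSet_Ioc).1 hsub'] with s h1 h2 hst
      have h3 := norm_velField_sub_le (h1 hst) (z s) (z' s)
      have h4 := norm_velField_sub_velField_le (h1 hst) (h2 hst) (z' s)
      calc _ = ‖(velField ν T ψ u s (z' s) - velField ν T ψ u' s (z' s)) +
            (velField ν T ψ u s (z s) - velField ν T ψ u s (z' s))‖ := by congr 1; abel
        _ ≤ _ := (norm_add_le _ _).trans (add_le_add h4 h3)
    · rw [intervalIntegral.integral_add hdt hLi]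
      exact add_le_add_left hle _

theorem hasUniqueTracer (hν : 0 < ν) (hγ : 0 < γ) (hT : 0 ≤ T) (hψ : ContinuousInHs γ T ψ)
    {u : VelocitySpace} (hu : IsRegular u) (a : Plane) : HasUniqueTracer ν T ψ u a := by
  obtain ⟨hL1, hL2, -⟩ := lipBound_integrable hν hγ hT hψ hu
  obtain ⟨z, hz, he⟩ := exists_integral_curve hT hL2 (fun s _ => lipBound_nonneg ν T ψ u s)
    (by
      filter_upwards [hL1] with s hs x y
      exact norm_velField_sub_le hs x y)
    (fun z hz => intervalIntegrable_velField_comp hν hγ hT hψ hu hz.continuousOn) a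
  have hzt : IsTracer ν T ψ u a z := (isTracer_iff hν hγ hT hψ hu).2 ⟨hz.continuousOn, he⟩
  refine ⟨z, hzt, fun z' hz' t ht => ?_⟩
  have h := hz'.norm_sub_le hν hγ hT hψ hu hu hzt ht
  simp only [sub_self, abs_zero, zero_div, tsum_zero, zero_mul] at h
  exact sub_eq_zero.1 (norm_le_zero_iff.1 h)

theorem isTracer_tracer (hν : 0 < ν) (hγ : 0 < γ) (hT : 0 ≤ T) (hψ : ContinuousInHs γ T ψ)
    {u : VelocitySpace} (hu : IsRegular u) (a : Plane) :
    IsTracer ν T ψ u a (tracer ν T ψ u a) := by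
  have h : ∃ z, IsTracer ν T ψ u a z := (hasUniqueTracer hν hγ hT hψ hu a).imp fun _ h => h.1
  rw [tracer, dif_pos h]
  exact h.choose_spec

theorem norm_forwardMap_sub_le (hν : 0 < ν) (hγ : 0 < γ) (hT : 0 ≤ T) (hψ : ContinuousInHs γ T ψ)
    {J K : ℕ} (a : Fin J → Plane) {t : Fin K → ℝ} (ht : ∀ k, t k ∈ Ioc 0 T)
    {u u' : VelocitySpace} (hu : IsRegular u) (hu' : IsRegular u') :
    ‖forwardMap ν T ψ a t u - forwardMap ν T ψ a t u'‖ ≤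
      (∑' k, |coeff u k - coeff u' k| / waveLength k ^ 2) / ν *
        Real.exp ((tracerNorm u + forcingNorm T ψ) / ν) := by
  refine (pi_norm_le_iff_of_nonneg ?_).2 fun i => ?_
  · exact mul_nonneg (div_nonneg (tsum_nonneg fun k => by positivity) hν.le) (Real.exp_pos _).le
  · refine le_trans ?_ ((isTracer_tracer hν hγ hT hψ hu (a i.1)).norm_sub_le hν hγ hT hψ hu hu'
      (isTracer_tracer hν hγ hT hψ hu' (a i.1)) (Ioc_subset_Icc_self (ht i.2.1)))
    exact PiLp.norm_apply_le (tracer ν T ψ u (a i.1) (t i.2.1) -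
      tracer ν T ψ u' (a i.1) (t i.2.1)) i.2.2

end Tracer

/-! ### The prior -/

theorem stokesPow_mode (s : ℝ) (k : WaveVector) :
    stokesPow s (mode k) = eigenvalue k ^ s • mode k := by
  unfold stokesPow
  rw [tsum_eq_single k fun j hj => by rw [coeff_mode, if_neg hj.symm, mul_zero, zero_smul]]
  rw [coeff_mode, if_pos rfl, mul_one]

section Prior

variable {β α : ℝ} {μ₀ : Measure VelocitySpace}

/-- Under the prior, the coefficient `u_k` has law `N(0, β λ_k^{-α})`. -/
theorem IsPrior.map_coeff (h : IsPrior β α μ₀) (k : WaveVector) :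
    μ₀.map (fun u => coeff u k) = gaussianReal 0 (β * eigenvalue k ^ (-α)).toNNReal := by
  have := h.gaussian
  have h2 : MemLp id 2 μ₀ := IsGaussian.memLp_two_id
  have hcov : covOp μ₀ = covarianceOperator μ₀ := by
    rw [covOp, h.mean_eq]
    simp only [sub_zero]
    rw [Measure.map_id']
  have hL : (fun u => coeff u k) = innerSL ℝ (mode k) := by
    ext u
    rw [coeff, real_inner_comm]
    rfl
  have hmean : ∫ u, innerSL ℝ (mode k) u ∂μ₀ = 0 := by
    have hm : ∫ u, u ∂μ₀ = 0 := h.mean_eq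
    rw [IsGaussian.integral_dual, hm, map_zero]
  have hvar : Var[innerSL ℝ (mode k); μ₀] = β * eigenvalue k ^ (-α) := by
    rw [variance_eq_integral (by fun_prop), hmean]
    have h3 := covarianceOperator_inner h2 (mode k) (mode k)
    rw [← hcov, h.cov_eq, stokesPow_mode] at h3
    have h4 : ⟪β • eigenvalue k ^ (-α) • mode k, mode k⟫ = β * eigenvalue k ^ (-α) := by
      have e : ∀ (c : ℝ) (x : VelocitySpace), ⟪c • x, mode k⟫ = c * ⟪x, mode k⟫ := fun c x =>
        real_inner_smul_left x (mode k) c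
      refine (e β _).trans (congrArg (β * ·) ((e _ _).trans ?_))
      rw [real_inner_self_eq_norm_sq, orthonormal_mode.1 k, one_pow, mul_one]
    rw [← h4, h3]
    simp [sq]
  rw [hL, IsGaussian.map_eq_gaussianReal, hmean, hvar]

theorem IsPrior.integral_exp_abs_coeff (h : IsPrior β α μ₀) (hβ : 0 ≤ β) (k : WaveVector) (c : ℝ) :
    Integrable (fun u => Real.exp (c * |coeff u k|)) μ₀ ∧
    ∫ u, Real.exp (c * |coeff u k|) ∂μ₀ ≤
      2 * Real.exp (β * eigenvalue k ^ (-α) * c ^ 2 / 2) := by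
  have hc : Continuous fun u : VelocitySpace => coeff u k := continuous_coeff k
  have hv : ((β * eigenvalue k ^ (-α)).toNNReal : ℝ) = β * eigenvalue k ^ (-α) :=
    Real.coe_toNNReal _ (mul_nonneg hβ (Real.rpow_nonneg (eigenvalue_pos k).le _))
  have hi : ∀ d : ℝ, Integrable (fun u => Real.exp (d * coeff u k)) μ₀ := fun d => by
    have := integrable_exp_mul_gaussianReal (μ := 0) (v := (β * eigenvalue k ^ (-α)).toNNReal) d
    rw [← h.map_coeff k, integrable_map_measure (by fun_prop) hc.aemeasurable] at this
    exact this
  have hm : ∀ d : ℝ, ∫ u, Real.exp (d * coeff u k) ∂μ₀ =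
      Real.exp (β * eigenvalue k ^ (-α) * d ^ 2 / 2) := fun d => by
    have := mgf_gaussianReal (h.map_coeff k) d
    rw [mgf, hv, zero_mul, zero_add] at this
    exact this
  have hle : ∀ u, Real.exp (c * |coeff u k|) ≤
      Real.exp (c * coeff u k) + Real.exp (-c * coeff u k) := by
    intro u
    rcases abs_choice (coeff u k) with h | h <;> rw [h]
    · linarith [Real.exp_pos (-c * coeff u k)]
    · rw [mul_neg, ← neg_mul]
      linarith [Real.exp_pos (c * coeff u k)]
  have hint : Integrable (fun u => Real.exp (c * |coeff u k|)) μ₀ := by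
    refine ((hi c).add (hi (-c))).mono' (by fun_prop) (ae_of_all _ fun u => ?_)
    rw [Real.norm_eq_abs, Real.abs_exp]
    exact hle u
  refine ⟨hint, (integral_mono hint ((hi c).add (hi (-c))) hle).trans_eq ?_⟩
  simp only [Pi.add_apply]
  rw [integral_add (hi c) (hi (-c)), hm, hm, neg_sq]
  ring

/-- The norm `∑_k |k|^{r-2} |u_k|`. For `1 ≤ r` it dominates `tracerNorm` wherever the
series converges; elsewhere it has the default value `0`. -/
def weightedNorm (r : ℝ) (u : VelocitySpace) : ℝ := ∑' k, waveLength k ^ (r - 2) * |coeff u k|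

/-- Exponential integrability of the weighted norm under the prior. As the standard deviation of
`u_k` is of order `|k|^{-α}`, the norm is up to a constant a convex combination, with weights
proportional to `|k|^{r-2-α}`, of absolute values of normalized Gaussian variables; so Jensen's
inequality applies and independence of the coefficients is not needed. -/
theorem IsPrior.integrable_exp_weightedNorm (h : IsPrior β α μ₀) (hβ : 0 ≤ β) {r : ℝ} (hr : r < α)
    (hα : 0 ≤ α) {C : ℝ} (hC : 0 < C) :
    (∀ᵐ u ∂μ₀, Summable fun k => waveLength k ^ (r - 2) * |coeff u k|) ∧
      Integrable (fun u => Real.exp (C * weightedNorm r u)) μ₀ := by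
  have hsum := summable_waveLength_rpow (s := r - 2 - α) (by linarith)
  set P := ∑' k : WaveVector, waveLength k ^ (r - 2 - α) with hP
  have hw : ∀ k, 0 < waveLength k ^ (r - 2 - α) := fun k =>
    Real.rpow_pos_of_pos (waveLength_pos k) _
  have hP0 : 0 < P := hsum.tsum_pos (fun k => (hw k).le)
    ⟨fun _ => 1, fun h => one_ne_zero (congrFun h 0)⟩ (hw _)
  let p : WaveVector → ℝ := fun k => waveLength k ^ (r - 2 - α) / P
  have hp0 : ∀ k, 0 < p k := fun k => div_pos (hw k) hP0
  have hps : Summable p := hsum.div_const P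
  have hp1 : ∑' k, p k = 1 := by rw [tsum_div_const, ← hP, div_self hP0.ne']
  let y : WaveVector → VelocitySpace → ℝ := fun k u => (C * P * waveLength k ^ α) * |coeff u k|
  have hpy : ∀ k u, p k * y k u = C * (waveLength k ^ (r - 2) * |coeff u k|) := by
    intro k u
    have e : waveLength k ^ (r - 2 - α) * waveLength k ^ α = waveLength k ^ (r - 2) := by
      rw [← Real.rpow_add (waveLength_pos k), sub_add_cancel]
    simp only [p, y]
    rw [← e]
    field_simp
  have hy0 : ∀ k u, 0 ≤ y k u := fun k u => by
    have := Real.rpow_pos_of_pos (waveLength_pos k) α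
    positivity
  set B := 2 * Real.exp (β * (C * P) ^ 2 / 2) with hB
  have hfi : ∀ k, Integrable (fun u => p k * Real.exp (y k u)) μ₀ := fun k =>
    (h.integral_exp_abs_coeff hβ k _).1.const_mul _
  have hfb : ∀ k, ∫ u, p k * Real.exp (y k u) ∂μ₀ ≤ p k * B := by
    intro k
    rw [integral_const_mul]
    refine mul_le_mul_of_nonneg_left ((h.integral_exp_abs_coeff hβ k _).2.trans ?_) (hp0 k).le
    refine mul_le_mul_of_nonneg_left (Real.exp_le_exp.2 ?_) zero_le_two
    refine div_le_div_of_nonneg_right ?_ zero_le_two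
    have h1 : (waveLength k ^ α) ^ 2 ≤ eigenvalue k ^ α := by
      rw [← Real.rpow_natCast, ← Real.rpow_mul (waveLength_pos k).le, mul_comm α,
        Real.rpow_mul (waveLength_pos k).le, Real.rpow_natCast]
      exact Real.rpow_le_rpow (sq_nonneg _) (sq_waveLength_le_eigenvalue k) hα
    have h2 := Real.rpow_pos_of_pos (eigenvalue_pos k) α
    have h3 : eigenvalue k ^ (-α) * (waveLength k ^ α) ^ 2 ≤ 1 := by
      rw [Real.rpow_neg (eigenvalue_pos k).le, inv_mul_le_iff₀ h2, mul_one]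
      exact h1
    calc β * eigenvalue k ^ (-α) * (C * P * waveLength k ^ α) ^ 2 =
        β * (C * P) ^ 2 * (eigenvalue k ^ (-α) * (waveLength k ^ α) ^ 2) := by ring
      _ ≤ β * (C * P) ^ 2 := mul_le_of_le_one_right (by positivity) h3
  have hf0 : ∀ k u, 0 ≤ p k * Real.exp (y k u) := fun k u =>
    mul_nonneg (hp0 k).le (Real.exp_pos _).le
  have hfs : Summable fun k => ∫ u, p k * Real.exp (y k u) ∂μ₀ :=
    (hps.mul_right B).of_nonneg_of_le (fun k => integral_nonneg (hf0 k)) hfb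
  obtain ⟨h1, h2, -⟩ := integrable_tsum_of_nonneg hfi hf0 hfs
  have hsm : ∀ u, (Summable fun k => p k * Real.exp (y k u)) → Summable fun k => p k * y k u := by
    intro u hu
    refine hu.of_nonneg_of_le (fun k => mul_nonneg (hp0 k).le (hy0 k u)) fun k => ?_
    refine mul_le_mul_of_nonneg_left ?_ (hp0 k).le
    linarith [Real.add_one_le_exp (y k u)]
  refine ⟨?_, h2.mono' ?_ ?_⟩
  · filter_upwards [h1] with u hu
    have := hsm u hu
    simp_rw [hpy] at this
    exact (summable_mul_left_iff hC.ne').1 this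
  · refine AEMeasurable.aestronglyMeasurable ?_
    refine Real.measurable_exp.comp_aemeasurable (AEMeasurable.const_mul ?_ C)
    refine AEMeasurable.tsum fun k => ?_
    have := continuous_coeff k
    fun_prop
  · filter_upwards [h1] with u hu
    rw [Real.norm_eq_abs, Real.abs_exp]
    set m := C * weightedNorm r u with hm
    have hsy := hsm u hu
    have hmy : ∑' k, p k * y k u = m := by
      simp_rw [hpy]
      rw [tsum_mul_left, hm, weightedNorm]
    -- the tangent of the exponential at the mean `m`
    have htan : ∀ k, p k * (Real.exp m * (1 - m)) + Real.exp m * (p k * y k u) ≤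
        p k * Real.exp (y k u) := by
      intro k
      have h3 : Real.exp m * (1 + (y k u - m)) ≤ Real.exp (y k u) := by
        have h4 := Real.add_one_le_exp (y k u - m)
        have h5 := mul_le_mul_of_nonneg_left h4 (Real.exp_pos m).le
        rw [← Real.exp_add, add_sub_cancel, add_comm (y k u - m)] at h5
        exact h5
      calc _ = p k * (Real.exp m * (1 + (y k u - m))) := by ring
        _ ≤ _ := mul_le_mul_of_nonneg_left h3 (hp0 k).le
    have hle := ((hps.mul_right (Real.exp m * (1 - m))).add (hsy.mul_left (Real.exp m))).tsum_le_tsum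
      htan hu
    rw [(hps.mul_right _).tsum_add (hsy.mul_left _), tsum_mul_right, tsum_mul_left, hp1, hmy] at hle
    linarith

end Prior

/-! ### Stability of posterior measures -/

/-- `exp(-x²/4)`, the square root of `exp(-x²/2)`, is a 1-Lipschitz function of `x`. -/
theorem abs_exp_neg_sq_sub_le (p q : ℝ) :
    |Real.exp (-(p ^ 2 / 4)) - Real.exp (-(q ^ 2 / 4))| ≤ |p - q| := by
  have hd : ∀ x : ℝ, HasDerivAt (fun x => Real.exp (-(x ^ 2 / 4)))
      (Real.exp (-(x ^ 2 / 4)) * (-(x / 2))) x := by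
    intro x
    refine (((hasDerivAt_pow 2 x).div_const 4).fun_neg.exp).congr_deriv ?_
    push_cast
    ring
  have hL : LipschitzWith 1 fun x : ℝ => Real.exp (-(x ^ 2 / 4)) := by
    refine lipschitzWith_of_nnnorm_deriv_le (fun x => (hd x).differentiableAt) fun x => ?_
    rw [(hd x).deriv, ← NNReal.coe_le_coe, coe_nnnorm, Real.norm_eq_abs, abs_mul, Real.abs_exp,
      Real.exp_neg, NNReal.coe_one, inv_mul_le_iff₀ (Real.exp_pos _), mul_one, abs_neg]
    refine le_trans ?_ (Real.add_one_le_exp _)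
    refine abs_le.2 ⟨?_, ?_⟩ <;> nlinarith [sq_nonneg (x - 1), sq_nonneg (x + 1)]
  simpa [Real.dist_eq] using hL.dist_le_mul p q

open scoped MatrixOrder in
/-- The potential is half the square of a Lipschitz function of the predicted data, so that the
square root of the likelihood `exp(-misfit)` is Lipschitz although the potential is not. -/
theorem exists_misfit_eq {ι : Type*} [Fintype ι] [DecidableEq ι] {Γ : Matrix ι ι ℝ}
    (hΓ : Γ.PosDef) (y : ι → ℝ) :
    ∃ (ρ : (ι → ℝ) → ℝ) (C : ℝ), 0 ≤ C ∧ (∀ g, misfit Γ y g = 1 / 2 * ρ g ^ 2) ∧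
      ∀ g g', |ρ g - ρ g'| ≤ C * ‖g - g'‖ := by
  obtain ⟨Q, hQ⟩ := CStarAlgebra.nonneg_iff_eq_star_mul_self.1 hΓ.inv.posSemidef.nonneg
  let A : (ι → ℝ) →L[ℝ] EuclideanSpace ℝ ι :=
    ((EuclideanSpace.equiv ι ℝ).symm : (ι → ℝ) →L[ℝ] EuclideanSpace ℝ ι) ∘L
      (Matrix.mulVecLin Q).toContinuousLinearMap
  have hA : ∀ x, ‖A x‖ ^ 2 = x ⬝ᵥ (Γ⁻¹ *ᵥ x) := by
    intro x
    have e : A x = WithLp.toLp 2 (Q *ᵥ x) := rfl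
    rw [e, EuclideanSpace.norm_sq_eq, hQ, Matrix.star_eq_conjTranspose,
      Matrix.conjTranspose_eq_transpose_of_trivial, ← Matrix.mulVec_mulVec,
      Matrix.dotProduct_mulVec, Matrix.vecMul_transpose]
    simp [dotProduct, sq]
  refine ⟨fun g => ‖A (y - g)‖, ‖A‖, norm_nonneg _, fun g => ?_, fun g g' => ?_⟩
  · rw [misfit, hA]
  · refine (abs_norm_sub_norm_le _ _).trans ?_
    rw [← map_sub, norm_sub_rev g, sub_sub_sub_cancel_left]
    exact A.le_opNorm _

/-- Elementary estimates for normalized densities and their square roots. -/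
theorem normalized_sub_le {h h' Z Z' ζ δ κ : ℝ} (hh : 0 ≤ h ∧ h ≤ 1) (hh' : 0 ≤ h' ∧ h' ≤ 1)
    (hζ : 0 < ζ) (hζ1 : ζ ≤ 1) (hZ : ζ ≤ Z) (hZ' : ζ ≤ Z') (hδ : |h - h'| ≤ δ)
    (hκ : |Z - Z'| ≤ κ) :
    |h ^ 2 / Z - h' ^ 2 / Z'| ≤ 2 * δ / ζ + κ / ζ ^ 2 ∧
      |h / √Z - h' / √Z'| ≤ 2 * δ / ζ + κ / ζ ^ 2 := by
  have hZ0 : 0 < Z := hζ.trans_le hZ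
  have hZ0' : 0 < Z' := hζ.trans_le hZ'
  have hδ0 : 0 ≤ δ := (abs_nonneg _).trans hδ
  have hκ0 : 0 ≤ κ := (abs_nonneg _).trans hκ
  constructor
  · have e : h ^ 2 / Z - h' ^ 2 / Z' = (h - h') * (h + h') / Z + h' ^ 2 * (Z' - Z) / (Z * Z') := by
      field_simp
      ring
    rw [e]
    refine (abs_add_le _ _).trans (add_le_add ?_ ?_)
    · rw [abs_div, abs_mul, abs_of_pos hZ0, abs_of_nonneg (by linarith : 0 ≤ h + h')]
      refine div_le_div₀ (by positivity) ?_ hζ hZ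
      rw [mul_comm 2]
      exact mul_le_mul hδ (by linarith) (by linarith) hδ0
    · rw [abs_div, abs_mul, abs_of_pos (mul_pos hZ0 hZ0'), abs_of_nonneg (sq_nonneg h')]
      refine div_le_div₀ hκ0 ?_ (by positivity) ?_
      · rw [abs_sub_comm]
        exact (mul_le_of_le_one_left (abs_nonneg _) (pow_le_one₀ hh'.1 hh'.2)).trans hκ
      · rw [sq]
        exact mul_le_mul hZ hZ' hζ.le hZ0.le
  · set s := √Z with hs
    set s' := √Z' with hs'
    have hsζ : ζ ≤ s := Real.le_sqrt_of_sq_le (by nlinarith)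
    have hsζ' : ζ ≤ s' := Real.le_sqrt_of_sq_le (by nlinarith)
    have hs0 : 0 < s := hζ.trans_le hsζ
    have hs0' : 0 < s' := hζ.trans_le hsζ'
    have hsZ : s ^ 2 = Z := Real.sq_sqrt hZ0.le
    have hsZ' : s' ^ 2 = Z' := Real.sq_sqrt hZ0'.le
    have e : h / s - h' / s' = (h - h') / s + h' * (Z' - Z) / (s * s' * (s + s')) := by
      rw [← hsZ, ← hsZ']
      field_simp
      ring
    rw [e]
    refine (abs_add_le _ _).trans (add_le_add ?_ ?_)
    · rw [abs_div, abs_of_pos hs0]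
      exact div_le_div₀ (by positivity) (by linarith) hζ hsζ
    · rw [abs_div, abs_mul, abs_of_pos (by positivity : 0 < s * s' * (s + s')),
        abs_of_nonneg hh'.1]
      refine div_le_div₀ hκ0 ?_ (by positivity) ?_
      · rw [abs_sub_comm]
        exact (mul_le_of_le_one_left (abs_nonneg _) hh'.2).trans hκ
      · -- `s s' ≥ ζ` and `s + s' ≥ ζ`
        have h1 : ζ ≤ s * s' := by
          rw [hs, hs', ← Real.sqrt_mul hZ0.le]
          exact Real.le_sqrt_of_sq_le (by rw [sq]; exact mul_le_mul hZ hZ' hζ.le hZ0.le)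
        rw [sq]
        exact mul_le_mul h1 (by linarith) hζ.le (by positivity)

section Posterior

variable {μ₀ : Measure VelocitySpace} [IsProbabilityMeasure μ₀] {Φ : VelocitySpace → ℝ}

theorem integrable_exp_neg (hΦ : AEMeasurable Φ μ₀) (hΦ0 : ∀ u, 0 ≤ Φ u) :
    Integrable (fun u => Real.exp (-Φ u)) μ₀ := by
  refine Integrable.of_bound (C := 1) ?_ (ae_of_all _ fun u => ?_)
  · exact (Real.measurable_exp.comp_aemeasurable hΦ.neg).aestronglyMeasurable
  · rw [Real.norm_eq_abs, Real.abs_exp]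
    exact Real.exp_le_one_iff.2 (neg_nonpos.2 (hΦ0 u))

theorem integrable_tilted_neg {E : Type*} [NormedAddCommGroup E] [NormedSpace ℝ E]
    (hΦ : AEMeasurable Φ μ₀) (hΦ0 : ∀ u, 0 ≤ Φ u) {g : VelocitySpace → E} (hg : Integrable g μ₀) :
    Integrable g (μ₀.tilted fun u => -Φ u) := by
  rw [integrable_tilted_iff (integrable_exp_neg hΦ hΦ0)]
  refine hg.bdd_smul 1 (integrable_exp_neg hΦ hΦ0).aestronglyMeasurable (ae_of_all _ fun u => ?_)
  rw [Real.norm_eq_abs, Real.abs_exp]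
  exact Real.exp_le_one_iff.2 (neg_nonpos.2 (hΦ0 u))

theorem isProbabilityMeasure_tilted_neg (hΦ : AEMeasurable Φ μ₀) (hΦ0 : ∀ u, 0 ≤ Φ u) :
    IsProbabilityMeasure (μ₀.tilted fun u => -Φ u) :=
  isProbabilityMeasure_tilted (integrable_exp_neg hΦ hΦ0)

theorem memLp_two_tilted_neg (hΦ : AEMeasurable Φ μ₀) (hΦ0 : ∀ u, 0 ≤ Φ u) (h2 : MemLp id 2 μ₀) :
    MemLp id 2 (μ₀.tilted fun u => -Φ u) := by
  rw [memLp_two_iff_integrable_sq_norm aestronglyMeasurable_id]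
  exact integrable_tilted_neg hΦ hΦ0 ((memLp_two_iff_integrable_sq_norm aestronglyMeasurable_id).1 h2)

/-- The covariance operator in terms of second moments and the mean. -/
theorem inner_covOp {μ : Measure VelocitySpace} [IsProbabilityMeasure μ] (h2 : MemLp id 2 μ)
    (x y : VelocitySpace) :
    ⟪covOp μ x, y⟫ = ∫ u, ⟪x, u⟫ * ⟪y, u⟫ ∂μ - ⟪x, mean μ⟫ * ⟪y, mean μ⟫ := by
  have hid : Integrable (fun u : VelocitySpace => u) μ := h2.integrable (by norm_num)
  have hx : ∀ x : VelocitySpace, MemLp (fun u => ⟪x, u⟫) 2 μ := fun x =>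
    (innerSL ℝ x).comp_memLp' h2
  have hxi : ∀ x : VelocitySpace, Integrable (fun u => ⟪x, u⟫) μ := fun x =>
    (hx x).integrable (by norm_num)
  have hm : ∀ x : VelocitySpace, ∫ u, ⟪x, u⟫ ∂μ = ⟪x, mean μ⟫ := fun x => integral_inner hid x
  have hmeas : Measurable fun u : VelocitySpace => u - mean μ := by fun_prop
  have h2' : MemLp id 2 (μ.map fun u => u - mean μ) := by
    rw [memLp_map_measure_iff aestronglyMeasurable_id hmeas.aemeasurable]
    exact h2.sub (memLp_const _)
  rw [covOp, covarianceOperator_inner h2', integral_map hmeas.aemeasurable (by fun_prop)]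
  have hxy : Integrable (fun u => ⟪x, u⟫ * ⟪y, u⟫) μ := (hx x).integrable_mul (hx y)
  have e : ∀ u, ⟪x, u - mean μ⟫ * ⟪y, u - mean μ⟫ = ⟪x, u⟫ * ⟪y, u⟫ -
      (⟪y, mean μ⟫ * ⟪x, u⟫ + (⟪x, mean μ⟫ * ⟪y, u⟫ - ⟪x, mean μ⟫ * ⟪y, mean μ⟫)) := fun u => by
    rw [inner_sub_right, inner_sub_right]
    ring
  have h1 : Integrable (fun u => ⟪y, mean μ⟫ * ⟪x, u⟫) μ := (hxi x).const_mul _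
  have h3 : Integrable (fun u => ⟪x, mean μ⟫ * ⟪y, u⟫) μ := (hxi y).const_mul _
  have h4 : Integrable (fun u => ⟪x, mean μ⟫ * ⟪y, u⟫ - ⟪x, mean μ⟫ * ⟪y, mean μ⟫) μ :=
    h3.sub (integrable_const _)
  have h5 : Integrable (fun u => ⟪y, mean μ⟫ * ⟪x, u⟫ +
      (⟪x, mean μ⟫ * ⟪y, u⟫ - ⟪x, mean μ⟫ * ⟪y, mean μ⟫)) μ := h1.add h4
  simp_rw [e]
  rw [integral_sub hxy h5, integral_add h1 h4, integral_sub h3 (integrable_const _),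
    integral_const_mul, integral_const_mul, hm, hm]
  simp
  ring

/-- If the square roots of the likelihoods differ by at most `ε_n W` with `W` square integrable and
`ε_n → 0`, then the normalization constants are bounded away from zero, and the posterior
densities, as well as their square roots, differ by at most `ε_n R` with `R` square integrable. -/
theorem exists_density_bound (hΦ : AEMeasurable Φ μ₀) (hΦ0 : ∀ u, 0 ≤ Φ u)
    {Ψ : ℕ → VelocitySpace → ℝ} (hΨ : ∀ n, AEMeasurable (Ψ n) μ₀) (hΨ0 : ∀ n u, 0 ≤ Ψ n u)
    {W : VelocitySpace → ℝ} (hW0 : ∀ u, 0 ≤ W u) (hW : MemLp W 2 μ₀) {ε : ℕ → ℝ}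
    (hε : Tendsto ε atTop (𝓝 0))
    (hd : ∀ n, ∀ᵐ u ∂μ₀, |Real.exp (-(Φ u / 2)) - Real.exp (-(Ψ n u / 2))| ≤ ε n * W u) :
    ∃ (ζ : ℝ) (R : VelocitySpace → ℝ), 0 < ζ ∧ ζ ≤ ∫ u, Real.exp (-Φ u) ∂μ₀ ∧
      (∀ n, ζ ≤ ∫ u, Real.exp (-Ψ n u) ∂μ₀) ∧ (∀ u, 0 ≤ R u) ∧ MemLp R 2 μ₀ ∧
      ∀ n, ∀ᵐ u ∂μ₀,
        |Real.exp (-Φ u) / (∫ u, Real.exp (-Φ u) ∂μ₀) -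
          Real.exp (-Ψ n u) / (∫ u, Real.exp (-Ψ n u) ∂μ₀)| ≤ ε n * R u ∧
        |√(Real.exp (-Φ u) / (∫ u, Real.exp (-Φ u) ∂μ₀)) -
          √(Real.exp (-Ψ n u) / (∫ u, Real.exp (-Ψ n u) ∂μ₀))| ≤ ε n * R u := by
  have hWi : Integrable W μ₀ := hW.integrable (by norm_num)
  set Z := ∫ u, Real.exp (-Φ u) ∂μ₀ with hZ
  set Zn : ℕ → ℝ := fun n => ∫ u, Real.exp (-Ψ n u) ∂μ₀ with hZn
  have hZ0 : 0 < Z := integral_exp_pos (integrable_exp_neg hΦ hΦ0)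
  have hZn0 : ∀ n, 0 < Zn n := fun n => integral_exp_pos (integrable_exp_neg (hΨ n) (hΨ0 n))
  have hsq : ∀ p : ℝ, Real.exp (-p) = Real.exp (-(p / 2)) ^ 2 := fun p => by
    rw [← Real.exp_nat_mul]
    congr 1
    push_cast
    ring
  have hle1 : ∀ p : ℝ, 0 ≤ p → 0 ≤ Real.exp (-(p / 2)) ∧ Real.exp (-(p / 2)) ≤ 1 := fun p hp =>
    ⟨(Real.exp_pos _).le, Real.exp_le_one_iff.2 (by linarith)⟩
  -- the normalization constants
  have hZd : ∀ n, |Z - Zn n| ≤ ε n * (2 * ∫ u, W u ∂μ₀) := by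
    intro n
    rw [hZ, hZn, ← integral_sub (integrable_exp_neg hΦ hΦ0) (integrable_exp_neg (hΨ n) (hΨ0 n)),
      ← Real.norm_eq_abs, ← integral_const_mul, ← integral_const_mul]
    refine norm_integral_le_of_norm_le ((hWi.const_mul 2).const_mul _) ?_
    filter_upwards [hd n] with u hu
    rw [Real.norm_eq_abs, hsq, hsq (Ψ n u), sq_sub_sq, abs_mul]
    have ha := hle1 _ (hΦ0 u)
    have hb := hle1 _ (hΨ0 n u)
    rw [abs_of_nonneg (add_nonneg ha.1 hb.1)]
    have := mul_le_mul (by linarith [ha.2, hb.2] : Real.exp (-(Φ u / 2)) + Real.exp (-(Ψ n u / 2)) ≤ 2)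
      hu (abs_nonneg _) zero_le_two
    linarith
  have hZlim : Tendsto Zn atTop (𝓝 Z) := by
    rw [tendsto_iff_norm_sub_tendsto_zero]
    have h0 : Tendsto (fun n => ε n * (2 * ∫ u, W u ∂μ₀)) atTop (𝓝 0) := by
      simpa using hε.mul_const (2 * ∫ u, W u ∂μ₀)
    refine squeeze_zero (fun _ => norm_nonneg _) (fun n => ?_) h0
    rw [Real.norm_eq_abs, abs_sub_comm]
    exact hZd n
  -- they are positive and converge to a positive number, so they are bounded below
  obtain ⟨ζ, hζ, hζ1, hζZ, hζn⟩ : ∃ ζ : ℝ, 0 < ζ ∧ ζ ≤ 1 ∧ ζ ≤ Z ∧ ∀ n, ζ ≤ Zn n := by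
    obtain ⟨b, hb⟩ := (hZlim.inv₀ hZ0.ne').bddAbove_range
    have hbn : ∀ n, (Zn n)⁻¹ ≤ b := fun n => hb (mem_range_self n)
    have hb0 : 0 < b := (inv_pos.2 (hZn0 0)).trans_le (hbn 0)
    refine ⟨min (min 1 Z) b⁻¹, by positivity, (min_le_left _ _).trans (min_le_left _ _),
      (min_le_left _ _).trans (min_le_right _ _), fun n => (min_le_right _ _).trans ?_⟩
    exact inv_le_of_inv_le₀ (hZn0 n) (hbn n)
  set R : VelocitySpace → ℝ := fun u => 2 * W u / ζ + (2 * ∫ u, W u ∂μ₀) / ζ ^ 2 with hR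
  have hW1 : 0 ≤ ∫ u, W u ∂μ₀ := integral_nonneg hW0
  have hR0 : ∀ u, 0 ≤ R u := fun u => by
    have := hW0 u
    positivity
  have hR2 : MemLp R 2 μ₀ := by
    refine MemLp.add ?_ (memLp_const _)
    have := (hW.const_mul 2).mul_const ζ⁻¹
    simpa [div_eq_mul_inv] using this
  have hdens : ∀ n, ∀ᵐ u ∂μ₀, |Real.exp (-Φ u) / Z - Real.exp (-Ψ n u) / Zn n| ≤ ε n * R u ∧
      |√(Real.exp (-Φ u) / Z) - √(Real.exp (-Ψ n u) / Zn n)| ≤ ε n * R u := by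
    intro n
    filter_upwards [hd n] with u hu
    have h1 := normalized_sub_le (hle1 _ (hΦ0 u)) (hle1 _ (hΨ0 n u)) hζ hζ1 hζZ (hζn n) hu (hZd n)
    have e : 2 * (ε n * W u) / ζ + ε n * (2 * ∫ u, W u ∂μ₀) / ζ ^ 2 = ε n * R u := by
      simp only [hR]
      ring
    rw [e] at h1
    rw [hsq (Φ u), hsq (Ψ n u), Real.sqrt_div (sq_nonneg _), Real.sqrt_div (sq_nonneg _),
      Real.sqrt_sq (Real.exp_pos _).le, Real.sqrt_sq (Real.exp_pos _).le]
    exact h1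
  exact ⟨ζ, R, hζ, hζZ, hζn, hR0, hR2, hdens⟩

section Pair

variable {Ψ R : VelocitySpace → ℝ} {ε : ℝ}

/-- A bound for the difference of the integrals of a function against two posteriors. -/
theorem norm_integral_tilted_sub_le {E : Type*} [NormedAddCommGroup E] [NormedSpace ℝ E]
    (hΦ : AEMeasurable Φ μ₀) (hΦ0 : ∀ u, 0 ≤ Φ u) (hΨ : AEMeasurable Ψ μ₀) (hΨ0 : ∀ u, 0 ≤ Ψ u)
    (hd : ∀ᵐ u ∂μ₀, |Real.exp (-Φ u) / (∫ u, Real.exp (-Φ u) ∂μ₀) -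
      Real.exp (-Ψ u) / (∫ u, Real.exp (-Ψ u) ∂μ₀)| ≤ ε * R u)
    {g : VelocitySpace → E} (hg : Integrable g μ₀) (hRg : Integrable (fun u => R u * ‖g u‖) μ₀) :
    ‖∫ u, g u ∂(μ₀.tilted fun u => -Φ u) - ∫ u, g u ∂(μ₀.tilted fun u => -Ψ u)‖ ≤
      ε * ∫ u, R u * ‖g u‖ ∂μ₀ := by
  have hi : ∀ {Θ : VelocitySpace → ℝ}, AEMeasurable Θ μ₀ → (∀ u, 0 ≤ Θ u) → ∀ c : ℝ,
      Integrable (fun u => (Real.exp (-Θ u) / c) • g u) μ₀ := by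
    intro Θ hΘ hΘ0 c
    have := (integrable_tilted_iff (integrable_exp_neg hΘ hΘ0) g).1
      (integrable_tilted_neg hΘ hΘ0 hg)
    refine (this.smul c⁻¹).congr (ae_of_all _ fun u => ?_)
    simp only [Pi.smul_apply]
    rw [smul_smul, mul_comm, div_eq_mul_inv]
  rw [integral_tilted, integral_tilted, ← integral_sub (hi hΦ hΦ0 _) (hi hΨ hΨ0 _),
    ← integral_const_mul]
  refine norm_integral_le_of_norm_le (hRg.const_mul _) ?_
  filter_upwards [hd] with u hu
  rw [← sub_smul, norm_smul, Real.norm_eq_abs, ← mul_assoc]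
  exact mul_le_mul_of_nonneg_right hu (norm_nonneg _)

theorem norm_mean_tilted_neg_le {μ₀ : Measure VelocitySpace}
    (h1 : Integrable (fun u : VelocitySpace => u) μ₀)
    (hΦ0 : ∀ u, 0 ≤ Φ u) {ζ : ℝ} (hζ : 0 < ζ) (hζΦ : ζ ≤ ∫ u, Real.exp (-Φ u) ∂μ₀) :
    ‖mean (μ₀.tilted fun u => -Φ u)‖ ≤ ∫ u : VelocitySpace, ζ⁻¹ * ‖u‖ ∂μ₀ := by
  rw [mean, integral_tilted]
  refine norm_integral_le_of_norm_le (h1.norm.const_mul _) (ae_of_all _ fun u => ?_)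
  rw [norm_smul, Real.norm_eq_abs, abs_of_nonneg (div_nonneg (Real.exp_pos _).le
    (hζ.le.trans hζΦ))]
  refine mul_le_mul_of_nonneg_right ?_ (norm_nonneg _)
  rw [← one_div]
  exact div_le_div₀ zero_le_one (Real.exp_le_one_iff.2 (neg_nonpos.2 (hΦ0 u))) hζ hζΦ

theorem inner_mul_inner_sub_le {x y m m' : VelocitySpace} {M δ : ℝ} (hm : ‖m‖ ≤ M)
    (hm' : ‖m'‖ ≤ M) (hδ : ‖m - m'‖ ≤ δ) :
    ⟪x, m'⟫ * ⟪y, m'⟫ - ⟪x, m⟫ * ⟪y, m⟫ ≤ ‖x‖ * ‖y‖ * (2 * M * δ) := by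
  have hδ0 : 0 ≤ δ := (norm_nonneg _).trans hδ
  have hM0 : 0 ≤ M := (norm_nonneg _).trans hm
  rw [norm_sub_rev] at hδ
  have e : ⟪x, m'⟫ * ⟪y, m'⟫ - ⟪x, m⟫ * ⟪y, m⟫ =
      ⟪x, m' - m⟫ * ⟪y, m'⟫ + ⟪x, m⟫ * ⟪y, m' - m⟫ := by
    rw [inner_sub_right, inner_sub_right]
    ring
  have hb : ∀ (z p : VelocitySpace) {b : ℝ}, ‖p‖ ≤ b → |⟪z, p⟫| ≤ ‖z‖ * b := fun z p b hp =>
    (abs_real_inner_le_norm _ _).trans (mul_le_mul_of_nonneg_left hp (norm_nonneg _))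
  have h1 : ⟪x, m' - m⟫ * ⟪y, m'⟫ ≤ (‖x‖ * δ) * (‖y‖ * M) := by
    refine (le_abs_self _).trans ?_
    rw [abs_mul]
    exact mul_le_mul (hb _ _ hδ) (hb _ _ hm') (abs_nonneg _) (by positivity)
  have h2 : ⟪x, m⟫ * ⟪y, m' - m⟫ ≤ (‖x‖ * M) * (‖y‖ * δ) := by
    refine (le_abs_self _).trans ?_
    rw [abs_mul]
    exact mul_le_mul (hb _ _ hm) (hb _ _ hδ) (abs_nonneg _) (by positivity)
  rw [e]
  linarith

theorem norm_covOp_tilted_sub_le (h2 : MemLp id 2 μ₀)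
    (hΦ : AEMeasurable Φ μ₀) (hΦ0 : ∀ u, 0 ≤ Φ u) (hΨ : AEMeasurable Ψ μ₀) (hΨ0 : ∀ u, 0 ≤ Ψ u)
    (hε : 0 ≤ ε) (hR0 : ∀ u, 0 ≤ R u) (hRm : AEStronglyMeasurable R μ₀)
    (hR2 : Integrable (fun u => R u * ‖u‖ ^ 2) μ₀)
    (hd : ∀ᵐ u ∂μ₀, |Real.exp (-Φ u) / (∫ u, Real.exp (-Φ u) ∂μ₀) -
      Real.exp (-Ψ u) / (∫ u, Real.exp (-Ψ u) ∂μ₀)| ≤ ε * R u) {M I : ℝ} (hI : 0 ≤ I)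
    (hM : ‖mean (μ₀.tilted fun u => -Φ u)‖ ≤ M) (hM' : ‖mean (μ₀.tilted fun u => -Ψ u)‖ ≤ M)
    (hmean : ‖mean (μ₀.tilted fun u => -Φ u) - mean (μ₀.tilted fun u => -Ψ u)‖ ≤ ε * I) :
    ‖covOp (μ₀.tilted fun u => -Φ u) - covOp (μ₀.tilted fun u => -Ψ u)‖ ≤
      ((∫ u, R u * ‖u‖ ^ 2 ∂μ₀) + 2 * M * I) * ε := by
  have hp1 := isProbabilityMeasure_tilted_neg hΦ hΦ0
  have hp2 := isProbabilityMeasure_tilted_neg hΨ hΨ0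
  have hn2 : Integrable (fun u : VelocitySpace => ‖u‖ ^ 2) μ₀ :=
    (memLp_two_iff_integrable_sq_norm aestronglyMeasurable_id).1 h2
  have hM0 : 0 ≤ M := (norm_nonneg _).trans hM
  set I₂ := ∫ u : VelocitySpace, R u * ‖u‖ ^ 2 ∂μ₀
  have hI₂ : 0 ≤ I₂ := integral_nonneg fun u => mul_nonneg (hR0 u) (sq_nonneg _)
  have hB0 : 0 ≤ (I₂ + 2 * M * I) * ε := by positivity
  have hform : ∀ x y : VelocitySpace, ⟪(covOp (μ₀.tilted fun u => -Φ u) -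
      covOp (μ₀.tilted fun u => -Ψ u)) x, y⟫ ≤ (I₂ + 2 * M * I) * ε * (‖x‖ * ‖y‖) := by
    intro x y
    rw [sub_apply, inner_sub_left, inner_covOp (memLp_two_tilted_neg hΦ hΦ0 h2),
      inner_covOp (memLp_two_tilted_neg hΨ hΨ0 h2)]
    have hgb : ∀ u : VelocitySpace, ‖⟪x, u⟫ * ⟪y, u⟫‖ ≤ ‖x‖ * ‖y‖ * ‖u‖ ^ 2 := fun u => by
      rw [norm_mul]
      calc _ ≤ (‖x‖ * ‖u‖) * (‖y‖ * ‖u‖) :=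
            mul_le_mul (norm_inner_le_norm _ _) (norm_inner_le_norm _ _) (norm_nonneg _)
              (by positivity)
        _ = _ := by ring
    have hgm : AEStronglyMeasurable (fun u : VelocitySpace => ⟪x, u⟫ * ⟪y, u⟫) μ₀ :=
      Continuous.aestronglyMeasurable (by fun_prop)
    have hg : Integrable (fun u : VelocitySpace => ⟪x, u⟫ * ⟪y, u⟫) μ₀ :=
      (hn2.const_mul (‖x‖ * ‖y‖)).mono' hgm (ae_of_all _ hgb)
    have hRgb : ∀ u : VelocitySpace, R u * ‖⟪x, u⟫ * ⟪y, u⟫‖ ≤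
        ‖x‖ * ‖y‖ * (R u * ‖u‖ ^ 2) := fun u =>
      (mul_le_mul_of_nonneg_left (hgb u) (hR0 u)).trans_eq (by ring)
    have hRg : Integrable (fun u : VelocitySpace => R u * ‖⟪x, u⟫ * ⟪y, u⟫‖) μ₀ := by
      refine (hR2.const_mul (‖x‖ * ‖y‖)).mono' (hRm.mul hgm.norm) (ae_of_all _ fun u => ?_)
      rw [Real.norm_eq_abs, abs_of_nonneg (mul_nonneg (hR0 u) (norm_nonneg _))]
      exact hRgb u
    have h1 := (le_abs_self _).trans (norm_integral_tilted_sub_le hΦ hΦ0 hΨ hΨ0 hd hg hRg)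
    have h3 : ∫ u, R u * ‖⟪x, u⟫ * ⟪y, u⟫‖ ∂μ₀ ≤ ‖x‖ * ‖y‖ * I₂ := by
      rw [← integral_const_mul]
      exact integral_mono hRg (hR2.const_mul _) hRgb
    have h5 := mul_le_mul_of_nonneg_left h3 hε
    have h6 := inner_mul_inner_sub_le (x := x) (y := y) hM hM' hmean
    linarith
  refine ContinuousLinearMap.opNorm_le_bound _ hB0 fun x => ?_
  -- test the form with `y = D x`, where `D` is the difference of the covariance operators
  set D := covOp (μ₀.tilted fun u => -Φ u) - covOp (μ₀.tilted fun u => -Ψ u)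
  have h := hform x (D x)
  rw [real_inner_self_eq_norm_sq] at h
  rcases (norm_nonneg (D x)).eq_or_lt with h0 | h0
  · rw [← h0]
    positivity
  · rw [sq, ← mul_assoc] at h
    exact le_of_mul_le_mul_right h h0

theorem toReal_rnDeriv_tilted_neg (hΦ : AEMeasurable Φ μ₀)
    (hpos : 0 ≤ ∫ u, Real.exp (-Φ u) ∂μ₀) :
    ∀ᵐ u ∂μ₀, ((μ₀.tilted fun u => -Φ u).rnDeriv μ₀ u).toReal =
      Real.exp (-Φ u) / ∫ u, Real.exp (-Φ u) ∂μ₀ := by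
  have h : AEMeasurable (fun u => -Φ u) μ₀ := hΦ.neg
  filter_upwards [rnDeriv_tilted_left_self h] with u hu
  rw [hu, ENNReal.toReal_ofReal (div_nonneg (Real.exp_pos _).le hpos)]

theorem hellinger_tilted_le (hΦ : AEMeasurable Φ μ₀) (hΨ : AEMeasurable Ψ μ₀) (hε : 0 ≤ ε)
    (hR2 : Integrable (fun u => R u ^ 2) μ₀)
    (hd : ∀ᵐ u ∂μ₀, |√(Real.exp (-Φ u) / (∫ u, Real.exp (-Φ u) ∂μ₀)) -
      √(Real.exp (-Ψ u) / (∫ u, Real.exp (-Ψ u) ∂μ₀))| ≤ ε * R u) :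
    hellinger μ₀ (μ₀.tilted fun u => -Φ u) (μ₀.tilted fun u => -Ψ u) ≤
      √(∫ u, R u ^ 2 ∂μ₀) * ε := by
  rw [← Real.sqrt_sq hε, ← Real.sqrt_mul' _ (sq_nonneg _), hellinger]
  refine Real.sqrt_le_sqrt ?_
  have h1 : ∫ u, (√((μ₀.tilted fun u => -Φ u).rnDeriv μ₀ u).toReal -
      √((μ₀.tilted fun u => -Ψ u).rnDeriv μ₀ u).toReal) ^ 2 ∂μ₀ ≤
      (∫ u, R u ^ 2 ∂μ₀) * ε ^ 2 := by
    rw [← integral_mul_const]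
    refine integral_mono_of_nonneg (ae_of_all _ fun u => sq_nonneg _) (hR2.mul_const _) ?_
    have hpos : ∀ Θ : VelocitySpace → ℝ, 0 ≤ ∫ u, Real.exp (-Θ u) ∂μ₀ := fun Θ =>
      integral_nonneg fun u => (Real.exp_pos _).le
    filter_upwards [toReal_rnDeriv_tilted_neg hΦ (hpos Φ), toReal_rnDeriv_tilted_neg hΨ (hpos Ψ), hd]
      with u h1 h2 h3
    simp only [h1, h2]
    rw [← sq_abs, ← mul_pow, mul_comm (R u)]
    exact pow_le_pow_left₀ (abs_nonneg _) h3 2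
  have h2 : 0 ≤ ∫ u, (√((μ₀.tilted fun u => -Φ u).rnDeriv μ₀ u).toReal -
      √((μ₀.tilted fun u => -Ψ u).rnDeriv μ₀ u).toReal) ^ 2 ∂μ₀ :=
    integral_nonneg fun u => sq_nonneg _
  linarith

end Pair

/-- If the square roots of the likelihoods differ by at most `ε_n W` with `W` square integrable and
`ε_n → 0`, then Hellinger distances, means and covariance operators of the posteriors differ
by `O(ε_n)`. -/
theorem posterior_stability (h4 : MemLp id 4 μ₀) (hΦ : AEMeasurable Φ μ₀) (hΦ0 : ∀ u, 0 ≤ Φ u)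
    {Ψ : ℕ → VelocitySpace → ℝ} (hΨ : ∀ n, AEMeasurable (Ψ n) μ₀) (hΨ0 : ∀ n u, 0 ≤ Ψ n u)
    {W : VelocitySpace → ℝ} (hW0 : ∀ u, 0 ≤ W u) (hW : MemLp W 2 μ₀) {ε : ℕ → ℝ}
    (hε0 : ∀ n, 0 ≤ ε n) (hε : Tendsto ε atTop (𝓝 0))
    (hd : ∀ n, ∀ᵐ u ∂μ₀, |Real.exp (-(Φ u / 2)) - Real.exp (-(Ψ n u / 2))| ≤ ε n * W u) :
    ∃ c : ℝ, 0 < c ∧ ∀ n,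
      hellinger μ₀ (μ₀.tilted fun u => -Φ u) (μ₀.tilted fun u => -Ψ n u) ≤ c * ε n ∧
      ‖mean (μ₀.tilted fun u => -Φ u) - mean (μ₀.tilted fun u => -Ψ n u)‖ ≤ c * ε n ∧
      ‖covOp (μ₀.tilted fun u => -Φ u) - covOp (μ₀.tilted fun u => -Ψ n u)‖ ≤ c * ε n := by
  have h2 : MemLp id 2 μ₀ := h4.mono_exponent (by norm_num)
  have hid : Integrable (fun u : VelocitySpace => u) μ₀ := h2.integrable (by norm_num)
  obtain ⟨ζ, R, hζ, hζΦ, hζΨ, hR0, hR2, hdens⟩ :=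
    exists_density_bound hΦ hΦ0 hΨ hΨ0 hW0 hW hε hd
  have hRsq : Integrable (fun u => R u ^ 2) μ₀ := hR2.integrable_sq
  have hn2 : Integrable (fun u : VelocitySpace => ‖u‖ ^ 2) μ₀ :=
    (memLp_two_iff_integrable_sq_norm aestronglyMeasurable_id).1 h2
  have hn4 : Integrable (fun u : VelocitySpace => ‖u‖ ^ 4) μ₀ :=
    MemLp.integrable_norm_pow (p := 4) (by exact_mod_cast h4) (by norm_num)
  have hRm := hR2.aestronglyMeasurable
  have hRn : Integrable (fun u : VelocitySpace => R u * ‖u‖) μ₀ := by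
    refine (hRsq.add hn2).mono' (hRm.mul continuous_norm.aestronglyMeasurable)
      (ae_of_all _ fun u => ?_)
    rw [Real.norm_eq_abs, abs_of_nonneg (mul_nonneg (hR0 u) (norm_nonneg _))]
    simp only [Pi.add_apply]
    nlinarith [sq_nonneg (R u - ‖u‖), sq_nonneg (R u + ‖u‖)]
  have hRn2 : Integrable (fun u : VelocitySpace => R u * ‖u‖ ^ 2) μ₀ := by
    refine (hRsq.add hn4).mono' (hRm.mul (continuous_norm.pow 2).aestronglyMeasurable)
      (ae_of_all _ fun u => ?_)
    rw [Real.norm_eq_abs, abs_of_nonneg (mul_nonneg (hR0 u) (sq_nonneg _))]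
    simp only [Pi.add_apply]
    nlinarith [sq_nonneg (R u - ‖u‖ ^ 2), sq_nonneg (R u + ‖u‖ ^ 2)]
  have hmean : ∀ n, ‖mean (μ₀.tilted fun u => -Φ u) - mean (μ₀.tilted fun u => -Ψ n u)‖ ≤
      ε n * ∫ u, R u * ‖u‖ ∂μ₀ := fun n =>
    norm_integral_tilted_sub_le hΦ hΦ0 (hΨ n) (hΨ0 n) ((hdens n).mono fun _ h => h.1) hid hRn
  set m₀ := ∫ u : VelocitySpace, ζ⁻¹ * ‖u‖ ∂μ₀ with hm₀
  have hm₀0 : 0 ≤ m₀ := integral_nonneg fun u => mul_nonneg (inv_pos.2 hζ).le (norm_nonneg _)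
  set I₁ := ∫ u : VelocitySpace, R u * ‖u‖ ∂μ₀
  have hI₁ : 0 ≤ I₁ := integral_nonneg fun u => mul_nonneg (hR0 u) (norm_nonneg _)
  have hcov := fun n => norm_covOp_tilted_sub_le h2 hΦ hΦ0 (hΨ n) (hΨ0 n) (hε0 n) hR0 hRm hRn2
    ((hdens n).mono fun _ h => h.1) hI₁ (norm_mean_tilted_neg_le hid hΦ0 hζ hζΦ)
    (norm_mean_tilted_neg_le hid (hΨ0 n) hζ (hζΨ n)) (hmean n)
  have hhell := fun n => hellinger_tilted_le hΦ (hΨ n) (hε0 n) hRsq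
    ((hdens n).mono fun _ h => h.2)
  set s₀ := √(∫ u, R u ^ 2 ∂μ₀)
  set I₂ := ∫ u : VelocitySpace, R u * ‖u‖ ^ 2 ∂μ₀
  have hs₀ : 0 ≤ s₀ := Real.sqrt_nonneg _
  have hI₂ : 0 ≤ I₂ := integral_nonneg fun u => mul_nonneg (hR0 u) (sq_nonneg _)
  have hI₃ : 0 ≤ I₂ + 2 * m₀ * I₁ := by positivity
  refine ⟨s₀ + I₁ + (I₂ + 2 * m₀ * I₁) + 1, by positivity, fun n => ⟨?_, ?_, ?_⟩⟩
  · exact (hhell n).trans (mul_le_mul_of_nonneg_right (by linarith) (hε0 n))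
  · refine (hmean n).trans ?_
    rw [mul_comm]
    exact mul_le_mul_of_nonneg_right (by linarith) (hε0 n)
  · exact (hcov n).trans (mul_le_mul_of_nonneg_right (by linarith) (hε0 n))

end Posterior

/-! ### Approximation and measurability of the forward map -/

theorem isRegular_of_summable {r : ℝ} (hr : 1 ≤ r) {u : VelocitySpace}
    (hu : Summable fun k => waveLength k ^ (r - 2) * |coeff u k|) :
    IsRegular u ∧ tracerNorm u ≤ weightedNorm r u := by
  have hle : ∀ k, |coeff u k| / waveLength k ≤ waveLength k ^ (r - 2) * |coeff u k| := fun k => by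
    rw [div_eq_inv_mul, ← Real.rpow_neg_one]
    exact mul_le_mul_of_nonneg_right
      (Real.rpow_le_rpow_of_exponent_le (one_le_waveLength k) (by linarith)) (abs_nonneg _)
  have hs : IsRegular u := Summable.of_nonneg_of_le
    (fun k => div_nonneg (abs_nonneg _) (waveLength_pos k).le) hle hu
  exact ⟨hs, hs.tsum_le_tsum hle hu⟩

theorem isRegular_spectralProj (N : ℕ) (u : VelocitySpace) : IsRegular (spectralProj N u) := by
  refine summable_of_ne_finset_zero (s := (finite_waveVectors N).toFinset) fun k hk => ?_
  have h : ¬ waveLength k ≤ N := fun h => hk ((finite_waveVectors N).mem_toFinset.2 h)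
  rw [coeff_spectralProj, if_neg h, abs_zero, zero_div]

/-- The rate of convergence of the truncations in the norm that controls the tracers. -/
theorem tsum_abs_coeff_sub_spectralProj_le {r : ℝ} {u : VelocitySpace}
    (hr : 0 ≤ r) (hu : Summable fun k => waveLength k ^ (r - 2) * |coeff u k|)
    {N : ℕ} (hN : 1 ≤ N) :
    ∑' k, |coeff u k - coeff (spectralProj N u) k| / waveLength k ^ 2 ≤
      (N : ℝ) ^ (-r) * weightedNorm r u := by
  have hN0 : (0 : ℝ) < N := by exact_mod_cast hN
  have hle : ∀ k, |coeff u k - coeff (spectralProj N u) k| / waveLength k ^ 2 ≤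
      (N : ℝ) ^ (-r) * (waveLength k ^ (r - 2) * |coeff u k|) := by
    intro k
    have hk := waveLength_pos k
    rw [coeff_spectralProj]
    split_ifs with h
    · rw [sub_self, abs_zero, zero_div]
      positivity
    · rw [sub_zero, div_eq_inv_mul, ← mul_assoc]
      refine mul_le_mul_of_nonneg_right ?_ (abs_nonneg _)
      have e : (waveLength k ^ 2)⁻¹ = waveLength k ^ (-r) * waveLength k ^ (r - 2) := by
        rw [← Real.rpow_add hk, ← Real.rpow_natCast, ← Real.rpow_neg hk.le]
        congr 1
        push_cast
        ring
      rw [e]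
      exact mul_le_mul_of_nonneg_right
        (Real.rpow_le_rpow_of_nonpos hN0 (not_le.1 h).le (neg_nonpos.2 hr)) (by positivity)
  rw [weightedNorm, ← tsum_mul_left]
  exact (Summable.of_nonneg_of_le (fun k => by positivity) hle
    (hu.mul_left _)).tsum_le_tsum hle (hu.mul_left _)

theorem tsum_abs_coeff_div_sq_le (u : VelocitySpace) :
    ∑' k, |coeff u k| / waveLength k ^ 2 ≤ √(∑' k : WaveVector, waveLength k ^ (-4 : ℝ)) * ‖u‖ := by
  have hs := summable_waveLength_rpow (s := -4) (by norm_num)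
  have hc := hasSum_sq_coeff u
  refine Real.tsum_le_of_sum_le (fun k => by positivity) fun F => ?_
  refine le_of_sq_le_sq ?_ (by positivity)
  rw [mul_pow, Real.sq_sqrt (tsum_nonneg fun k => Real.rpow_nonneg (waveLength_pos k).le _)]
  have e : ∀ k : WaveVector, |coeff u k| / waveLength k ^ 2 = (waveLength k ^ 2)⁻¹ * |coeff u k| :=
    fun k => div_eq_inv_mul _ _
  simp_rw [e]
  refine (Finset.sum_mul_sq_le_sq_mul_sq _ _ _).trans (mul_le_mul ?_ ?_
    (Finset.sum_nonneg fun k _ => sq_nonneg _) (tsum_nonneg fun k =>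
      Real.rpow_nonneg (waveLength_pos k).le _))
  · have e2 : ∀ k : WaveVector, ((waveLength k ^ 2)⁻¹) ^ 2 = waveLength k ^ (-4 : ℝ) := fun k => by
      rw [Real.rpow_neg (waveLength_pos k).le, inv_pow, ← pow_mul]
      norm_cast
    simp_rw [e2]
    exact hs.sum_le_tsum _ fun k _ => Real.rpow_nonneg (waveLength_pos k).le _
  · simp_rw [sq_abs]
    rw [← hc.tsum_eq]
    exact hc.summable.sum_le_tsum _ fun k _ => sq_nonneg _

section ForwardMap

variable {ν γ T : ℝ} {ψ : ℝ → VelocitySpace}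

/-- The forward map is continuous on the closed sets where the norm controlling the tracers is
bounded; these exhaust the regular initial velocities, so the forward map is almost everywhere
measurable whenever almost all initial velocities are regular. -/
theorem aemeasurable_forwardMap_comp (hν : 0 < ν) (hγ : 0 < γ) (hT : 0 ≤ T)
    (hψ : ContinuousInHs γ T ψ) {J K : ℕ} (a : Fin J → Plane) {t : Fin K → ℝ}
    (ht : ∀ k, t k ∈ Ioc 0 T) {μ₀ : Measure VelocitySpace} {P : VelocitySpace → VelocitySpace}
    (hP : Continuous P) (hreg : ∀ᵐ u ∂μ₀, IsRegular (P u)) :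
    AEMeasurable (fun u => forwardMap ν T ψ a t (P u)) μ₀ := by
  let D : ℕ → Set VelocitySpace := fun M =>
    {u | ∀ F : Finset WaveVector, ∑ k ∈ F, |coeff (P u) k| / waveLength k ≤ M}
  have hDc : ∀ M, IsClosed (D M) := fun M => by
    simp only [D, ofPred_forall]
    refine isClosed_iInter fun F => isClosed_le ?_ continuous_const
    exact continuous_finsetSum _ fun k _ => ((continuous_coeff k).comp hP).abs.div_const _
  have hDr : ∀ M, ∀ u ∈ D M, IsRegular (P u) ∧ tracerNorm (P u) ≤ M := fun M u hu => by
    have h0 : ∀ k, 0 ≤ |coeff (P u) k| / waveLength k := fun k =>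
      div_nonneg (abs_nonneg _) (waveLength_pos k).le
    exact ⟨summable_of_sum_le h0 hu, Real.tsum_le_of_sum_le h0 hu⟩
  have hcont : ∀ M, ContinuousOn (fun u => forwardMap ν T ψ a t (P u)) (D M) := by
    intro M u hu
    set B := √(∑' k : WaveVector, waveLength k ^ (-4 : ℝ)) / ν *
      Real.exp ((M + forcingNorm T ψ) / ν)
    rw [ContinuousWithinAt, tendsto_iff_norm_sub_tendsto_zero]
    have h0 : Tendsto (fun u' => B * ‖P u - P u'‖) (𝓝[D M] u) (𝓝 0) := by
      have : Tendsto (fun u' => B * ‖P u - P u'‖) (𝓝 u) (𝓝 (B * ‖P u - P u‖)) :=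
        (continuous_const.mul (continuous_const.sub hP).norm).tendsto u
      rw [sub_self, norm_zero, mul_zero] at this
      exact this.mono_left nhdsWithin_le_nhds
    refine squeeze_zero' (Eventually.of_forall fun _ => norm_nonneg _) ?_ h0
    filter_upwards [self_mem_nhdsWithin] with u' hu'
    rw [norm_sub_rev]
    refine (norm_forwardMap_sub_le hν hγ hT hψ a ht (hDr M u hu).1 (hDr M u' hu').1).trans ?_
    have h1 := tsum_abs_coeff_div_sq_le (P u - P u')
    simp_rw [coeff_sub] at h1
    have h2 : Real.exp ((tracerNorm (P u) + forcingNorm T ψ) / ν) ≤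
        Real.exp ((M + forcingNorm T ψ) / ν) := by
      have := (hDr M u hu).2
      gcongr
    calc _ ≤ √(∑' k : WaveVector, waveLength k ^ (-4 : ℝ)) * ‖P u - P u'‖ / ν *
          Real.exp ((M + forcingNorm T ψ) / ν) := by gcongr
      _ = B * ‖P u - P u'‖ := by ring
  have hU := aemeasurable_iUnion_iff.2 fun M =>
    (hcont M).aemeasurable (μ := μ₀) (hDc M).measurableSet
  rwa [Measure.restrict_eq_self_of_ae_mem] at hU
  filter_upwards [hreg] with u hu
  obtain ⟨M, hM⟩ := exists_nat_ge (tracerNorm (P u))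
  exact mem_iUnion.2 ⟨M, fun F => (hu.sum_le_tsum F fun k _ =>
    div_nonneg (abs_nonneg _) (waveLength_pos k).le).trans hM⟩

theorem measurable_misfit {ι : Type*} [Fintype ι] [DecidableEq ι] (Γ : Matrix ι ι ℝ) (y : ι → ℝ) :
    Measurable (misfit Γ y) := by
  refine Continuous.measurable ?_
  unfold misfit
  have h : Continuous fun g : ι → ℝ => y - g := continuous_const.sub continuous_id
  exact continuous_const.mul (h.dotProduct (continuous_const.matrix_mulVec h))

/-- The square root of the likelihood depends on the truncation of the initial velocity only up
to `N^{-r}` times a function all of whose powers are integrable under the prior. -/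
theorem abs_sqrt_likelihood_sub_le (hν : 0 < ν) (hγ : 0 < γ) (hT : 0 ≤ T)
    (hψ : ContinuousInHs γ T ψ) {J K : ℕ} (a : Fin J → Plane) {t : Fin K → ℝ}
    (ht : ∀ k, t k ∈ Ioc 0 T)
    {Γ : Matrix (Fin J × Fin K × Fin 2) (Fin J × Fin K × Fin 2) ℝ} (hΓ : Γ.PosDef)
    (y : Fin J × Fin K × Fin 2 → ℝ) :
    ∃ B : ℝ, 0 ≤ B ∧ ∀ r : ℝ, 1 ≤ r → ∀ u : VelocitySpace,
      (Summable fun k => waveLength k ^ (r - 2) * |coeff u k|) → ∀ N : ℕ, 1 ≤ N →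
      |Real.exp (-(misfit Γ y (forwardMap ν T ψ a t u) / 2)) -
        Real.exp (-(misfit Γ y (forwardMap ν T ψ a t (spectralProj N u)) / 2))| ≤
      (N : ℝ) ^ (-r) * (B * Real.exp ((1 + 1 / ν) * weightedNorm r u)) := by
  obtain ⟨ρ, C, hC, hρ, hL⟩ := exists_misfit_eq hΓ y
  refine ⟨C / ν * Real.exp (forcingNorm T ψ / ν), by positivity, fun r hr u hu N hN => ?_⟩
  obtain ⟨hreg, hle⟩ := isRegular_of_summable hr hu
  have e : ∀ g, -(misfit Γ y g / 2) = -(ρ g ^ 2 / 4) := fun g => by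
    rw [hρ]
    ring
  rw [e, e]
  refine (abs_exp_neg_sq_sub_le _ _).trans ((hL _ _).trans ?_)
  have h1 := norm_forwardMap_sub_le hν hγ hT hψ a ht hreg (isRegular_spectralProj N u)
  have h2 := tsum_abs_coeff_sub_spectralProj_le (zero_le_one.trans hr) hu hN
  -- the factor `S_r(u)` is absorbed into the exponential
  have h3 : weightedNorm r u ≤ Real.exp (weightedNorm r u) :=
    (by linarith : weightedNorm r u ≤ weightedNorm r u + 1).trans (Real.add_one_le_exp _)
  have hN0 : (0 : ℝ) ≤ (N : ℝ) ^ (-r) := by positivity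
  calc C * ‖forwardMap ν T ψ a t u - forwardMap ν T ψ a t (spectralProj N u)‖
      ≤ C * ((N : ℝ) ^ (-r) * Real.exp (weightedNorm r u) / ν *
          Real.exp ((weightedNorm r u + forcingNorm T ψ) / ν)) := by
        refine mul_le_mul_of_nonneg_left (h1.trans ?_) hC
        have h4 := h2.trans (mul_le_mul_of_nonneg_left h3 hN0)
        gcongr
    _ = (N : ℝ) ^ (-r) * (C / ν * Real.exp (forcingNorm T ψ / ν) *
          Real.exp ((1 + 1 / ν) * weightedNorm r u)) := by
        rw [add_div, Real.exp_add, add_mul, one_mul, Real.exp_add, one_div_mul_eq_div]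
        ring

end ForwardMap

end StokesDA

end

open StokesDA
theorem theorem4p3
    (ν : ℝ) (hν : 0 < ν) (T : ℝ) (hT : 0 < T)
    (γ : ℝ) (hγ : 0 < γ) (ψ : ℝ → VelocitySpace) (hψ : ContinuousInHs γ T ψ)
    (J K : ℕ) (a : Fin J → Plane) (t : Fin K → ℝ) (ht : ∀ k, t k ∈ Set.Ioc 0 T)
    (Γ : Matrix (Fin J × Fin K × Fin 2) (Fin J × Fin K × Fin 2) ℝ) (hΓ : Γ.PosDef)
    (y : Fin J × Fin K × Fin 2 → ℝ)
    (β α : ℝ) (hβ : 0 < β) (hα : 1 < α)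
    (μ₀ : Measure VelocitySpace) (hμ₀ : IsPrior β α μ₀)
    (μ : Measure VelocitySpace) (hμ : μ = posteriorMeasure μ₀ Γ y (forwardMap ν T ψ a t))
    (μN : ℕ → Measure VelocitySpace)
    (hμN : ∀ N, μN N = posteriorMeasure μ₀ Γ y (forwardMap ν T ψ a t ∘ spectralProj N)) :
    (∀ᵐ u ∂μ₀, ∀ j, HasUniqueTracer ν T ψ u (a j) ∧
        ∀ N, HasUniqueTracer ν T ψ (spectralProj N u) (a j)) ∧
      (IsProbabilityMeasure μ ∧ MemLp id 2 μ) ∧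
      (∀ N, IsProbabilityMeasure (μN N) ∧ MemLp id 2 (μN N)) ∧
      ∀ q : ℝ, q < α - 1 → ∃ c : ℝ, 0 < c ∧ ∀ N : ℕ, 1 ≤ N →
        hellinger μ₀ μ (μN N) ≤ c * (N : ℝ) ^ (-q) ∧
        ‖mean μ - mean (μN N)‖ ≤ c * (N : ℝ) ^ (-q) ∧
        ‖covOp μ - covOp (μN N)‖ ≤ c * (N : ℝ) ^ (-q) := by
  have := hμ₀.gaussian
  have hreg : ∀ᵐ u ∂μ₀, IsRegular u := by
    filter_upwards [(hμ₀.integrable_exp_weightedNorm hβ.le hα (by linarith) one_pos).1] with u hu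
    exact (isRegular_of_summable le_rfl hu).1
  have hmis : ∀ g, 0 ≤ misfit Γ y g := fun g => by
    obtain ⟨ρ, C, -, hρ, -⟩ := exists_misfit_eq hΓ y
    rw [hρ]
    positivity
  have hΦ : AEMeasurable (fun u => misfit Γ y (forwardMap ν T ψ a t u)) μ₀ :=
    (measurable_misfit Γ y).comp_aemeasurable
      (aemeasurable_forwardMap_comp hν hγ hT.le hψ a ht continuous_id hreg)
  have hΨ : ∀ N : ℕ,
      AEMeasurable (fun u => misfit Γ y (forwardMap ν T ψ a t (spectralProj N u))) μ₀ := fun N =>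
    (measurable_misfit Γ y).comp_aemeasurable
      (aemeasurable_forwardMap_comp hν hγ hT.le hψ a ht (spectralProj N).continuous
        (ae_of_all _ fun u => isRegular_spectralProj N u))
  have hμ' : μ = μ₀.tilted fun u => -misfit Γ y (forwardMap ν T ψ a t u) := hμ
  have hμN' : ∀ N, μN N =
      μ₀.tilted fun u => -misfit Γ y (forwardMap ν T ψ a t (spectralProj N u)) := hμN
  have h2 : MemLp id 2 μ₀ := IsGaussian.memLp_two_id
  refine ⟨?_, ⟨?_, ?_⟩, fun N => ⟨?_, ?_⟩, fun q hq => ?_⟩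
  · filter_upwards [hreg] with u hu j
    exact ⟨hasUniqueTracer hν hγ hT.le hψ hu (a j), fun N =>
      hasUniqueTracer hν hγ hT.le hψ (isRegular_spectralProj N u) (a j)⟩
  · rw [hμ']
    exact isProbabilityMeasure_tilted_neg hΦ fun u => hmis _
  · rw [hμ']
    exact memLp_two_tilted_neg hΦ (fun u => hmis _) h2
  · rw [hμN']
    exact isProbabilityMeasure_tilted_neg (hΨ N) fun u => hmis _
  · rw [hμN']
    exact memLp_two_tilted_neg (hΨ N) (fun u => hmis _) h2
  · -- the argument works for every exponent in `[1, α)`, and a larger exponent is better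
    set r := max 1 q with hr
    have hr1 : 1 ≤ r := le_max_left _ _
    have hrα : r < α := max_lt hα (by linarith)
    obtain ⟨B, hB, hlik⟩ := abs_sqrt_likelihood_sub_le hν hγ hT.le hψ a ht hΓ y
    obtain ⟨hsum, hint⟩ := hμ₀.integrable_exp_weightedNorm hβ.le hrα (by linarith)
      (by positivity : 0 < 1 + 1 / ν)
    -- the square of the dominating function doubles the exponent
    have hint2 := (hμ₀.integrable_exp_weightedNorm hβ.le hrα (by linarith)
      (by positivity : 0 < 2 * (1 + 1 / ν))).2
    have hW : MemLp (fun u => B * Real.exp ((1 + 1 / ν) * weightedNorm r u)) 2 μ₀ := by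
      refine MemLp.const_mul ?_ B
      rw [memLp_two_iff_integrable_sq hint.aestronglyMeasurable]
      refine hint2.congr (ae_of_all _ fun u => ?_)
      simp only
      rw [← Real.exp_nat_mul, mul_assoc]
      norm_cast
    -- the index is shifted because the bound concerns `N ≥ 1`
    have hε : Tendsto (fun n : ℕ => ((n + 1 : ℕ) : ℝ) ^ (-r)) atTop (𝓝 0) :=
      (tendsto_rpow_neg_atTop (zero_lt_one.trans_le hr1)).comp
        (tendsto_natCast_atTop_atTop.comp (tendsto_add_atTop_nat 1))
    obtain ⟨c, hc, hbound⟩ := posterior_stability (IsGaussian.memLp_id μ₀ 4 (by norm_num)) hΦ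
      (fun u => hmis _) (fun n => hΨ (n + 1)) (fun n u => hmis _)
      (fun u => mul_nonneg hB (Real.exp_pos _).le) hW
      (fun n => Real.rpow_nonneg (Nat.cast_nonneg _) _) hε fun n => by
        filter_upwards [hsum] with u hu
        exact hlik r hr1 u hu (n + 1) (Nat.le_add_left 1 n)
    refine ⟨c, hc, fun N hN => ?_⟩
    obtain ⟨n, rfl⟩ := Nat.exists_eq_add_of_le' hN
    have hle : c * ((n + 1 : ℕ) : ℝ) ^ (-r) ≤ c * ((n + 1 : ℕ) : ℝ) ^ (-q) :=
      mul_le_mul_of_nonneg_left (Real.rpow_le_rpow_of_exponent_le (by exact_mod_cast hN)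
        (neg_le_neg (le_max_right _ _))) hc.le
    rw [hμ', hμN']
    exact ⟨(hbound n).1.trans hle, (hbound n).2.1.trans hle, (hbound n).2.2.trans hle⟩
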